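/- **Claim A$_k$ (preparation of a verified level-$k$ ancilla), $k\ge 1$.** *Noise.* Each physical CNOT gate fails independently with probability $p$, and then a Pauli product on its two qubits, drawn from a fixed but arbitrary distribution on $\{I,X,Y,Z\}^{\otimes 2}$, is applied after the perfect gate. Everything else (preparation of $|0\rangle$, Hadamard and Pauli gates, measurement, memory, classical control) is perfect. Pauli errors are recorded (up to phase) and propagated through the CNOT gates. *Code.* Let $n=7$ and concatenate the $[[7,1,3]]$ Steane code, so that a block$_k$ consists of $n$ blocks$_{k-1}$ and a block$_0$ is a qubit. The state$_0$ of a qubit is its recorded Pauli error; the state$_k$ of a block$_k$ is the Pauli operator obtained by error-free Steane decoding of the states$_{k-1}$ of its subblocks. The relative states$_{k-1}$ of its subblocks are given by the minimum-weight error ($Y$ counted as two) with the same Steane syndrome as these states$_{k-1}$; a subblock is in relative error if its relative state is not $I$. Every block$_0$ is well$_0$. A block$_k$ is well$_k(q_1,\dots,q_k)$ if, conditioned on its state$_k$ and on the errors in all other blocks, there is a random label (possibly hidden) that is either empty or names one "uncontrolled" subblock, such that the label is non-empty with probability at most $q_k$ and, conditioned on the label, every subblock not named by it is not in relative error and is well$_{k-1}(q_1,\dots,q_{k-1})$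 (where the other subblocks count among the "other blocks"). *Operations.* CNOT$_0$ is the physical gate and Correction$_0$ does nothing. CNOT$_k$ is transverse CNOT$_{k-1}$ followed by Correction$_k$ on both blocks. Correction$_k$ consists of two identical rounds. Each round is: transverse Correction$_{k-1}$; transverse CNOT$_{k-1}$ into a fresh $|+\rangle_k$, which is then measured in the computational basis and decoded recursively, and transverse $X$ applied to the subblock found in relative $X$ error, if any; then the dual step with transverse CNOT$_{k-1}$ from a fresh $|0\rangle_k$, measurement in the $\pm$ basis and transverse $Z$. The ancilla $|0\rangle_0$ is perfect, and $|+\rangle_k$ is obtained from $|0\rangle_k$ by a transverse Hadamard gate. An unverified $|0\rangle_k$ is prepared from seven ancillas$_{k-1}$, with $|+\rangle_{k-1}$ in positions $1,2,4$ and $|0\rangle_{k-1}$ in the others, by the $s=9$ gates CNOT$_{k-1}$ with (control, target) $=(1,3),(1,5),(1,7),(2,3),(2,6),(2,7),(4,5),(4,6),(4,7)$, followed by transverse Correction$_{k-1}$. To prepare $|0\rangle_k$, make two unverified copies, apply transverse CNOT$_{k-1}$ from the first to the second, measure the second in the computational basis and decode it recursively; accept if no subblock has a relative $X$ component and the state$_k$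 has no $X$ component, otherwise discard both and start again. The output is the first copy; if the $Z$ component of its state$_k$ is non-trivial, its recorded error is multiplied by the transverse $Z$ operator, which fixes $|0\rangle_k$. *Parameters.* $A_0=B_0=0$, $C_0=p$, and for $k\ge1$ $$N_k=1-2nA_{k-1}-2nB_{k-1}-(2s+n)C_{k-1},$$ $$A_k=\frac{\binom{2n}2(A_{k-1}^2+B_{k-1}^2)+\binom{2s+n}2C_{k-1}^2+2n(2s+n)(A_{k-1}+B_{k-1})C_{k-1}+4n^2A_{k-1}B_{k-1}}{N_k},$$ $$a_k=\frac{2n(A_{k-1}+B_{k-1})+(2s+n)C_{k-1}}{(1-A_k)N_k},$$ $$\sigma_k=4a_k+2nB_{k-1}+4nC_{k-1},\qquad B'_k=4A_k+\sigma_k,\qquad b_k=\frac{\sigma_k}{1-B'_k},$$ $$B_k=4A_k+\tbinom{4n}2C_{k-1}^2+\tbinom42a_k^2+\tbinom{2n}2B_{k-1}^2+b_k\sigma_k+4nC_{k-1}(4a_k+2nB_{k-1})+8na_kB_{k-1},$$ $$C_k=2B_k+2nC_{k-1}B'_k+\tbinom n2C_{k-1}^2+2b_k(2B'_k+nC_{k-1})+b_k^2.$$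 *Claim.* Let $k\ge1$ and let $0\le p\le1$ be in the parameter range where $N_j>0$ and $A_j<1$ for $1\le j\le k$, and $B_j\le B'_j<1$ for $1\le j<k$. Then: 1. The noiseless circuit (run on ideal level-$(k-1)$ logical states) brings the two copies to $|0\rangle_k\otimes|0\rangle_k$, and the bookkeeping step does not change the physical state: an error and its reduced record act identically on $|0\rangle_k$. 2. Each attempt is accepted with probability at least $N_k$. 3. Conditioned on acceptance, there is a (hidden) failure event of probability at most $A_k$ such that, conditioned on no failure, the output ancilla has state$_k$ $I$ and is well$_k(b_1,\dots,b_{k-1},a_k)$. -/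

import Mathlib

open scoped NNReal ENNReal Matrix

noncomputable section

namespace FT

/-! ### Blocks of the concatenated seven-qubit code -/

/-- `Nest α k` is the type of `7 ^ k`-tuples of elements of `α`, arranged in `k` levels of blocks of
seven. -/
def Nest (α : Type) : ℕ → Type
  | 0 => α
  | k + 1 => Fin 7 → Nest α k

@[reducible]
def nestAddCommGroup (α : Type) [AddCommGroup α] : (k : ℕ) → AddCommGroup (Nest α k)
  | 0 => inferInstanceAs (AddCommGroup α)
  | k + 1 =>
    letI := nestAddCommGroup α k
    inferInstanceAs (AddCommGroup (Fin 7 → Nest α k))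

instance (α : Type) [AddCommGroup α] (k : ℕ) : AddCommGroup (Nest α k) := nestAddCommGroup α k

/-- A single-qubit Pauli operator up to phase, `(x, z)` standing for `X ^ x * Z ^ z`: thus
`I = (0, 0)`, `X = (1, 0)`, `Z = (0, 1)`, `Y = (1, 1)`, and multiplication is addition. -/
abbrev Pauli : Type := ZMod 2 × ZMod 2

/-- A recorded error on a level-`k` block: one Pauli operator on each of the `7 ^ k` qubits. -/
abbrev Block (k : ℕ) : Type := Nest Pauli k

/-- Classical bit strings on the qubits of a level-`k` block. -/
abbrev Bits (k : ℕ) : Type := Nest (ZMod 2) k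

/-- The same element of `α` at each of the `7 ^ k` positions (a transverse operator). -/
def fill {α : Type} (a : α) : (k : ℕ) → Nest α k
  | 0 => a
  | k + 1 => fun _ => fill a k

/-- How a transverse Hadamard gate acts on recorded errors: it exchanges `X` and `Z`. -/
def had : (k : ℕ) → Block k → Block k
  | 0, e => (e.2, e.1)
  | k + 1, e => fun i => had k (e i)

/-! ### The Steane code, states and relative states -/

/-- The parity checks `IIIZZZZ`, `IZZIIZZ`, `ZIZIZIZ`; the three `X` generators have the same
supports. -/
def parityCheck : Matrix (Fin 3) (Fin 7) (ZMod 2) :=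
  !![0, 0, 0, 1, 1, 1, 1; 0, 1, 1, 0, 0, 1, 1; 1, 0, 1, 0, 1, 0, 1]

/-- The lowest-weight binary error with the same syndrome as `x` (see `relBits_spec`). -/
def relBits (x : Fin 7 → ZMod 2) : Fin 7 → ZMod 2 :=
  fun i => if parityCheck *ᵥ x = fun r => parityCheck r i then 1 else 0

/-- The logical bit of `x` after correction: as the stabilizers have even weight and the logical
operator is transverse, it is the parity of the corrected word. -/
def logicalBit (x : Fin 7 → ZMod 2) : ZMod 2 := ∑ i, (x i + relBits x i)

/-- The relative errors of seven Pauli operators: the error of least weight, with `Y` counted as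
two, that generates the same syndrome (see `relPauli_spec`). -/
def relPauli (w : Fin 7 → Pauli) : Fin 7 → Pauli :=
  fun i => (relBits (fun j => (w j).1) i, relBits (fun j => (w j).2) i)

/-- Error-free decoding of seven Pauli operators. -/
def decodePauli (w : Fin 7 → Pauli) : Pauli :=
  (logicalBit fun j => (w j).1, logicalBit fun j => (w j).2)

/-- The state of a block, by bottom-up recursive error-free decoding. -/
def state : (k : ℕ) → Block k → Pauli
  | 0, e => e
  | k + 1, e => decodePauli fun i => state k (e i)

/-- The relative state of the `i`-th subblock of a block. -/
def relState {k : ℕ} (e : Block (k + 1)) (i : Fin 7) : Pauli :=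
  relPauli (fun j => state k (e j)) i

def weight (x : Fin 7 → ZMod 2) : ℕ := ∑ i, (x i).val

theorem relBits_self (y : Fin 7 → ZMod 2) : parityCheck *ᵥ relBits y = parityCheck *ᵥ y ∧
    weight (relBits y) ≤ weight y ∧ (weight (relBits y) = weight y → relBits y = y) := by
  revert y
  decide +kernel

/-- `relBits x` is the unique binary error of least weight with the syndrome of `x`. -/
theorem relBits_spec (x : Fin 7 → ZMod 2) : parityCheck *ᵥ relBits x = parityCheck *ᵥ x ∧
    ∀ y, parityCheck *ᵥ y = parityCheck *ᵥ x →
      weight (relBits x) ≤ weight y ∧ (weight (relBits x) = weight y → relBits x = y) := by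
  refine ⟨(relBits_self x).1, fun y hy => ?_⟩
  have h : relBits x = relBits y := by unfold relBits; rw [hy]
  rw [h]
  exact (relBits_self y).2

/-- `relPauli w` has the same `Z` and `X` syndromes as `w`, and every other Pauli error `v` with
these syndromes has larger weight, `Y` being counted as two. -/
theorem relPauli_spec (w : Fin 7 → Pauli) :
    (parityCheck *ᵥ (fun i => (relPauli w i).1) = parityCheck *ᵥ (fun i => (w i).1) ∧
      parityCheck *ᵥ (fun i => (relPauli w i).2) = parityCheck *ᵥ (fun i => (w i).2)) ∧
    ∀ v : Fin 7 → Pauli, parityCheck *ᵥ (fun i => (v i).1) = parityCheck *ᵥ (fun i => (w i).1) →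
      parityCheck *ᵥ (fun i => (v i).2) = parityCheck *ᵥ (fun i => (w i).2) → v ≠ relPauli w →
      weight (fun i => (relPauli w i).1) + weight (fun i => (relPauli w i).2) <
        weight (fun i => (v i).1) + weight (fun i => (v i).2) := by
  have h1 := relBits_spec fun i => (w i).1
  have h2 := relBits_spec fun i => (w i).2
  refine ⟨⟨h1.1, h2.1⟩, fun v hv1 hv2 hne => ?_⟩
  have a1 := h1.2 _ hv1
  have a2 := h2.2 _ hv2
  by_contra hlt
  apply hne
  change ¬ weight (relBits fun i => (w i).1) + weight (relBits fun i => (w i).2) <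
    weight (fun i => (v i).1) + weight (fun i => (v i).2) at hlt
  have e1 := a1.2 (by omega)
  have e2 := a2.2 (by omega)
  funext i
  exact Prod.ext (congrFun e1 i).symm (congrFun e2 i).symm

/-! ### Probability -/

open Classical in
/-- The conditional law of `μ` given the event `S` (and `μ` itself if `S` has probability zero). -/
def condOn {α : Type} (μ : PMF α) (S : Set α) : PMF α :=
  if h : ∃ a ∈ S, a ∈ μ.support then μ.filter S h else μ

/-- The joint law of independent samples, the `i`-th one from `f i`. -/
def indep {α : Type} : {n : ℕ} → (Fin n → PMF α) → PMF (Fin n → α)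
  | 0, _ => PMF.pure Fin.elim0
  | _ + 1, f => (f 0).bind fun a => (indep fun i => f i.succ).map fun v => Fin.cons a v

/-- A coin that shows `true` with probability `p`. -/
def coin (p : ℝ≥0) (hp : p ≤ 1) : PMF Bool :=
  PMF.ofFintype (fun c => if c then (p : ℝ≥0∞) else 1 - p) (by
    simp [add_tsub_cancel_of_le (ENNReal.coe_le_one_iff.mpr hp)])

/-- `Well q k ν`: a level-`k` block is well with parameters `q 1, …, q k`, where `ν` is the law of
the errors in the block conditioned on the errors in all other blocks.  Conditioned further on the
state `s` of the block there is a (possibly empty) random label `u`, naming the uncontrolled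
subblock if there is one, such that `P(u ≠ none) ≤ q k` and such that every subblock `i` not named
by `u` is not in relative error and is itself well, conditioned on the errors in the other
subblocks.  There is no condition on a single qubit. -/
def Well (q : ℕ → ℝ) : (k : ℕ) → PMF (Block k) → Prop
  | 0, _ => True
  | k + 1, ν => ∀ s : Pauli, (∃ e ∈ ν.support, state (k + 1) e = s) →
      ∃ (label : PMF (Option (Fin 7))) (law : Option (Fin 7) → PMF (Block (k + 1))),
        condOn ν {e | state (k + 1) e = s} = label.bind law ∧
        ∑ i, (label (some i)).toReal ≤ q (k + 1) ∧
        ∀ u ∈ label.support, ∀ i : Fin 7, u ≠ some i → ∀ e ∈ (law u).support,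
          relState e i = 0 ∧
          Well q k ((condOn (law u) {e' | ∀ j, j ≠ i → e' j = e j}).map fun e' => e' i)

/-! ### The noisy procedures

All procedures act on recorded Pauli errors, which are propagated through the circuit; a
measurement reveals the part of the recorded error that anticommutes with the measured operators. -/

/-- The three noisy operations at level `k`: the law of the errors in a prepared ancilla `|0⟩`, and
error correction and the CNOT gate (first argument the control), as random maps on errors. -/
structure Gadgets (k : ℕ) where
  anc : PMF (Block k)
  ec : Block k → PMF (Block k)
  cnot : Block k → Block k → PMF (Block k × Block k)

/-- Propagation through a perfect CNOT gate: `X` is copied forward and `Z` backward. -/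
def propagate (e f : Pauli) : Pauli × Pauli := ((e.1, e.2 + f.2), (e.1 + f.1, f.2))

/-- A physical CNOT gate: with probability `p` it fails, and then a Pauli product drawn from `err`
is applied after the perfect gate. -/
def physicalCNOT (p : ℝ≥0) (hp : p ≤ 1) (err : PMF (Pauli × Pauli)) (e f : Pauli) :
    PMF (Pauli × Pauli) :=
  (coin p hp).bind fun failed =>
    if failed then err.map fun P => propagate e f + P else PMF.pure (propagate e f)

section Level

variable {k : ℕ} (G : Gadgets k)

/-- Which of the seven subblocks start in `|+⟩` in the encoding circuit; the others start
in `|0⟩`. -/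
def startsPlus : Fin 7 → Bool := ![true, true, false, true, false, false, false]

/-- The nine CNOT gates (control, target) of the encoding circuit, in order. -/
def encoder : List (Fin 7 × Fin 7) :=
  [(0, 2), (0, 4), (0, 6), (1, 2), (1, 5), (1, 6), (3, 4), (3, 5), (3, 6)]

/-- Apply CNOT gates between subblocks of one block, in order. -/
def applyCNOTs : List (Fin 7 × Fin 7) → Block (k + 1) → PMF (Block (k + 1))
  | [], e => PMF.pure e
  | (c, t) :: L, e => (G.cnot (e c) (e t)).bind fun r =>
      applyCNOTs L (Function.update (Function.update e c r.1) t r.2)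

/-- Transverse CNOT gates from the block `e` to the block `f`. -/
def transverseCNOT (e f : Block (k + 1)) : PMF (Block (k + 1) × Block (k + 1)) :=
  (indep fun i => G.cnot (e i) (f i)).map fun r => (fun i => (r i).1, fun i => (r i).2)

/-- Transverse error correction of the subblocks. -/
def transverseEC (e : Block (k + 1)) : PMF (Block (k + 1)) := indep fun i => G.ec (e i)

/-- An unverified ancilla: seven lower-level ancillas `|0⟩` or `|+⟩` (the latter by a transverse
Hadamard gate), the encoding circuit, transverse error correction. -/
def unverified : PMF (Block (k + 1)) :=
  (indep fun i => if startsPlus i then G.anc.map (had k) else G.anc).bind fun e =>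
    (applyCNOTs G encoder e).bind fun e => transverseEC G e

/-- One attempt: two unverified ancillas and transverse CNOT gates from the first to the second. -/
def attempt : PMF (Block (k + 1) × Block (k + 1)) :=
  (unverified G).bind fun e => (unverified G).bind fun f => transverseCNOT G e f

/-- The attempt is accepted: the transverse measurement of the second block in the computational
basis, decoded recursively, shows no `X` component in any relative state nor in the state. -/
def accepted (k : ℕ) : Set (Block (k + 1) × Block (k + 1)) :=
  {r | (∀ i, (relState r.2 i).1 = 0) ∧ (state (k + 1) r.2).1 = 0}

/-- Bookkeeping for the ancilla `|0⟩`, which the logical `Z` fixes: if the state has a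
`Z` component, multiply the recorded error by the transverse `Z`. -/
def reduceZ {k : ℕ} (e : Block k) : Block k := e + fill (0, (state k e).2) k

/-- The verified ancilla: attempts are repeated until one is accepted, so its law is conditioned on
acceptance. -/
def verified : PMF (Block (k + 1)) :=
  (condOn (attempt G) (accepted k)).map fun r => reduceZ r.1

/-- `X` correction: transverse CNOT gates into a fresh `|+⟩`, whose transverse measurement in the
computational basis, decoded recursively, tells to which subblock a transverse `X` is applied. -/
def correctX (anc : PMF (Block (k + 1))) (e : Block (k + 1)) : PMF (Block (k + 1)) :=
  (anc.map (had (k + 1))).bind fun a => (transverseCNOT G e a).map fun r =>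
    fun i => r.1 i + fill ((relState r.2 i).1, 0) k

/-- `Z` correction: transverse CNOT gates from a fresh `|0⟩`, whose transverse measurement in the
dual basis, decoded recursively, tells to which subblock a transverse `Z` is applied. -/
def correctZ (anc : PMF (Block (k + 1))) (e : Block (k + 1)) : PMF (Block (k + 1)) :=
  anc.bind fun a => (transverseCNOT G a e).map fun r =>
    fun i => r.2 i + fill (0, (relState r.1 i).2) k

/-- One of the two identical halves of error correction. -/
def halfEC (anc : PMF (Block (k + 1))) (e : Block (k + 1)) : PMF (Block (k + 1)) :=
  (transverseEC G e).bind fun e => (correctX G anc e).bind fun e => correctZ G anc e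

def nextEC (e : Block (k + 1)) : PMF (Block (k + 1)) :=
  (halfEC G (verified G) e).bind fun e => halfEC G (verified G) e

def nextCNOT (e f : Block (k + 1)) : PMF (Block (k + 1) × Block (k + 1)) :=
  (transverseCNOT G e f).bind fun r =>
    (nextEC G r.1).bind fun e => (nextEC G r.2).map fun f => (e, f)

end Level

/-- The noisy operations at each level of concatenation.  At level `0` preparation is perfect,
there is no error correction, and the CNOT gate is the physical one. -/
def gadgets (p : ℝ≥0) (hp : p ≤ 1) (err : PMF (Pauli × Pauli)) : (k : ℕ) → Gadgets k
  | 0 => ⟨PMF.pure (0 : Pauli), fun e => PMF.pure e, physicalCNOT p hp err⟩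
  | k + 1 =>
    let G := gadgets p hp err k
    ⟨verified G, nextEC G, nextCNOT G⟩

/-! ### The ideal ancilla -/

/-- The logical basis state `|b⟩` of a level-`k` block, as a vector of amplitudes: at level `k + 1`
it is the uniform superposition of the words of the Hamming code of parity `b`, each bit encoded at
level `k`. -/
def codeKet : (k : ℕ) → ZMod 2 → Bits k → ℂ
  | 0, b => fun (y : ZMod 2) => if y = b then 1 else 0
  | k + 1, b => fun y => (1 / (Real.sqrt 8 : ℂ)) *
      ∑ x : Fin 7 → ZMod 2, if parityCheck *ᵥ x = 0 ∧ ∑ i, x i = b then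
        ∏ i, codeKet k (x i) (y i) else 0

/-- The logical state `|+⟩`. -/
def plusKet (k : ℕ) : Bits k → ℂ :=
  fun y => (1 / (Real.sqrt 2 : ℂ)) * (codeKet k 0 y + codeKet k 1 y)

/-- The noiseless encoding circuit at level `k + 1`, run on logical states of level `k`. -/
def idealUnverified (k : ℕ) : Bits (k + 1) → ℂ :=
  encoder.foldl (fun ψ g => fun y => ψ (Function.update y g.2 (y g.1 + y g.2)))
    fun y => ∏ i, if startsPlus i then plusKet k (y i) else codeKet k 0 (y i)

/-- The noiseless joint state of the two blocks before the verifying measurement. -/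
def idealAttempt (k : ℕ) : Bits (k + 1) → Bits (k + 1) → ℂ :=
  fun y z => idealUnverified k y * idealUnverified k (y + z)

/-- The mod 2 inner product of the `Z` part of an error with a bit string. -/
def zDot : (k : ℕ) → Block k → Bits k → ZMod 2
  | 0, e, y => HMul.hMul (α := ZMod 2) (β := ZMod 2) e.2 y
  | k + 1, e, y => ∑ i, zDot k (e i) (y i)

/-- The `X` part of an error, as a bit string. -/
def xBits : (k : ℕ) → Block k → Bits k
  | 0, e => e.1
  | k + 1, e => fun i => xBits k (e i)

/-- The Pauli operator `X ^ x * Z ^ z` recorded by an error, applied to a vector. -/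
def pauliKet {k : ℕ} (e : Block k) (ψ : Bits k → ℂ) : Bits k → ℂ :=
  fun y => (-1) ^ (zDot k e (y + xBits k e)).val * ψ (y + xBits k e)

/-! ### The failure parameters -/

/-- The parameters of one level: the acceptance bound `N`, the failure parameters `A`, `B`, `Bp`
(for `B'`) and `C`, and the wellness parameters `a` and `b`. -/
structure Params where
  N : ℝ
  A : ℝ
  a : ℝ
  Bp : ℝ
  b : ℝ
  B : ℝ
  C : ℝ

/-- The parameters of a level from those of the preceding level; `n = 7` is the block size and
`s = 9` the number of gates of the encoding circuit. -/
def Params.next (P : Params) : Params :=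
  let n : ℝ := 7
  let s : ℝ := 9
  let N := 1 - 2 * n * P.A - 2 * n * P.B - (2 * s + n) * P.C
  let A := ((Nat.choose 14 2 : ℝ) * (P.A ^ 2 + P.B ^ 2) + (Nat.choose 25 2 : ℝ) * P.C ^ 2
    + 2 * n * (2 * s + n) * (P.A + P.B) * P.C + 4 * n ^ 2 * P.A * P.B) / N
  let a := (2 * n * (P.A + P.B) + (2 * s + n) * P.C) / ((1 - A) * N)
  let single := 4 * a + 2 * n * P.B + 4 * n * P.C
  let Bp := 4 * A + single
  let b := single / (1 - Bp)
  let B := 4 * A + (Nat.choose 28 2 : ℝ) * P.C ^ 2 + (Nat.choose 4 2 : ℝ) * a ^ 2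
    + (Nat.choose 14 2 : ℝ) * P.B ^ 2 + b * (4 * n * P.C + 4 * a + 2 * n * P.B)
    + 4 * n * P.C * (4 * a + 2 * n * P.B) + 8 * n * a * P.B
  let C := (2 * B + 2 * n * P.C * Bp + (Nat.choose 7 2 : ℝ) * P.C ^ 2)
    + 2 * b * (2 * Bp + n * P.C) + b ^ 2
  ⟨N, A, a, Bp, b, B, C⟩

/-- The parameters at each level, for physical failure probability `p`.  At level `0` only `A = 0`,
`B = 0` and `C = p` have a meaning. -/
def params (p : ℝ) : ℕ → Params
  | 0 => ⟨1, 0, 0, 0, 0, 0, p⟩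
  | k + 1 => (params p k).next

end FT

end

open FT

noncomputable section

namespace FT

/-! ### Probability mass functions -/

section Prob

variable {α β γ ι : Type}

/-! The induction over levels does not run on `Well`, whose conditional statements are awkward to
push through a circuit, but on the stronger class `Tame`. A tame law is a mixture over a hidden
label whose components have independent subblocks; outside the at most one named subblock, these are
tame one level lower, with definite states that agree there with a word of trivial syndrome.
Independence survives because faults can be conditioned upon completely: `Fails.refine` splits a
failed law into point masses. At the end `well_bind` recovers `Well` by Bayes' rule.

Errors are counted with `Fails` and `Graded`. A single fault is tolerated and costs one uncontrolled
subblock; two faults, or one fatal event such as a failed ancilla used in error correction, are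
given up. In `Graded.bind` the bound for two faults becomes `y + y' + x * x'`, and iterating this
produces the binomial coefficients and cross terms of the parameters.

The inductive hypothesis is `Claims`. Besides the preservation of tame laws it says, in `ec_any` and
`cnot_any`, that arbitrary inputs are brought into definite though unknown states; thus a later
fault-free operation turns any damage to a subblock into a wrong state, which the code one level up
can treat. `Claims.next` carries the hypothesis to the next level. A round without faults restores
any block (`half_any`) and keeps the state of a block with one uncontrolled subblock
(`half_oneBad`), so two rounds fail only to second order, up to ancilla failures.

For verification (`Claims.verified_anc`), acceptance is certain without faults, which gives the
bound `N`. With one fault, an unverified copy has either all subblocks controlled with an unknown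
word of states, or one uncontrolled subblock and state `0` elsewhere. The transverse CNOT copies `X`
components of the first block into the second, so in the former case acceptance forces the `X` part
of the output to be trivial. For the `Z` part, the Hamming code being perfect, any word is a code
word up to one place, and the logical `Z` is removed by bookkeeping (`oneBad_of_off`). Hence one
fault leaves at most one uncontrolled subblock. Two faults given acceptance have probability at most
`A`, and `a` bounds one fault given acceptance and no such failure.

The noiseless statements rest on `codeKet_mul_codeKet_add`: transverse CNOT gates act on encoded
basis states as CNOT gates. -/

theorem toOuterMeasure_le_one (μ : PMF α) (S : Set α) : μ.toOuterMeasure S ≤ 1 := by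
  rw [PMF.toOuterMeasure_apply, ← μ.tsum_coe]
  exact ENNReal.tsum_le_tsum fun a => Set.indicator_le_self _ _ a

theorem toOuterMeasure_le_of_support {μ : PMF α} {S T : Set α}
    (h : ∀ a ∈ μ.support, a ∈ S → a ∈ T) : μ.toOuterMeasure S ≤ μ.toOuterMeasure T :=
  PMF.toOuterMeasure_mono μ fun a ha => h a ha.2 ha.1

theorem toOuterMeasure_eq_zero_of_support {μ : PMF α} {S : Set α}
    (h : ∀ a ∈ μ.support, a ∉ S) : μ.toOuterMeasure S = 0 := by
  rw [PMF.toOuterMeasure_apply_eq_zero_iff]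
  exact Set.disjoint_left.mpr h

theorem notMem_of_toOuterMeasure_eq_zero {μ : PMF α} {S : Set α} (h : μ.toOuterMeasure S = 0)
    {a : α} (ha : a ∈ μ.support) : a ∉ S :=
  Set.disjoint_left.mp ((PMF.toOuterMeasure_apply_eq_zero_iff μ S).mp h) ha

theorem bind_congr_support {μ : PMF α} {f g : α → PMF β} (h : ∀ a ∈ μ.support, f a = g a) :
    μ.bind f = μ.bind g := by
  ext b
  rw [PMF.bind_apply, PMF.bind_apply]
  refine tsum_congr fun a => ?_
  by_cases ha : a ∈ μ.support
  · rw [h a ha]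
  · rw [(PMF.apply_eq_zero_iff μ a).mpr ha, zero_mul, zero_mul]

theorem map_congr_support {μ : PMF α} {f g : α → β} (h : ∀ a ∈ μ.support, f a = g a) :
    μ.map f = μ.map g :=
  bind_congr_support fun a ha => by simp [h a ha]

/-- A bound on the probability of an event after a random step. -/
theorem toOuterMeasure_bind_le {μ : PMF α} {f : α → PMF β} {S : Set β} (T U : Set α)
    {r s : ℝ≥0∞} (h : ∀ a ∈ μ.support, (f a).toOuterMeasure S ≤
      r + T.indicator (fun _ => s) a + U.indicator (fun _ => 1) a) :
    (μ.bind f).toOuterMeasure S ≤ r + μ.toOuterMeasure T * s + μ.toOuterMeasure U := by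
  classical
  rw [PMF.toOuterMeasure_bind_apply]
  calc ∑' a, μ a * (f a).toOuterMeasure S
      ≤ ∑' a, (μ a * r + T.indicator μ a * s + U.indicator μ a) := by
        refine ENNReal.tsum_le_tsum fun a => ?_
        by_cases ha : a ∈ μ.support
        · refine (mul_le_mul_right (h a ha) _).trans ?_
          by_cases h1 : a ∈ T <;> by_cases h2 : a ∈ U <;> simp [h1, h2, mul_add]
        · simp [(PMF.apply_eq_zero_iff μ a).mpr ha]
    _ = r + μ.toOuterMeasure T * s + μ.toOuterMeasure U := by
        rw [ENNReal.tsum_add, ENNReal.tsum_add, ENNReal.tsum_mul_right, ENNReal.tsum_mul_right,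
          μ.tsum_coe, one_mul, PMF.toOuterMeasure_apply, PMF.toOuterMeasure_apply]

theorem toOuterMeasure_bind_le_of_forall {μ : PMF α} {f : α → PMF β} {S : Set β}
    {r : ℝ≥0∞} (h : ∀ a ∈ μ.support, (f a).toOuterMeasure S ≤ r) :
    (μ.bind f).toOuterMeasure S ≤ r := by
  have := toOuterMeasure_bind_le (μ := μ) (f := f) (S := S) ∅ ∅ (r := r) (s := 0)
    (by simpa using h)
  simpa using this

/-! ### Conditioning -/

theorem toOuterMeasure_ne_zero_iff {μ : PMF α} {S : Set α} :
    μ.toOuterMeasure S ≠ 0 ↔ ∃ a ∈ S, a ∈ μ.support := by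
  rw [Ne, PMF.toOuterMeasure_apply_eq_zero_iff, Set.not_disjoint_iff]
  exact exists_congr fun a => and_comm

theorem condOn_apply {μ : PMF α} {S : Set α} (h : ∃ a ∈ S, a ∈ μ.support) (a : α) :
    condOn μ S a = S.indicator μ a * (μ.toOuterMeasure S)⁻¹ := by
  rw [condOn, dif_pos h, PMF.filter_apply, PMF.toOuterMeasure_apply]

theorem mem_support_condOn {μ : PMF α} {S : Set α} (h : ∃ a ∈ S, a ∈ μ.support) {a : α} :
    a ∈ (condOn μ S).support ↔ a ∈ S ∧ a ∈ μ.support := by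
  rw [condOn, dif_pos h, PMF.mem_support_filter_iff]

theorem condOn_of_support_subset {μ : PMF α} {S : Set α} (h : ∀ a ∈ μ.support, a ∈ S) :
    condOn μ S = μ := by
  obtain ⟨a, ha⟩ := μ.support_nonempty
  ext b
  rw [condOn_apply ⟨a, h a ha, ha⟩, (PMF.toOuterMeasure_apply_eq_one_iff μ S).mpr h, inv_one,
    mul_one]
  by_cases hb : b ∈ μ.support
  · rw [Set.indicator_of_mem (h b hb)]
  · rw [(PMF.apply_eq_zero_iff μ b).mpr hb]
    exact Set.indicator_apply_eq_zero.mpr fun _ => (PMF.apply_eq_zero_iff μ b).mpr hb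

/-- Bayes' rule: conditioning a mixture is the same as reweighting it and conditioning its
components. -/
theorem condOn_bind {μ : PMF α} {f : α → PMF β} {S : Set β}
    (h : ∃ b ∈ S, b ∈ (μ.bind f).support) :
    ∃ μ' : PMF α, (∀ a ∈ μ'.support, a ∈ μ.support ∧ ∃ b ∈ S, b ∈ (f a).support) ∧
      (∀ T, μ'.toOuterMeasure T ≤ μ.toOuterMeasure T / (μ.bind f).toOuterMeasure S) ∧
      condOn (μ.bind f) S = μ'.bind fun a => condOn (f a) S := by
  classical
  set w : α → ℝ≥0∞ := fun a => μ a * (f a).toOuterMeasure S with hw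
  have hsum : ∑' a, w a = (μ.bind f).toOuterMeasure S :=
    (PMF.toOuterMeasure_bind_apply _ _ _).symm
  have h0 : (μ.bind f).toOuterMeasure S ≠ 0 := toOuterMeasure_ne_zero_iff.mpr h
  have htop : (μ.bind f).toOuterMeasure S ≠ ∞ :=
    ne_top_of_le_ne_top ENNReal.one_ne_top (toOuterMeasure_le_one _ _)
  refine ⟨PMF.normalize w (hsum ▸ h0) (hsum ▸ htop), fun a ha => ?_, fun T => ?_, ?_⟩
  · rw [PMF.mem_support_normalize_iff, hw] at ha
    exact ⟨left_ne_zero_of_mul ha, toOuterMeasure_ne_zero_iff.mp (right_ne_zero_of_mul ha)⟩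
  · rw [div_eq_mul_inv, PMF.toOuterMeasure_apply μ, ← ENNReal.tsum_mul_right]
    refine (PMF.toOuterMeasure_apply _ T).trans_le (ENNReal.tsum_le_tsum fun a => ?_)
    by_cases ha : a ∈ T
    · simp only [Set.indicator_of_mem ha, PMF.normalize_apply, hsum]
      gcongr
      exact mul_le_of_le_one_right' (toOuterMeasure_le_one _ _)
    · simp [ha]
  · ext b
    rw [condOn_apply h, PMF.bind_apply]
    simp only [PMF.normalize_apply, hsum]
    by_cases hb : b ∈ S
    · rw [Set.indicator_of_mem hb, PMF.bind_apply, ← ENNReal.tsum_mul_right]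
      refine tsum_congr fun a => ?_
      by_cases hS : ∃ b ∈ S, b ∈ (f a).support
      · have h1 := toOuterMeasure_ne_zero_iff.mpr hS
        have h2 : (f a).toOuterMeasure S ≠ ∞ :=
          ne_top_of_le_ne_top ENNReal.one_ne_top (toOuterMeasure_le_one _ _)
        rw [condOn_apply hS, Set.indicator_of_mem hb, hw]
        calc μ a * f a b * ((μ.bind f).toOuterMeasure S)⁻¹
            = μ a * f a b * ((μ.bind f).toOuterMeasure S)⁻¹ *
              ((f a).toOuterMeasure S * ((f a).toOuterMeasure S)⁻¹) := by
                rw [ENNReal.mul_inv_cancel h1 h2, mul_one]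
          _ = _ := by ring
      · have h1 : (f a).toOuterMeasure S = 0 := by
          by_contra h1
          exact hS (toOuterMeasure_ne_zero_iff.mp h1)
        have h2 : f a b = 0 := by
          by_contra h2
          exact hS ⟨b, hb, h2⟩
        rw [hw]
        simp [h1, h2]
    · rw [Set.indicator_of_notMem hb, zero_mul]
      symm
      rw [ENNReal.tsum_eq_zero]
      intro a
      by_cases hS : ∃ b ∈ S, b ∈ (f a).support
      · rw [condOn_apply hS, Set.indicator_of_notMem hb, zero_mul, mul_zero]
      · have h1 : (f a).toOuterMeasure S = 0 := by
          by_contra h1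
          exact hS (toOuterMeasure_ne_zero_iff.mp h1)
        rw [hw]
        simp [h1]

theorem toOuterMeasure_condOn_le {μ : PMF α} {S : Set α} (h : ∃ a ∈ S, a ∈ μ.support)
    (T : Set α) : (condOn μ S).toOuterMeasure T ≤ μ.toOuterMeasure T / μ.toOuterMeasure S := by
  rw [PMF.toOuterMeasure_apply, PMF.toOuterMeasure_apply, div_eq_mul_inv, ← ENNReal.tsum_mul_right]
  refine ENNReal.tsum_le_tsum fun a => ?_
  by_cases ha : a ∈ T
  · rw [Set.indicator_of_mem ha, Set.indicator_of_mem ha, condOn_apply h]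
    gcongr
    exact Set.indicator_le_self _ _ a
  · simp [ha]

/-- A law is the mixture of its conditional laws given the value of a function. -/
theorem map_bind_condOn (μ : PMF α) (f : α → β) :
    ((μ.map f).bind fun b => condOn μ {a | f a = b}) = μ := by
  classical
  ext a
  rw [PMF.bind_map, PMF.bind_apply]
  have key : ∀ a', μ a' * condOn μ {x | f x = f a'} a =
      {x | f x = f a}.indicator μ a' * (μ a * (μ.toOuterMeasure {x | f x = f a})⁻¹) := by
    intro a'
    by_cases ha' : a' ∈ μ.support
    · by_cases he : f a' = f a
      · rw [he, condOn_apply ⟨a', he, ha'⟩, Set.indicator_of_mem (by simp),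
          Set.indicator_of_mem (by simpa using he)]
      · rw [condOn_apply (S := {x | f x = f a'}) ⟨a', rfl, ha'⟩,
          Set.indicator_of_notMem (by simpa using Ne.symm he),
          Set.indicator_of_notMem (by simpa using he)]
        simp
    · have h0 := (PMF.apply_eq_zero_iff μ a').mpr ha'
      rw [h0, zero_mul]
      by_cases he : a' ∈ {x | f x = f a}
      · rw [Set.indicator_of_mem he, h0, zero_mul]
      · rw [Set.indicator_of_notMem he, zero_mul]
  simp only [Function.comp_def, key]
  rw [ENNReal.tsum_mul_right, ← PMF.toOuterMeasure_apply]
  by_cases ha : a ∈ μ.support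
  · have h1 : μ.toOuterMeasure {x | f x = f a} ≠ 0 :=
      toOuterMeasure_ne_zero_iff.mpr ⟨a, rfl, ha⟩
    have h2 : μ.toOuterMeasure {x | f x = f a} ≠ ∞ :=
      ne_top_of_le_ne_top ENNReal.one_ne_top (toOuterMeasure_le_one _ _)
    rw [mul_comm (μ a), ← mul_assoc, ENNReal.mul_inv_cancel h1 h2, one_mul]
  · rw [(PMF.apply_eq_zero_iff μ a).mpr ha]
    simp

/-! ### Product laws -/

/-- The joint law of two independent samples. -/
def pair (μ : PMF α) (ν : PMF β) : PMF (α × β) := μ.bind fun a => ν.map fun b => (a, b)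

theorem mem_support_pair {μ : PMF α} {ν : PMF β} {r : α × β} :
    r ∈ (pair μ ν).support ↔ r.1 ∈ μ.support ∧ r.2 ∈ ν.support := by
  obtain ⟨a, b⟩ := r
  simp [pair, and_comm]

theorem pair_bind_left (π : PMF ι) (f : ι → PMF α) (ν : PMF β) :
    pair (π.bind f) ν = π.bind fun c => pair (f c) ν := by
  simp [pair, PMF.bind_bind]

theorem pair_bind_right (μ : PMF α) (π : PMF ι) (f : ι → PMF β) :
    pair μ (π.bind f) = π.bind fun c => pair μ (f c) := by
  simp only [pair, PMF.map_bind]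
  rw [PMF.bind_comm]

theorem pair_bind (μ : PMF α) (ν : PMF β) (f : α × β → PMF γ) :
    (pair μ ν).bind f = μ.bind fun a => ν.bind fun b => f (a, b) := by
  simp [pair, PMF.bind_bind, PMF.bind_map, Function.comp_def]

theorem pair_pure (a : α) (b : β) : pair (PMF.pure a) (PMF.pure b) = PMF.pure (a, b) := by
  simp [pair, PMF.pure_map]

theorem pair_map_map {α' β' : Type} (μ : PMF α) (ν : PMF β) (f : α → α') (g : β → β') :
    (pair μ ν).map (fun r => (f r.1, g r.2)) = pair (μ.map f) (ν.map g) := by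
  simp [pair, PMF.map_bind, PMF.bind_map, PMF.map_comp, Function.comp_def]

theorem pair_map_fst (μ : PMF α) (ν : PMF β) : (pair μ ν).map Prod.fst = μ := by
  simp [pair, Function.comp_def, PMF.map]

theorem pair_map_swap (μ : PMF α) (ν : PMF β) : (pair μ ν).map Prod.swap = pair ν μ := by
  simp only [pair, PMF.map]
  rw [PMF.bind_bind]
  simp only [PMF.bind_bind, Function.comp_def, PMF.pure_bind, Prod.swap]
  rw [PMF.bind_comm]

theorem indep_pure : {n : ℕ} → (v : Fin n → α) → indep (fun i => PMF.pure (v i)) = PMF.pure v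
  | 0, v => by
    rw [indep]
    congr 1
    exact Subsingleton.elim _ _
  | n + 1, v => by
    rw [indep, PMF.pure_bind, indep_pure (fun i : Fin n => v i.succ), PMF.pure_map]
    congr 1
    exact Fin.cons_self_tail v

/-- Steps acting on each coordinate separately preserve independence. All transverse operations are
handled through this identity. -/
theorem indep_bind_indep : {n : ℕ} → (μ : Fin n → PMF α) → (g : Fin n → α → PMF β) →
    ((indep μ).bind fun c => indep fun i => g i (c i)) = indep fun i => (μ i).bind (g i)
  | 0, μ, g => by
    rw [indep, indep, PMF.pure_bind, indep]
  | n + 1, μ, g => by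
    simp only [indep, PMF.bind_bind, PMF.bind_map, Function.comp_def, Fin.cons_zero,
      Fin.cons_succ]
    refine congrArg _ (funext fun a => ?_)
    rw [PMF.bind_comm]
    refine congrArg _ (funext fun b => ?_)
    rw [← indep_bind_indep, PMF.map_bind]

theorem indep_map {n : ℕ} (μ : Fin n → PMF α) (φ : Fin n → α → β) :
    (indep μ).map (fun v i => φ i (v i)) = indep fun i => (μ i).map (φ i) := by
  have := indep_bind_indep μ fun i a => PMF.pure (φ i a)
  simp only [indep_pure] at this
  exact this

theorem mem_support_indep : {n : ℕ} → {μ : Fin n → PMF α} → {v : Fin n → α} →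
    (v ∈ (indep μ).support ↔ ∀ i, v i ∈ (μ i).support)
  | 0, μ, v => by
    simp only [indep, PMF.mem_support_pure_iff, IsEmpty.forall_iff, iff_true]
    exact Subsingleton.elim _ _
  | n + 1, μ, v => by
    rw [indep, PMF.mem_support_bind_iff, Fin.forall_fin_succ]
    constructor
    · rintro ⟨a, ha, hv⟩
      obtain ⟨w, hw, rfl⟩ := (PMF.mem_support_map_iff _ _ _).mp hv
      exact ⟨ha, mem_support_indep.mp hw⟩
    · rintro ⟨h0, h1⟩
      refine ⟨_, h0, (PMF.mem_support_map_iff _ _ _).mpr ⟨fun i => v i.succ,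
        mem_support_indep.mpr h1, Fin.cons_self_tail v⟩⟩

theorem indep_map_apply : {n : ℕ} → (μ : Fin n → PMF α) → (i : Fin n) →
    (indep μ).map (fun v => v i) = μ i
  | 0, _, i => i.elim0
  | n + 1, μ, i => by
    rw [indep, PMF.map_bind]
    simp only [PMF.map_comp, Function.comp_def]
    refine Fin.cases ?_ (fun j => ?_) i
    · simp only [Fin.cons_zero]
      have : ∀ a : α, (indep fun i : Fin n => μ i.succ).map (fun _ => a) = PMF.pure a :=
        fun a => PMF.map_const _ a
      simp only [this, PMF.bind_pure]
    · simp only [Fin.cons_succ, indep_map_apply, PMF.bind_const]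

theorem indep_update_bind {n : ℕ} (μ : Fin n → PMF α) (i : Fin n) (π : PMF ι) (f : ι → PMF α) :
    indep (Function.update μ i (π.bind f)) =
      π.bind fun c => indep (Function.update μ i (f c)) := by
  -- Every coordinate gets its own copy of the mixing variable, and all copies but the `i`-th are
  -- ignored; the `i`-th marginal then gives back `π`.
  have h := indep_bind_indep (fun _ : Fin n => π) fun j c => Function.update μ i (f c) j
  have h1 : (fun j : Fin n => π.bind fun c => Function.update μ i (f c) j) =
      Function.update μ i (π.bind f) := by
    funext j
    by_cases hj : j = i
    · subst hj; simp
    · simp [hj]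
  rw [h1] at h
  rw [← h]
  have h2 : ∀ c : Fin n → ι, (fun j => Function.update μ i (f (c j)) j) =
      Function.update μ i (f (c i)) := by
    intro c
    funext j
    by_cases hj : j = i
    · subst hj; simp
    · simp [hj]
  simp only [h2]
  conv_rhs => rw [← indep_map_apply (fun _ : Fin n => π) i, PMF.bind_map]
  rfl

/-- Splitting independent pairs into two independent tuples. -/
theorem indep_pair_map : {n : ℕ} → (μ : Fin n → PMF α) → (ν : Fin n → PMF β) →
    (indep fun i => pair (μ i) (ν i)).map (fun r => (fun i => (r i).1, fun i => (r i).2)) =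
      pair (indep μ) (indep ν)
  | 0, μ, ν => by
    simp only [indep, PMF.pure_map, pair_pure]
    congr 1
    refine Prod.ext ?_ ?_ <;> exact Subsingleton.elim _ _
  | n + 1, μ, ν => by
    have ih := indep_pair_map (fun i : Fin n => μ i.succ) fun i => ν i.succ
    have e : ∀ (a : α × β) (v : Fin n → α × β),
        ((fun i => ((Fin.cons a v : Fin (n + 1) → α × β) i).1,
          fun i => ((Fin.cons a v : Fin (n + 1) → α × β) i).2) :
            (Fin (n + 1) → α) × (Fin (n + 1) → β)) =
        (fun r : (Fin n → α) × (Fin n → β) => ((Fin.cons a.1 r.1, Fin.cons a.2 r.2) :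
            (Fin (n + 1) → α) × (Fin (n + 1) → β)))
          (fun i => (v i).1, fun i => (v i).2) := by
      intro a v
      refine Prod.ext (funext fun i => ?_) (funext fun i => ?_) <;>
        refine Fin.cases ?_ (fun j => ?_) i <;> simp
    simp only [indep, PMF.map_bind, PMF.map_comp, Function.comp_def, e]
    have e2 : ∀ a : α × β,
        (indep fun i : Fin n => pair (μ i.succ) (ν i.succ)).map (fun v =>
          ((Fin.cons a.1 fun i => (v i).1, Fin.cons a.2 fun i => (v i).2) :
            (Fin (n + 1) → α) × (Fin (n + 1) → β))) =
        (pair (indep fun i : Fin n => μ i.succ) (indep fun i : Fin n => ν i.succ)).map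
          (fun r => ((Fin.cons a.1 r.1, Fin.cons a.2 r.2) :
            (Fin (n + 1) → α) × (Fin (n + 1) → β))) := by
      intro a
      rw [← ih, PMF.map_comp]
      rfl
    have e3 : ∀ a : α × β, (pair (indep fun i : Fin n => μ i.succ)
        (indep fun i : Fin n => ν i.succ)).map (fun r => ((Fin.cons a.1 r.1, Fin.cons a.2 r.2) :
            (Fin (n + 1) → α) × (Fin (n + 1) → β))) =
        pair ((indep fun i : Fin n => μ i.succ).map fun v => Fin.cons a.1 v)
          ((indep fun i : Fin n => ν i.succ).map fun v => Fin.cons a.2 v) :=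
      fun a => pair_map_map _ _ _ _
    simp only [e2, e3, pair_bind]
    rw [pair_bind_left]
    refine congrArg _ (funext fun a => ?_)
    rw [pair_bind_right]

/-- Two flags among `n + 1` samples are either two in the tail, or one at the head and,
independently, one in the tail; Pascal's rule does the rest. -/
theorem toOuterMeasure_indep_flag {n : ℕ} {μ : Fin n → PMF α} {F : Set α} {δ : ℝ≥0∞}
    (h : ∀ i, (μ i).toOuterMeasure F ≤ δ) :
    (indep μ).toOuterMeasure {v | ∃ i, v i ∈ F} ≤ n * δ ∧
      (indep μ).toOuterMeasure {v | ∃ i j, i ≠ j ∧ v i ∈ F ∧ v j ∈ F} ≤ n.choose 2 * δ ^ 2 := by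
  induction n with
  | zero => constructor <;> simp
  | succ n ih =>
    obtain ⟨ih1, ih2⟩ := ih (μ := fun i => μ i.succ) fun i => h i.succ
    have e1 : ∀ (a : α) (v : Fin n → α),
        (∃ i, (Fin.cons a v : Fin (n + 1) → α) i ∈ F) ↔ a ∈ F ∨ ∃ i, v i ∈ F := by
      intro a v
      rw [Fin.exists_fin_succ]
      simp
    have e2 : ∀ (a : α) (v : Fin n → α),
        (∃ i j, i ≠ j ∧ (Fin.cons a v : Fin (n + 1) → α) i ∈ F ∧
          (Fin.cons a v : Fin (n + 1) → α) j ∈ F) ↔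
        (a ∈ F ∧ ∃ i, v i ∈ F) ∨ ∃ i j, i ≠ j ∧ v i ∈ F ∧ v j ∈ F := by
      intro a v
      simp only [Fin.exists_fin_succ, Fin.cons_zero, Fin.cons_succ, ne_eq, not_true_eq_false,
        false_and, false_or, Fin.succ_inj, Fin.succ_ne_zero, not_false_eq_true, true_and,
        (Fin.succ_ne_zero _).symm]
      grind
    constructor
    · rw [indep]
      refine (toOuterMeasure_bind_le ∅ F (r := n * δ) (s := 0) fun a _ => ?_).trans ?_
      · rw [PMF.toOuterMeasure_map_apply]
        by_cases ha : a ∈ F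
        · rw [Set.indicator_of_mem ha]
          exact (toOuterMeasure_le_one _ _).trans le_add_self
        · have : (fun v : Fin n → α => (Fin.cons a v : Fin (n + 1) → α)) ⁻¹'
              {v | ∃ i, v i ∈ F} = {v | ∃ i, v i ∈ F} := by
            ext v
            simp only [Set.mem_preimage, Set.mem_ofPred_eq, e1, ha, false_or]
          rw [this]
          simpa [ha] using ih1
      · have := h 0
        simp only [MeasureTheory.measure_empty, zero_mul, add_zero]
        calc _ ≤ n * δ + δ := by gcongr
          _ = _ := by push_cast; ring
    · rw [indep]
      refine (toOuterMeasure_bind_le F ∅ (r := n.choose 2 * δ ^ 2) (s := n * δ)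
        fun a _ => ?_).trans ?_
      · rw [PMF.toOuterMeasure_map_apply]
        by_cases ha : a ∈ F
        · have : (fun v : Fin n → α => (Fin.cons a v : Fin (n + 1) → α)) ⁻¹'
              {v | ∃ i j, i ≠ j ∧ v i ∈ F ∧ v j ∈ F} ⊆ {v | ∃ i, v i ∈ F} := by
            intro v hv
            simp only [Set.mem_preimage, Set.mem_ofPred_eq, e2] at hv
            rcases hv with ⟨_, hv⟩ | ⟨i, j, _, hi, _⟩
            · exact hv
            · exact ⟨i, hi⟩
          refine ((indep _).toOuterMeasure.mono this).trans ?_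
          simp only [Set.indicator_of_mem ha, Set.indicator_empty, add_zero]
          exact ih1.trans le_add_self
        · have : (fun v : Fin n → α => (Fin.cons a v : Fin (n + 1) → α)) ⁻¹'
              {v | ∃ i j, i ≠ j ∧ v i ∈ F ∧ v j ∈ F} = {v | ∃ i j, i ≠ j ∧ v i ∈ F ∧ v j ∈ F} := by
            ext v
            simp only [Set.mem_preimage, Set.mem_ofPred_eq, e2, ha, false_and, false_or]
          rw [this]
          simpa [ha] using ih2
      · have := h 0
        simp only [MeasureTheory.measure_empty, add_zero]
        calc _ ≤ (n.choose 2 : ℝ≥0∞) * δ ^ 2 + δ * (n * δ) := by gcongr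
          _ = _ := by
            rw [Nat.choose_succ_succ' n 1, Nat.choose_one_right]
            push_cast
            ring

end Prob

/-! ### Mixtures with hidden faults -/

section Faults

variable {α β γ ι : Type}

/-- `ν` is a mixture of laws in `K` and, with total weight at most `δ`, of arbitrary laws. -/
def Fails (δ : ℝ≥0∞) (K : PMF α → Prop) (ν : PMF α) : Prop :=
  ∃ π : PMF (Bool × PMF α), π.bind Prod.snd = ν ∧
    (∀ c ∈ π.support, c.1 = false → K c.2) ∧ π.toOuterMeasure {c | c.1 = true} ≤ δ

/-- `ν` is a mixture of laws with a hidden grade, which counts faults and fatal events: laws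
without faults or fatal events are in `K`, and laws with one fault and no fatal event are in `L`.
The probability of a fatal event is at most `d`, that of a fault at most `x`, and that of two faults
at most `y`. -/
def Graded (K L : PMF α → Prop) (d x y : ℝ≥0∞) (ν : PMF α) : Prop :=
  ∃ π : PMF ((ℕ × ℕ) × PMF α), π.bind Prod.snd = ν ∧
    (∀ c ∈ π.support, c.1 = (0, 0) → K c.2) ∧ (∀ c ∈ π.support, c.1 = (1, 0) → L c.2) ∧
    π.toOuterMeasure {c | 1 ≤ c.1.2} ≤ d ∧ π.toOuterMeasure {c | 1 ≤ c.1.1} ≤ x ∧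
    π.toOuterMeasure {c | 2 ≤ c.1.1} ≤ y

theorem Fails.mono {δ δ' : ℝ≥0∞} {K K' : PMF α → Prop} {ν : PMF α} (h : Fails δ K ν)
    (hδ : δ ≤ δ') (hK : ∀ μ, K μ → K' μ) : Fails δ' K' ν := by
  obtain ⟨π, h1, h2, h3⟩ := h
  exact ⟨π, h1, fun c hc hc' => hK _ (h2 c hc hc'), h3.trans hδ⟩

theorem Fails.of_self {K : PMF α → Prop} {ν : PMF α} (h : K ν) (δ : ℝ≥0∞) : Fails δ K ν := by
  refine ⟨PMF.pure (false, ν), PMF.pure_bind _ _, fun c hc _ => ?_, ?_⟩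
  · rw [PMF.mem_support_pure_iff] at hc
    rw [hc]
    exact h
  · rw [PMF.toOuterMeasure_pure_apply]
    simp

/-- The failed part may be split into deterministic laws. -/
theorem Fails.refine {δ : ℝ≥0∞} {K : PMF α → Prop} {ν : PMF α} (h : Fails δ K ν) :
    ∃ π : PMF (Bool × PMF α), π.bind Prod.snd = ν ∧
      (∀ c ∈ π.support, c.1 = false → K c.2) ∧
      (∀ c ∈ π.support, c.1 = true → ∃ a, c.2 = PMF.pure a) ∧
      π.toOuterMeasure {c | c.1 = true} ≤ δ := by
  obtain ⟨π, h1, h2, h3⟩ := h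
  set g : Bool × PMF α → PMF (Bool × PMF α) := fun c =>
    if c.1 then c.2.map fun a => (true, PMF.pure a) else PMF.pure c with hg
  refine ⟨π.bind g, ?_, fun c hc h0 => ?_, fun c hc h0 => ?_, ?_⟩
  · rw [PMF.bind_bind, ← h1]
    refine congrArg _ (funext fun c => ?_)
    rcases c with ⟨b, μ⟩
    cases b <;> simp [hg, PMF.bind_map, Function.comp_def]
  · obtain ⟨⟨b, μ⟩, hb, hc⟩ := (PMF.mem_support_bind_iff _ _ _).mp hc
    cases b
    · simp only [hg, Bool.false_eq_true, if_false, PMF.mem_support_pure_iff] at hc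
      subst hc
      exact h2 _ hb rfl
    · simp only [hg, if_true, PMF.mem_support_map_iff] at hc
      obtain ⟨a, _, rfl⟩ := hc
      simp at h0
  · obtain ⟨⟨b, μ⟩, hb, hc⟩ := (PMF.mem_support_bind_iff _ _ _).mp hc
    cases b
    · simp only [hg, Bool.false_eq_true, if_false, PMF.mem_support_pure_iff] at hc
      subst hc
      simp at h0
    · simp only [hg, if_true, PMF.mem_support_map_iff] at hc
      obtain ⟨a, _, rfl⟩ := hc
      exact ⟨a, rfl⟩
  · refine (toOuterMeasure_bind_le ∅ {c | c.1 = true} (r := 0) (s := 0) fun c _ => ?_).trans ?_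
    · rcases c with ⟨b, μ⟩
      cases b
      · simp [hg, PMF.toOuterMeasure_pure_apply]
      · simpa using toOuterMeasure_le_one _ _
    · simpa using h3

theorem Fails.of_forall {δ : ℝ≥0∞} {K : PMF β → Prop} (μ : PMF α) {f : α → PMF β}
    (h : ∀ a ∈ μ.support, Fails δ K (f a)) : Fails δ K (μ.bind f) := by
  have : ∀ a, ∃ π : PMF (Bool × PMF β), π.bind Prod.snd = f a ∧ (a ∈ μ.support →
      (∀ c ∈ π.support, c.1 = false → K c.2) ∧ π.toOuterMeasure {c | c.1 = true} ≤ δ) := by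
    intro a
    by_cases ha : a ∈ μ.support
    · obtain ⟨π, h1, h2⟩ := h a ha
      exact ⟨π, h1, fun _ => h2⟩
    · exact ⟨PMF.pure (true, f a), PMF.pure_bind _ _, fun h => absurd h ha⟩
  choose ρ h1 h2 using this
  refine ⟨μ.bind ρ, ?_, fun c hc h0 => ?_, ?_⟩
  · simp only [PMF.bind_bind, h1]
  · obtain ⟨a, ha, hc⟩ := (PMF.mem_support_bind_iff _ _ _).mp hc
    exact (h2 a ha).1 c hc h0
  · exact toOuterMeasure_bind_le_of_forall fun a ha => (h2 a ha).2

theorem Graded.mono {K L K' L' : PMF α → Prop} {d x y d' x' y' : ℝ≥0∞} {ν : PMF α}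
    (h : Graded K L d x y ν) (hd : d ≤ d') (hx : x ≤ x') (hy : y ≤ y') (hK : ∀ μ, K μ → K' μ)
    (hL : ∀ μ, L μ → L' μ) : Graded K' L' d' x' y' ν := by
  obtain ⟨π, h1, h2, h3, h4, h5, h6⟩ := h
  exact ⟨π, h1, fun c hc hc' => hK _ (h2 c hc hc'), fun c hc hc' => hL _ (h3 c hc hc'),
    h4.trans hd, h5.trans hx, h6.trans hy⟩

theorem Graded.of_self {K L : PMF α → Prop} {ν : PMF α} (h : K ν) (d x y : ℝ≥0∞) :
    Graded K L d x y ν := by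
  refine ⟨PMF.pure ((0, 0), ν), PMF.pure_bind _ _, fun c hc _ => ?_, fun c hc h0 => ?_, ?_, ?_, ?_⟩
  · rw [PMF.mem_support_pure_iff] at hc
    rw [hc]
    exact h
  · rw [PMF.mem_support_pure_iff] at hc
    simp [hc] at h0
  all_goals simp [PMF.toOuterMeasure_pure_apply]

theorem Graded.of_forall {K L : PMF β → Prop} {d x y : ℝ≥0∞} (μ : PMF α) {f : α → PMF β}
    (h : ∀ a ∈ μ.support, Graded K L d x y (f a)) : Graded K L d x y (μ.bind f) := by
  have : ∀ a, ∃ π : PMF ((ℕ × ℕ) × PMF β), π.bind Prod.snd = f a ∧ (a ∈ μ.support →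
      (∀ c ∈ π.support, c.1 = (0, 0) → K c.2) ∧ (∀ c ∈ π.support, c.1 = (1, 0) → L c.2) ∧
      π.toOuterMeasure {c | 1 ≤ c.1.2} ≤ d ∧ π.toOuterMeasure {c | 1 ≤ c.1.1} ≤ x ∧
      π.toOuterMeasure {c | 2 ≤ c.1.1} ≤ y) := by
    intro a
    by_cases ha : a ∈ μ.support
    · obtain ⟨π, h1, h2⟩ := h a ha
      exact ⟨π, h1, fun _ => h2⟩
    · exact ⟨PMF.pure ((0, 0), f a), PMF.pure_bind _ _, fun h => absurd h ha⟩
  choose ρ h1 h2 using this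
  refine ⟨μ.bind ρ, ?_, fun c hc h0 => ?_, fun c hc h0 => ?_, ?_, ?_, ?_⟩
  · simp only [PMF.bind_bind, h1]
  · obtain ⟨a, ha, hc⟩ := (PMF.mem_support_bind_iff _ _ _).mp hc
    exact (h2 a ha).1 c hc h0
  · obtain ⟨a, ha, hc⟩ := (PMF.mem_support_bind_iff _ _ _).mp hc
    exact (h2 a ha).2.1 c hc h0
  · exact toOuterMeasure_bind_le_of_forall fun a ha => (h2 a ha).2.2.1
  · exact toOuterMeasure_bind_le_of_forall fun a ha => (h2 a ha).2.2.2.1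
  · exact toOuterMeasure_bind_le_of_forall fun a ha => (h2 a ha).2.2.2.2

/-- Applying a map of laws that commutes with mixing. -/
theorem Graded.lift {K L : PMF α → Prop} {P Q : PMF β → Prop} {d x y : ℝ≥0∞} {ν : PMF α}
    (h : Graded K L d x y ν) (F : PMF α → PMF β)
    (hF : ∀ π : PMF ((ℕ × ℕ) × PMF α), F (π.bind Prod.snd) = π.bind fun c => F c.2)
    (hP : ∀ μ, K μ → P (F μ)) (hQ : ∀ μ, L μ → Q (F μ)) : Graded P Q d x y (F ν) := by
  obtain ⟨π, h1, h2, h3, h4, h5, h6⟩ := h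
  refine ⟨π.map fun c => (c.1, F c.2), ?_, fun c hc h0 => ?_, fun c hc h0 => ?_, ?_, ?_, ?_⟩
  · rw [PMF.bind_map, ← h1, hF]
    rfl
  · obtain ⟨c, hc', rfl⟩ := (PMF.mem_support_map_iff _ _ _).mp hc
    exact hP _ (h2 c hc' h0)
  · obtain ⟨c, hc', rfl⟩ := (PMF.mem_support_map_iff _ _ _).mp hc
    exact hQ _ (h3 c hc' h0)
  all_goals rw [PMF.toOuterMeasure_map_apply]; assumption

theorem Graded.map {K L : PMF α → Prop} {P Q : PMF β → Prop} {d x y : ℝ≥0∞} {ν : PMF α}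
    (h : Graded K L d x y ν) (f : α → β) (hP : ∀ μ, K μ → P (μ.map f))
    (hQ : ∀ μ, L μ → Q (μ.map f)) : Graded P Q d x y (ν.map f) :=
  h.lift (fun μ => μ.map f) (fun _ => PMF.map_bind _ _ _) hP hQ

theorem Fails.lift {K : PMF α → Prop} {P : PMF β → Prop} {δ : ℝ≥0∞} {ν : PMF α}
    (h : Fails δ K ν) (F : PMF α → PMF β)
    (hF : ∀ π : PMF (Bool × PMF α), F (π.bind Prod.snd) = π.bind fun c => F c.2)
    (hP : ∀ μ, K μ → P (F μ)) : Fails δ P (F ν) := by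
  obtain ⟨π, h1, h2, h3⟩ := h
  refine ⟨π.map fun c => (c.1, F c.2), ?_, fun c hc h0 => ?_, ?_⟩
  · rw [PMF.bind_map, ← h1, hF]
    rfl
  · obtain ⟨c, hc', rfl⟩ := (PMF.mem_support_map_iff _ _ _).mp hc
    exact hP _ (h2 c hc' h0)
  · rw [PMF.toOuterMeasure_map_apply]
    exact h3

theorem Fails.map {K : PMF α → Prop} {P : PMF β → Prop} {δ : ℝ≥0∞} {ν : PMF α}
    (h : Fails δ K ν) (f : α → β) (hP : ∀ μ, K μ → P (μ.map f)) : Fails δ P (ν.map f) :=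
  h.lift (fun μ => μ.map f) (fun _ => PMF.map_bind _ _ _) hP

theorem Fails.graded {K : PMF α → Prop} {δ : ℝ≥0∞} {ν : PMF α} (h : Fails δ K ν) :
    Graded K (fun _ => True) 0 δ 0 ν := by
  obtain ⟨π, h1, h2, h3⟩ := h
  refine ⟨π.map fun c => ((if c.1 then 1 else 0, 0), c.2), ?_, fun c hc h0 => ?_,
    fun c hc h0 => trivial, ?_, ?_, ?_⟩
  · rw [PMF.bind_map, ← h1]
    rfl
  · obtain ⟨⟨b, μ⟩, hc', rfl⟩ := (PMF.mem_support_map_iff _ _ _).mp hc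
    cases b
    · exact h2 _ hc' rfl
    · simp at h0
  · rw [PMF.toOuterMeasure_map_apply]
    simp
  · rw [PMF.toOuterMeasure_map_apply]
    refine le_trans (π.toOuterMeasure.mono ?_) h3
    rintro ⟨b, μ⟩ hb
    cases b
    · simp at hb
    · rfl
  · rw [PMF.toOuterMeasure_map_apply]
    refine le_of_eq (toOuterMeasure_eq_zero_of_support ?_)
    rintro ⟨b, μ⟩ _ hb
    cases b <;> simp at hb

/-- Failures may be regarded as fatal events. -/
theorem Fails.graded_fatal {K : PMF α → Prop} {δ : ℝ≥0∞} {ν : PMF α} (h : Fails δ K ν) :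
    Graded K (fun _ => False) δ 0 0 ν := by
  obtain ⟨π, h1, h2, h3⟩ := h
  refine ⟨π.map fun c => ((0, if c.1 then 1 else 0), c.2), ?_, fun c hc h0 => ?_,
    fun c hc h0 => ?_, ?_, ?_, ?_⟩
  · rw [PMF.bind_map, ← h1]
    rfl
  · obtain ⟨⟨b, μ⟩, hc', rfl⟩ := (PMF.mem_support_map_iff _ _ _).mp hc
    cases b
    · exact h2 _ hc' rfl
    · simp at h0
  · obtain ⟨⟨b, μ⟩, hc', rfl⟩ := (PMF.mem_support_map_iff _ _ _).mp hc
    simp at h0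
  · rw [PMF.toOuterMeasure_map_apply]
    refine le_trans (π.toOuterMeasure.mono ?_) h3
    rintro ⟨b, μ⟩ hb
    cases b
    · simp at hb
    · rfl
  all_goals
    rw [PMF.toOuterMeasure_map_apply]
    simp

/-- Composition of steps: faults and fatal events add up. -/
theorem Graded.bind {K L : PMF α → Prop} {K' L' : PMF β → Prop} {d x y d' x' y' z' : ℝ≥0∞}
    {ν : PMF α} {f : α → PMF β} (h : Graded K L d x y ν)
    (hK : ∀ μ, K μ → Graded K' L' d' x' y' (μ.bind f))
    (hL : ∀ μ, L μ → Graded L' (fun _ => True) d' x' z' (μ.bind f)) :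
    Graded K' L' (d + d') (x + x') (y + y' + x * x') (ν.bind f) := by
  obtain ⟨π, h1, h2, h3, h4, h5, h6⟩ := h
  have key : ∀ c : (ℕ × ℕ) × PMF α, ∃ ρ : PMF ((ℕ × ℕ) × PMF β),
      ρ.bind Prod.snd = c.2.bind f ∧ (c ∈ π.support →
        (∀ c' ∈ ρ.support, c'.1 = (0, 0) → K' c'.2) ∧ (∀ c' ∈ ρ.support, c'.1 = (1, 0) → L' c'.2) ∧
        ρ.toOuterMeasure {c | 1 ≤ c.1.2} ≤ d' + Set.indicator {c | 1 ≤ c.1.2} (fun _ => 1) c ∧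
        ρ.toOuterMeasure {c | 1 ≤ c.1.1} ≤ x' + Set.indicator {c | 1 ≤ c.1.1} (fun _ => 1) c ∧
        ρ.toOuterMeasure {c | 2 ≤ c.1.1} ≤ y' + Set.indicator {c | 1 ≤ c.1.1} (fun _ => x') c +
          Set.indicator {c | 2 ≤ c.1.1} (fun _ => 1) c) := by
    intro c
    by_cases hc : c ∈ π.support
    swap
    · exact ⟨PMF.pure ((0, 0), c.2.bind f), PMF.pure_bind _ _, fun h => absurd h hc⟩
    obtain ⟨⟨m, n⟩, μ⟩ := c
    by_cases hm0 : (m, n) = (0, 0)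
    · obtain ⟨ρ, r1, r2, r3, r4, r5, r6⟩ := hK μ (h2 _ hc hm0)
      refine ⟨ρ, r1, fun _ => ⟨r2, r3, r4.trans le_self_add, r5.trans le_self_add,
        r6.trans ?_⟩⟩
      rw [add_assoc]
      exact le_self_add
    by_cases hm1 : (m, n) = (1, 0)
    · obtain ⟨ρ, r1, r2, r3, r4, r5, r6⟩ := hL μ (h3 _ hc hm1)
      obtain ⟨rfl, rfl⟩ := Prod.mk.inj hm1
      -- The earlier fault is added to the count. One further fault already makes two, so it is `x'`
      -- and not `z'` that enters the bound.
      refine ⟨ρ.map fun c => ((c.1.1 + 1, c.1.2), c.2), ?_, fun _ => ⟨fun c hc h0 => ?_,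
        fun c hc h0 => ?_, ?_, ?_, ?_⟩⟩
      · rw [PMF.bind_map, ← r1]
        rfl
      · obtain ⟨c, hc', rfl⟩ := (PMF.mem_support_map_iff _ _ _).mp hc
        simp at h0
      · obtain ⟨c, hc', rfl⟩ := (PMF.mem_support_map_iff _ _ _).mp hc
        refine r2 c hc' ?_
        simpa [Prod.ext_iff] using h0
      · rw [PMF.toOuterMeasure_map_apply]
        exact r4.trans le_self_add
      · refine (toOuterMeasure_le_one _ _).trans ?_
        simp
      · rw [PMF.toOuterMeasure_map_apply]
        refine le_trans ?_ (r5.trans ?_)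
        · exact ρ.toOuterMeasure.mono fun c (hc : 2 ≤ c.1.1 + 1) => (by omega : 1 ≤ c.1.1)
        · simp
    -- After two faults or a fatal event the old grade is kept and nothing is claimed about the law.
    · refine ⟨PMF.pure ((m, n), μ.bind f), PMF.pure_bind _ _, fun _ => ⟨fun c hc h0 => ?_,
        fun c hc h0 => ?_, ?_, ?_, ?_⟩⟩
      · rw [PMF.mem_support_pure_iff] at hc
        subst hc
        exact absurd h0 hm0
      · rw [PMF.mem_support_pure_iff] at hc
        subst hc
        exact absurd h0 hm1
      · rw [PMF.toOuterMeasure_pure_apply]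
        by_cases hn : 1 ≤ n <;> simp [hn]
      · rw [PMF.toOuterMeasure_pure_apply]
        by_cases hn : 1 ≤ m <;> simp [hn]
      · rw [PMF.toOuterMeasure_pure_apply]
        by_cases hn : 2 ≤ m <;> simp [hn]
  choose ρ r1 r2 using key
  refine ⟨π.bind ρ, ?_, fun c hc h0 => ?_, fun c hc h0 => ?_, ?_, ?_, ?_⟩
  · rw [← h1, PMF.bind_bind, PMF.bind_bind]
    exact congrArg _ (funext r1)
  · obtain ⟨a, ha, hc⟩ := (PMF.mem_support_bind_iff _ _ _).mp hc
    exact (r2 a ha).1 c hc h0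
  · obtain ⟨a, ha, hc⟩ := (PMF.mem_support_bind_iff _ _ _).mp hc
    exact (r2 a ha).2.1 c hc h0
  · refine (toOuterMeasure_bind_le ∅ {c | 1 ≤ c.1.2} (r := d') (s := 0) fun c hc => ?_).trans ?_
    · simpa using (r2 c hc).2.2.1
    · simp only [MeasureTheory.measure_empty, zero_mul, add_zero]
      rw [add_comm]
      gcongr
  · refine (toOuterMeasure_bind_le ∅ {c | 1 ≤ c.1.1} (r := x') (s := 0) fun c hc => ?_).trans ?_
    · simpa using (r2 c hc).2.2.2.1
    · simp only [MeasureTheory.measure_empty, zero_mul, add_zero]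
      rw [add_comm]
      gcongr
  · refine (toOuterMeasure_bind_le {c | 1 ≤ c.1.1} {c | 2 ≤ c.1.1} fun c hc =>
      (r2 c hc).2.2.2.2).trans ?_
    calc _ ≤ y' + x * x' + y := by gcongr
      _ = _ := by ring

/-- Fatal events and double faults count as failures at once, and the extra cost `δ'` of continuing
from one fault is weighted by `x`. The common part `d'` is separated so that it is charged only
once. -/
theorem Graded.bind_fails {K L : PMF α → Prop} {J : PMF β → Prop} {d x y d' δ δ' : ℝ≥0∞}
    {ν : PMF α} {f : α → PMF β} (h : Graded K L d x y ν)
    (hK : ∀ μ, K μ → Fails (d' + δ) J (μ.bind f)) (hL : ∀ μ, L μ → Fails (d' + δ') J (μ.bind f)) :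
    Fails (d + y + d' + δ + x * δ') J (ν.bind f) := by
  obtain ⟨π, h1, h2, h3, h4, h5, h6⟩ := h
  have key : ∀ c : (ℕ × ℕ) × PMF α, ∃ ρ : PMF (Bool × PMF β),
      ρ.bind Prod.snd = c.2.bind f ∧ (c ∈ π.support →
        (∀ c' ∈ ρ.support, c'.1 = false → J c'.2) ∧
        ρ.toOuterMeasure {c | c.1 = true} ≤ (d' + δ) + Set.indicator {c | 1 ≤ c.1.1} (fun _ => δ') c
          + Set.indicator ({c | 1 ≤ c.1.2} ∪ {c | 2 ≤ c.1.1}) (fun _ => 1) c) := by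
    intro c
    by_cases hc : c ∈ π.support
    swap
    · exact ⟨PMF.pure (true, c.2.bind f), PMF.pure_bind _ _, fun h => absurd h hc⟩
    obtain ⟨⟨m, n⟩, μ⟩ := c
    by_cases hm0 : (m, n) = (0, 0)
    · obtain ⟨ρ, r1, r2, r3⟩ := hK μ (h2 _ hc hm0)
      refine ⟨ρ, r1, fun _ => ⟨r2, r3.trans ?_⟩⟩
      rw [add_assoc (d' + δ)]
      exact le_self_add
    by_cases hm1 : (m, n) = (1, 0)
    · obtain ⟨ρ, r1, r2, r3⟩ := hL μ (h3 _ hc hm1)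
      obtain ⟨rfl, rfl⟩ := Prod.mk.inj hm1
      refine ⟨ρ, r1, fun _ => ⟨r2, r3.trans ?_⟩⟩
      rw [Set.indicator_of_mem (s := {c : (ℕ × ℕ) × PMF α | 1 ≤ c.1.1}) (by simp)]
      calc d' + δ' ≤ d' + δ' + δ := le_self_add
        _ = d' + δ + δ' := by ring
        _ ≤ _ := le_self_add
    · refine ⟨PMF.pure (true, μ.bind f), PMF.pure_bind _ _, fun _ => ⟨fun c hc h0 => ?_, ?_⟩⟩
      · rw [PMF.mem_support_pure_iff] at hc
        subst hc
        simp at h0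
      · refine (toOuterMeasure_le_one _ _).trans ?_
        rw [Set.indicator_of_mem (s := ({c | 1 ≤ c.1.2} ∪ {c | 2 ≤ c.1.1} :
          Set ((ℕ × ℕ) × PMF α)))]
        · exact le_add_self
        · simp only [Prod.mk.injEq, not_and] at hm0 hm1
          change 1 ≤ n ∨ 2 ≤ m
          omega
  choose ρ r1 r2 using key
  refine ⟨π.bind ρ, ?_, fun c hc h0 => ?_, ?_⟩
  · rw [← h1, PMF.bind_bind, PMF.bind_bind]
    exact congrArg _ (funext r1)
  · obtain ⟨a, ha, hc⟩ := (PMF.mem_support_bind_iff _ _ _).mp hc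
    exact (r2 a ha).1 c hc h0
  · refine (toOuterMeasure_bind_le {c | 1 ≤ c.1.1} _ fun c hc => (r2 c hc).2).trans ?_
    calc _ ≤ d' + δ + x * δ' + (d + y) := by
          gcongr
          exact (MeasureTheory.measure_union_le _ _).trans (add_le_add h4 h6)
      _ = _ := by ring

theorem Graded.fails {K L : PMF α → Prop} {d x y : ℝ≥0∞} {ν : PMF α} (h : Graded K L d x y ν) :
    Fails (d + x) K ν := by
  obtain ⟨π, h1, h2, h3, h4, h5, h6⟩ := h
  refine ⟨π.map fun c => (decide (c.1 ≠ (0, 0)), c.2), ?_, fun c hc h0 => ?_, ?_⟩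
  · rw [PMF.bind_map, ← h1]
    rfl
  · obtain ⟨c, hc', rfl⟩ := (PMF.mem_support_map_iff _ _ _).mp hc
    exact h2 c hc' (by simpa using h0)
  · rw [PMF.toOuterMeasure_map_apply]
    refine le_trans (π.toOuterMeasure.mono (s₂ := {c | 1 ≤ c.1.2} ∪ {c | 1 ≤ c.1.1}) ?_)
      ((MeasureTheory.measure_union_le _ _).trans (add_le_add h4 h5))
    rintro ⟨⟨m, n⟩, μ⟩ hc
    simp only [Set.mem_preimage, Set.mem_ofPred_eq, decide_eq_true_eq, ne_eq, Prod.mk.injEq,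
      not_and] at hc
    change 1 ≤ n ∨ 1 ≤ m
    omega

theorem Fails.bind_graded {K : PMF α → Prop} {P Q : PMF β → Prop} {δ d x y : ℝ≥0∞} {ν : PMF α}
    {f : α → PMF β} (h : Fails δ K ν) (hK : ∀ μ, K μ → Graded P Q d x y (μ.bind f)) :
    Graded P Q (δ + d) x y (ν.bind f) := by
  simpa using h.graded_fatal.bind (z' := 0) hK fun μ hμ => hμ.elim

theorem Fails.bind {K : PMF α → Prop} {J : PMF β → Prop} {δ δ' : ℝ≥0∞} {ν : PMF α}
    {f : α → PMF β} (h : Fails δ K ν) (hK : ∀ μ, K μ → Fails δ' J (μ.bind f)) :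
    Fails (δ + δ') J (ν.bind f) := by
  simpa using (h.bind_graded fun μ hμ => (hK μ hμ).graded_fatal).fails

theorem Fails.of_graded {K P Q : PMF α → Prop} {δ d x y : ℝ≥0∞} {ν : PMF α} (h : Fails δ K ν)
    (hK : ∀ μ, K μ → Graded P Q d x y μ) : Graded P Q (δ + d) x y ν := by
  simpa using h.bind_graded (f := PMF.pure) fun μ hμ => by simpa using hK μ hμ

theorem Fails.pair {K : PMF α → Prop} {J : PMF β → Prop} {δ δ' : ℝ≥0∞} {μ : PMF α} {ν : PMF β}
    (h : Fails δ K μ) (h' : Fails δ' J ν) :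
    Fails (δ + δ') (fun ρ => ∃ μ ν, K μ ∧ J ν ∧ ρ = FT.pair μ ν) (FT.pair μ ν) := by
  refine Fails.bind h fun μ₀ h₀ => ?_
  exact h'.lift (fun ν => FT.pair μ₀ ν) (fun π => pair_bind_right _ _ _)
    fun ν₀ h₁ => ⟨μ₀, ν₀, h₀, h₁, rfl⟩

theorem Graded.pair {K L : PMF α → Prop} {K' L' : PMF β → Prop} {d x y d' x' y' : ℝ≥0∞}
    {μ : PMF α} {ν : PMF β} (h : Graded K L d x y μ) (h' : Graded K' L' d' x' y' ν) :
    Graded (fun ρ => ∃ μ ν, K μ ∧ K' ν ∧ ρ = FT.pair μ ν)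
      (fun ρ => ∃ μ ν, (K μ ∧ L' ν ∨ L μ ∧ K' ν) ∧ ρ = FT.pair μ ν)
      (d + d') (x + x') (y + y' + x * x') (FT.pair μ ν) := by
  refine Graded.bind h (z' := y') (fun μ₀ h₀ => ?_) fun μ₀ h₀ => ?_
  · exact h'.lift (fun ν => FT.pair μ₀ ν) (fun π => pair_bind_right _ _ _)
      (fun ν₀ h₁ => ⟨μ₀, ν₀, h₀, h₁, rfl⟩) fun ν₀ h₁ => ⟨μ₀, ν₀, Or.inl ⟨h₀, h₁⟩, rfl⟩
  · exact h'.lift (fun ν => FT.pair μ₀ ν) (fun π => pair_bind_right _ _ _)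
      (fun ν₀ h₁ => ⟨μ₀, ν₀, Or.inr ⟨h₀, h₁⟩, rfl⟩) fun ν₀ h₁ => trivial

/-- Independent samples, each of which may fail. -/
theorem graded_indep {n : ℕ} {μ : Fin n → PMF α} {K : Fin n → PMF α → Prop} {δ : ℝ≥0∞}
    (h : ∀ i, Fails δ (K i) (μ i)) {P Q : PMF (Fin n → α) → Prop}
    (hP : ∀ g : Fin n → PMF α, (∀ i, K i (g i)) → P (indep g))
    (hQ : ∀ i, ∀ g : Fin n → PMF α, (∀ j, j ≠ i → K j (g j)) → (∃ a, g i = PMF.pure a) →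
      Q (indep g)) :
    Graded P Q 0 (n * δ) (n.choose 2 * δ ^ 2) (indep μ) := by
  classical
  -- Failed samples are made deterministic here; this provides the point mass that `hQ` allows for
  -- at the failed place.
  choose π h1 h2 h3 h4 using fun i => (h i).refine
  set cnt : (Fin n → Bool × PMF α) → ℕ := fun v => {i | (v i).1 = true}.toFinset.card with hcnt
  obtain ⟨m1, m2⟩ := toOuterMeasure_indep_flag (μ := π) (F := {c | c.1 = true}) h4
  refine ⟨(indep π).map fun v => ((cnt v, 0), indep fun i => (v i).2), ?_, fun c hc h0 => ?_,
    fun c hc h0 => ?_, ?_, ?_, ?_⟩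
  · rw [PMF.bind_map]
    refine (indep_bind_indep π fun _ c => c.2).trans ?_
    exact congrArg _ (funext h1)
  · obtain ⟨v, hv, rfl⟩ := (PMF.mem_support_map_iff _ _ _).mp hc
    rw [mem_support_indep] at hv
    refine hP _ fun i => h2 i _ (hv i) ?_
    have h5 : cnt v = 0 := (Prod.mk.inj h0).1
    rw [hcnt, Finset.card_eq_zero] at h5
    by_contra h6
    have : i ∈ ({i | (v i).1 = true}.toFinset : Finset (Fin n)) := by simpa using h6
    simp [h5] at this
  · obtain ⟨v, hv, rfl⟩ := (PMF.mem_support_map_iff _ _ _).mp hc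
    rw [mem_support_indep] at hv
    have h5 : cnt v = 1 := (Prod.mk.inj h0).1
    obtain ⟨i, hi⟩ := Finset.card_eq_one.mp h5
    have h6 : ∀ j, (v j).1 = true ↔ j = i := by
      intro j
      have := Finset.ext_iff.mp hi j
      simpa using this
    refine hQ i _ (fun j hj => h2 j _ (hv j) ?_) (h3 i _ (hv i) ((h6 i).mpr rfl))
    simpa using mt (h6 j).mp hj
  · rw [PMF.toOuterMeasure_map_apply]
    simp
  · rw [PMF.toOuterMeasure_map_apply]
    refine le_trans ((indep π).toOuterMeasure.mono fun v hv => ?_) m1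
    obtain ⟨i, hi⟩ := Finset.card_pos.mp (show 0 < cnt v from hv)
    exact ⟨i, by simpa using hi⟩
  · rw [PMF.toOuterMeasure_map_apply]
    refine le_trans ((indep π).toOuterMeasure.mono fun v hv => ?_) m2
    obtain ⟨i, hi, j, hj, hij⟩ := Finset.one_lt_card.mp (show 1 < cnt v from hv)
    exact ⟨i, j, hij, by simpa using hi, by simpa using hj⟩

/-- Conditioning on few faults and no fatal event. -/
theorem Graded.normalize {K L : PMF α → Prop} {d x y : ℝ≥0∞} {ν : PMF α}
    (h : Graded K L d x y ν) (hdy : d + y < 1) :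
    Fails (d + y) (Graded K L 0 (x / (1 - (d + y))) 0) ν := by
  classical
  obtain ⟨π, h1, h2, h3, h4, h5, h6⟩ := h
  set bad : (ℕ × ℕ) × PMF α → Bool := fun c => decide (1 ≤ c.1.2 ∨ 2 ≤ c.1.1) with hbad
  have hB : π.toOuterMeasure {c | bad c = true} ≤ d + y := by
    refine le_trans (π.toOuterMeasure.mono (s₂ := {c | 1 ≤ c.1.2} ∪ {c | 2 ≤ c.1.1}) ?_)
      ((MeasureTheory.measure_union_le _ _).trans (add_le_add h4 h6))
    intro c hc
    simpa [hbad] using hc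
  have hG : 1 - (d + y) ≤ π.toOuterMeasure {c | bad c = false} := by
    rw [tsub_le_iff_left]
    calc (1 : ℝ≥0∞) = π.toOuterMeasure Set.univ :=
          ((PMF.toOuterMeasure_apply_eq_one_iff π _).mpr (Set.subset_univ _)).symm
      _ ≤ π.toOuterMeasure ({c | bad c = true} ∪ {c | bad c = false}) := by
          refine π.toOuterMeasure.mono fun c _ => ?_
          cases hc : bad c
          · exact Or.inr hc
          · exact Or.inl hc
      _ ≤ _ := (MeasureTheory.measure_union_le _ _).trans (add_le_add hB le_rfl)
  have hne : ∃ c ∈ {c | bad c = false}, c ∈ π.support := by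
    rw [← toOuterMeasure_ne_zero_iff]
    intro h0
    rw [h0, nonpos_iff_eq_zero, tsub_eq_zero_iff_le] at hG
    exact absurd hG (not_le.mpr hdy)
  -- The hidden bit `bad` becomes the failure flag. Given that it is `false`, only the grades `(0,
  -- 0)` and `(1, 0)` remain.
  refine ⟨(π.map bad).map fun b => (b, (condOn π {c | bad c = b}).bind Prod.snd), ?_,
    fun c hc h0 => ?_, ?_⟩
  · rw [PMF.bind_map, ← h1]
    conv_rhs => rw [← map_bind_condOn π bad, PMF.bind_bind]
    rfl
  · obtain ⟨b, hb, rfl⟩ := (PMF.mem_support_map_iff _ _ _).mp hc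
    obtain rfl : b = false := h0
    have hs : ∀ c, c ∈ (condOn π {c | bad c = false}).support →
        bad c = false ∧ c ∈ π.support := fun c hc => (mem_support_condOn hne).mp hc
    refine ⟨condOn π {c | bad c = false}, rfl, fun c hc => h2 c (hs c hc).2,
      fun c hc => h3 c (hs c hc).2, ?_, ?_, ?_⟩
    · refine le_of_eq (toOuterMeasure_eq_zero_of_support fun c hc h => ?_)
      have := (hs c hc).1
      simp only [hbad, decide_eq_false_iff_not] at this
      exact this (Or.inl h)
    · refine (toOuterMeasure_condOn_le hne _).trans ?_
      exact ENNReal.div_le_div h5 hG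
    · refine le_of_eq (toOuterMeasure_eq_zero_of_support fun c hc h => ?_)
      have := (hs c hc).1
      simp only [hbad, decide_eq_false_iff_not] at this
      exact this (Or.inr h)
  · rw [PMF.toOuterMeasure_map_apply, PMF.toOuterMeasure_map_apply]
    exact hB

/-- Conditioning on an event that is certain in the absence of faults. -/
theorem Graded.condOn {K L P Q : PMF α → Prop} {x y : ℝ≥0∞} {ν : PMF α} {S : Set α}
    (h : Graded K L 0 x y ν) (hx : x < 1) (hK : ∀ μ, K μ → ∀ a ∈ μ.support, a ∈ S)
    (hP : ∀ μ, K μ → P μ)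
    (hQ : ∀ μ, L μ → (∃ a ∈ S, a ∈ μ.support) → Q (FT.condOn μ S)) :
    1 - x ≤ ν.toOuterMeasure S ∧
      Graded P Q 0 (x / (1 - x)) (y / (1 - x)) (FT.condOn ν S) := by
  obtain ⟨π, rfl, h2, h3, h4, h5, h6⟩ := h
  have hd : ∀ c ∈ π.support, c.1.2 = 0 := fun c hc => by
    have := notMem_of_toOuterMeasure_eq_zero (nonpos_iff_eq_zero.mp h4) hc
    simpa using this
  have hG : 1 - x ≤ (π.bind Prod.snd).toOuterMeasure S := by
    rw [tsub_le_iff_left, ← (PMF.toOuterMeasure_apply_eq_one_iff (π.bind Prod.snd) Set.univ).mpr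
      (Set.subset_univ _)]
    -- Only components with a fault can leave `S`.
    have h7 : (π.bind Prod.snd).toOuterMeasure Sᶜ ≤ x := by
      refine (toOuterMeasure_bind_le ∅ {c | 1 ≤ c.1.1} (r := 0) (s := 0) fun c hc => ?_).trans ?_
      · by_cases hc1 : 1 ≤ c.1.1
        · simpa [hc1] using toOuterMeasure_le_one _ _
        · rw [toOuterMeasure_eq_zero_of_support]
          · exact zero_le
          · intro a ha
            rw [Set.notMem_compl_iff]
            exact hK _ (h2 c hc (Prod.ext (by simpa using hc1) (hd c hc))) a ha
      · simpa using h5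
    refine le_trans (PMF.toOuterMeasure_mono _ (t := Sᶜ ∪ S) fun a _ => ?_)
      ((MeasureTheory.measure_union_le _ _).trans (add_le_add h7 le_rfl))
    by_cases ha : a ∈ S
    · exact Or.inr ha
    · exact Or.inl ha
  refine ⟨hG, ?_⟩
  have hne : ∃ a ∈ S, a ∈ (π.bind Prod.snd).support := by
    rw [← toOuterMeasure_ne_zero_iff]
    intro h0
    rw [h0, nonpos_iff_eq_zero, tsub_eq_zero_iff_le] at hG
    exact absurd hG (not_le.mpr hx)
  obtain ⟨π', b1, b2, b3⟩ := condOn_bind hne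
  rw [b3]
  refine ⟨π'.map fun c => (c.1, FT.condOn c.2 S), ?_, fun c hc h0 => ?_, fun c hc h0 => ?_,
    ?_, ?_, ?_⟩
  · rw [PMF.bind_map]
    rfl
  · obtain ⟨c, hc', rfl⟩ := (PMF.mem_support_map_iff _ _ _).mp hc
    have hc2 := h2 c (b1 c hc').1 h0
    simp only
    rw [condOn_of_support_subset (hK _ hc2)]
    exact hP _ hc2
  · obtain ⟨c, hc', rfl⟩ := (PMF.mem_support_map_iff _ _ _).mp hc
    exact hQ _ (h3 c (b1 c hc').1 h0) (b1 c hc').2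
  all_goals
    rw [PMF.toOuterMeasure_map_apply]
    refine (b2 _).trans ?_
  · exact (ENNReal.div_le_div h4 hG).trans (by simp)
  · exact ENNReal.div_le_div h5 hG
  · exact ENNReal.div_le_div h6 hG

end Faults

/-! ### The Hamming code -/

section Code

theorem relBits_eq_zero_iff (x : Fin 7 → ZMod 2) : relBits x = 0 ↔ parityCheck *ᵥ x = 0 := by
  revert x
  decide +kernel

/-- `relBits` depends on its argument only through the syndrome. -/
theorem relBits_add_code (x : Fin 7 → ZMod 2) {c : Fin 7 → ZMod 2} (hc : relBits c = 0) :
    relBits (x + c) = relBits x := by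
  unfold relBits
  rw [Matrix.mulVec_add, (relBits_eq_zero_iff c).mp hc, add_zero]

theorem logicalBit_add_code (x : Fin 7 → ZMod 2) {c : Fin 7 → ZMod 2} (hc : relBits c = 0) :
    logicalBit (x + c) = logicalBit x + logicalBit c := by
  simp only [logicalBit, relBits_add_code x hc, hc, Finset.sum_add_distrib, Pi.add_apply,
    Pi.zero_apply, add_zero]
  ring

theorem relBits_add_relBits (x : Fin 7 → ZMod 2) : relBits (x + relBits x) = 0 := by
  rw [relBits_eq_zero_iff, Matrix.mulVec_add, (relBits_self x).1]
  exact CharTwo.add_self_eq_zero _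

theorem logicalBit_add_relBits (x : Fin 7 → ZMod 2) :
    logicalBit (x + relBits x) = logicalBit x := by
  simp only [logicalBit, relBits_add_relBits, Pi.add_apply, Pi.zero_apply, add_zero]

theorem relBits_single (i : Fin 7) (a : ZMod 2) : relBits (Pi.single i a) = Pi.single i a := by
  revert i a
  decide +kernel

theorem relBits_const (a : ZMod 2) : relBits (fun _ => a) = 0 := by
  revert a
  decide +kernel

theorem logicalBit_const (a : ZMod 2) : logicalBit (fun _ => a) = a := by
  revert a
  decide +kernel

/-- The Hamming code is perfect: every non-zero syndrome is a column of the parity check matrix. -/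
theorem relBits_weight_le_one (x : Fin 7 → ZMod 2) : ∃ i, ∀ j, j ≠ i → relBits x j = 0 := by
  revert x
  decide +kernel

theorem eq_add_single {c x : Fin 7 → ZMod 2} {i : Fin 7} (h : ∀ j, j ≠ i → x j = c j) :
    x = Pi.single i (x i - c i) + c := by
  funext j
  by_cases hj : j = i
  · subst hj; simp
  · simp [hj, h j hj]

/-- A code word with an error at `i` has the syndrome of that single error, which is its own
representative of least weight. -/
theorem relBits_of_eq_off {c x : Fin 7 → ZMod 2} {i : Fin 7} (hc : relBits c = 0)
    (h : ∀ j, j ≠ i → x j = c j) {j : Fin 7} (hj : j ≠ i) : relBits x j = 0 := by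
  rw [eq_add_single h, relBits_add_code _ hc, relBits_single, Pi.single_eq_of_ne hj]

theorem logicalBit_of_eq_off {c x : Fin 7 → ZMod 2} {i : Fin 7} (hc : relBits c = 0)
    (h : ∀ j, j ≠ i → x j = c j) : logicalBit x = logicalBit c := by
  have h0 : logicalBit (Pi.single i (x i - c i)) = 0 := by
    simp only [logicalBit, relBits_single]
    exact Finset.sum_eq_zero fun j _ => CharTwo.add_self_eq_zero _
  rw [eq_add_single h, logicalBit_add_code _ hc, h0, zero_add]

/-- Seven Pauli operators with trivial syndrome. -/
def IsCode (t : Fin 7 → Pauli) : Prop :=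
  relBits (fun i => (t i).1) = 0 ∧ relBits (fun i => (t i).2) = 0

theorem isCode_zero : IsCode fun _ => 0 := ⟨relBits_const 0, relBits_const 0⟩

theorem decodePauli_zero : decodePauli (fun _ => 0) = 0 :=
  Prod.ext (logicalBit_const 0) (logicalBit_const 0)

theorem IsCode.relPauli_eq_off {t w : Fin 7 → Pauli} (ht : IsCode t) {i : Fin 7}
    (h : ∀ j, j ≠ i → w j = t j) {j : Fin 7} (hj : j ≠ i) : relPauli w j = 0 :=
  Prod.ext (relBits_of_eq_off ht.1 (fun j hj => by rw [h j hj]) hj)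
    (relBits_of_eq_off ht.2 (fun j hj => by rw [h j hj]) hj)

theorem IsCode.decodePauli_eq_off {t w : Fin 7 → Pauli} (ht : IsCode t) {i : Fin 7}
    (h : ∀ j, j ≠ i → w j = t j) : decodePauli w = decodePauli t := by
  have h1 := logicalBit_of_eq_off (x := fun j => (w j).1) ht.1 fun j hj => by rw [h j hj]
  have h2 := logicalBit_of_eq_off (x := fun j => (w j).2) ht.2 fun j hj => by rw [h j hj]
  rw [decodePauli, h1, h2, decodePauli]

theorem IsCode.relPauli {t : Fin 7 → Pauli} (ht : IsCode t) (i : Fin 7) : relPauli t i = 0 :=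
  Prod.ext (congrFun ht.1 i) (congrFun ht.2 i)

theorem fill_zero {α : Type} [AddCommGroup α] : (k : ℕ) → fill (0 : α) k = 0
  | 0 => rfl
  | k + 1 => funext fun _ => fill_zero k

end Code

/-! ### Classes of laws on blocks -/

section Classes

variable {k : ℕ}

/-- Independent subblocks, of which those outside `S` have laws in `T`, with states given by `t`. -/
def Off (T : Pauli → PMF (Block k) → Prop) (S : Set (Fin 7)) (t : Fin 7 → Pauli)
    (ν : PMF (Fin 7 → Block k)) : Prop :=
  ∃ m : Fin 7 → PMF (Block k), (∀ j, j ∉ S → T (t j) (m j)) ∧ ν = indep m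

/-- A block in state `s` all of whose subblocks are controlled. -/
def Clean (T : Pauli → PMF (Block k) → Prop) (s : Pauli) (ν : PMF (Fin 7 → Block k)) : Prop :=
  ∃ t, IsCode t ∧ decodePauli t = s ∧ Off T ∅ t ν

/-- A block in state `s` with at most one uncontrolled subblock. -/
def OneBad (T : Pauli → PMF (Block k) → Prop) (s : Pauli) (ν : PMF (Fin 7 → Block k)) : Prop :=
  ∃ t i, IsCode t ∧ decodePauli t = s ∧ Off T {i} t ν

/-- A block in state `s` with a hidden label that is non-empty with probability at most `a`. -/
def Labelled (T : Pauli → PMF (Block k) → Prop) (a : ℝ≥0∞) (s : Pauli)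
    (ν : PMF (Fin 7 → Block k)) : Prop :=
  Graded (Clean T s) (OneBad T s) 0 a 0 ν

/-- A structural strengthening of wellness for a block in state `s`. -/
def Tame (q : ℕ → ℝ≥0∞) : (k : ℕ) → Pauli → PMF (Block k) → Prop
  | 0, s, μ => μ = PMF.pure s
  | k + 1, s, μ => Labelled (Tame q k) (q (k + 1)) s μ

theorem Clean.oneBad {T : Pauli → PMF (Block k) → Prop} {s : Pauli} {ν : PMF (Fin 7 → Block k)}
    (h : Clean T s ν) : OneBad T s ν := by
  obtain ⟨t, h1, h2, m, h3, h4⟩ := h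
  exact ⟨t, 0, h1, h2, m, fun j _ => h3 j (Set.notMem_empty j), h4⟩

theorem Clean.labelled {T : Pauli → PMF (Block k) → Prop} {s : Pauli}
    {ν : PMF (Fin 7 → Block k)} (h : Clean T s ν) (a : ℝ≥0∞) : Labelled T a s ν :=
  Graded.of_self h _ _ _

/-- Closure properties of a class of laws of blocks in given states. -/
structure Sound (T : Pauli → PMF (Block k) → Prop) : Prop where
  state_eq : ∀ {s μ}, T s μ → ∀ e ∈ μ.support, state k e = s
  had : ∀ {s μ}, T s μ → T s.swap (μ.map (FT.had k))
  shift : ∀ {s μ}, T s μ → ∀ c, T (s + c) (μ.map fun e => e + fill c k)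

/-- The zero bounds on fatal events and on double faults leave only the grades `(0, 0)` and `(1, 0)`
in the support. -/
theorem Graded.exists_of_mem_support {α : Type} {K L : PMF α → Prop} {x : ℝ≥0∞} {ν : PMF α}
    (h : Graded K L 0 x 0 ν) {a : α} (ha : a ∈ ν.support) :
    ∃ μ, (K μ ∨ L μ) ∧ a ∈ μ.support := by
  obtain ⟨π, rfl, h2, h3, h4, h5, h6⟩ := h
  obtain ⟨⟨⟨m, n⟩, μ⟩, hc, ha⟩ := (PMF.mem_support_bind_iff _ _ _).mp ha
  have e1 := notMem_of_toOuterMeasure_eq_zero (nonpos_iff_eq_zero.mp h4) hc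
  have e2 := notMem_of_toOuterMeasure_eq_zero (nonpos_iff_eq_zero.mp h6) hc
  simp only [Set.mem_ofPred_eq, not_le] at e1 e2
  obtain rfl : n = 0 := by omega
  refine ⟨μ, ?_, ha⟩
  rcases (by omega : m = 0 ∨ m = 1) with rfl | rfl
  · exact Or.inl (h2 _ hc rfl)
  · exact Or.inr (h3 _ hc rfl)

variable {T : Pauli → PMF (Block k) → Prop}

/-- The code corrects one arbitrary subblock, so an uncontrolled subblock does not make the state of
the block uncertain. -/
theorem OneBad.state_eq (hT : Sound T) {s : Pauli} {ν : PMF (Block (k + 1))}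
    (h : OneBad T s ν) : ∀ e ∈ ν.support, state (k + 1) e = s := by
  obtain ⟨t, i, h1, h2, m, h3, rfl⟩ := h
  intro e he
  rw [← h2]
  exact h1.decodePauli_eq_off fun j hj => hT.state_eq (h3 j hj) _ (mem_support_indep.mp he j)

theorem Off.map_had (hT : Sound T) {S : Set (Fin 7)} {t : Fin 7 → Pauli}
    {ν : PMF (Fin 7 → Block k)} (h : Off T S t ν) :
    Off T S (fun i => (t i).swap) (ν.map (had (k + 1))) := by
  obtain ⟨m, h1, rfl⟩ := h
  exact ⟨fun i => (m i).map (had k), fun j hj => hT.had (h1 j hj), indep_map m fun _ => had k⟩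

theorem Off.map_shift (hT : Sound T) {S : Set (Fin 7)} {t : Fin 7 → Pauli}
    {ν : PMF (Fin 7 → Block k)} (h : Off T S t ν) (c : Fin 7 → Pauli) :
    Off T S (fun i => t i + c i) (ν.map fun e i => e i + fill (c i) k) := by
  obtain ⟨m, h1, rfl⟩ := h
  exact ⟨fun i => (m i).map fun e => e + fill (c i) k, fun j hj => hT.shift (h1 j hj) _,
    indep_map m fun i e => e + fill (c i) k⟩

theorem IsCode.swap {t : Fin 7 → Pauli} (h : IsCode t) : IsCode fun i => (t i).swap := ⟨h.2, h.1⟩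

theorem IsCode.add {t w : Fin 7 → Pauli} (h : IsCode t) (hw : IsCode w) :
    IsCode fun i => t i + w i :=
  ⟨(relBits_add_code _ hw.1).trans h.1, (relBits_add_code _ hw.2).trans h.2⟩

theorem decodePauli_add_code (t : Fin 7 → Pauli) {w : Fin 7 → Pauli} (hw : IsCode w) :
    decodePauli (fun i => t i + w i) = decodePauli t + decodePauli w := by
  have h1 := logicalBit_add_code (fun i => (t i).1) hw.1
  have h2 := logicalBit_add_code (fun i => (t i).2) hw.2
  rw [decodePauli, decodePauli, decodePauli, Prod.mk_add_mk, ← h1, ← h2]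
  rfl

theorem isCode_const (c : Pauli) : IsCode fun _ => c := ⟨relBits_const _, relBits_const _⟩

theorem decodePauli_const (c : Pauli) : decodePauli (fun _ => c) = c :=
  Prod.ext (logicalBit_const _) (logicalBit_const _)

theorem OneBad.map_had (hT : Sound T) {s : Pauli} {ν : PMF (Fin 7 → Block k)}
    (h : OneBad T s ν) : OneBad T s.swap (ν.map (had (k + 1))) := by
  obtain ⟨t, i, h1, rfl, h3⟩ := h
  exact ⟨_, i, h1.swap, rfl, h3.map_had hT⟩

theorem Clean.map_had (hT : Sound T) {s : Pauli} {ν : PMF (Fin 7 → Block k)}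
    (h : Clean T s ν) : Clean T s.swap (ν.map (had (k + 1))) := by
  obtain ⟨t, h1, rfl, h3⟩ := h
  exact ⟨_, h1.swap, rfl, h3.map_had hT⟩

theorem OneBad.map_shift (hT : Sound T) {s : Pauli} {ν : PMF (Fin 7 → Block k)}
    (h : OneBad T s ν) (c : Pauli) :
    OneBad T (s + c) (ν.map fun e i => e i + fill c k) := by
  obtain ⟨t, i, h1, rfl, h3⟩ := h
  refine ⟨_, i, h1.add (isCode_const c), ?_, h3.map_shift hT fun _ => c⟩
  rw [decodePauli_add_code t (isCode_const c), decodePauli_const]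

theorem Clean.map_shift (hT : Sound T) {s : Pauli} {ν : PMF (Fin 7 → Block k)}
    (h : Clean T s ν) (c : Pauli) :
    Clean T (s + c) (ν.map fun e i => e i + fill c k) := by
  obtain ⟨t, h1, rfl, h3⟩ := h
  refine ⟨_, h1.add (isCode_const c), ?_, h3.map_shift hT fun _ => c⟩
  rw [decodePauli_add_code t (isCode_const c), decodePauli_const]

theorem Sound.labelled (hT : Sound T) (a : ℝ≥0∞) : Sound (k := k + 1) (Labelled T a) where
  state_eq h e he := by
    obtain ⟨μ, h1 | h1, h2⟩ := Graded.exists_of_mem_support h he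
    · exact h1.oneBad.state_eq hT e h2
    · exact h1.state_eq hT e h2
  had h := Graded.map h _ (fun _ h => h.map_had hT) fun _ h => h.map_had hT
  shift h c := Graded.map h _ (fun _ h => h.map_shift hT c) fun _ h => h.map_shift hT c

theorem sound_tame (q : ℕ → ℝ≥0∞) : (k : ℕ) → Sound (Tame q k)
  | 0 => by
    refine ⟨fun {s μ} h e he => ?_, fun {s μ} h => ?_, fun {s μ} h c => ?_⟩
    · obtain rfl : μ = PMF.pure s := h
      exact (PMF.mem_support_pure_iff _ _).mp he
    · obtain rfl : μ = PMF.pure s := h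
      exact PMF.pure_map _ _
    · obtain rfl : μ = PMF.pure s := h
      exact PMF.pure_map _ _
  | k + 1 => (sound_tame q k).labelled (q (k + 1))

/-- Two independent blocks in given states. -/
def PairIn (T : Pauli → PMF (Block k) → Prop) (s : Pauli × Pauli)
    (ρ : PMF (Block k × Block k)) : Prop :=
  ∃ μ ν, T s.1 μ ∧ T s.2 ν ∧ ρ = pair μ ν

/-- What the operations of one level guarantee: laws of blocks in known states are preserved, and
error correction and gates bring arbitrary blocks into unknown states. -/
structure Claims (G : Gadgets k) (T : Pauli → PMF (Block k) → Prop) (A B C : ℝ≥0∞) : Prop where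
  sound : Sound T
  anc : Fails A (T 0) G.anc
  ec_any : ∀ e, Fails B (fun ν => ∃ s, T s ν) (G.ec e)
  ec : ∀ {s μ}, T s μ → Fails B (T s) (μ.bind G.ec)
  cnot_any : ∀ e f, Fails C (fun ρ => ∃ s, PairIn T s ρ) (G.cnot e f)
  cnot : ∀ {s t μ ν}, T s μ → T t ν →
    Fails C (PairIn T (propagate s t)) ((pair μ ν).bind fun r => G.cnot r.1 r.2)

end Classes

/-! ### Transverse operations -/

section Transverse

variable {k : ℕ} {G : Gadgets k} {T : Pauli → PMF (Block k) → Prop} {A B C : ℝ≥0∞}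

theorem pair_bind_pair {α β γ δ : Type} (μ : PMF α) (ν : PMF β) (f : α → PMF γ) (g : β → PMF δ) :
    ((pair μ ν).bind fun r => pair (f r.1) (g r.2)) = pair (μ.bind f) (ν.bind g) := by
  rw [pair_bind, pair_bind_left]
  exact congrArg _ (funext fun a => (pair_bind_right (f a) ν g).symm)

/-- `transverseEC` on tuples of subblocks. -/
def ecs (G : Gadgets k) (e : Fin 7 → Block k) : PMF (Fin 7 → Block k) := indep fun i => G.ec (e i)

/-- `transverseCNOT` on pairs of tuples of subblocks. -/
def cnots (G : Gadgets k) (r : (Fin 7 → Block k) × (Fin 7 → Block k)) :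
    PMF ((Fin 7 → Block k) × (Fin 7 → Block k)) :=
  (indep fun i => G.cnot (r.1 i) (r.2 i)).map fun r => (fun i => (r i).1, fun i => (r i).2)

theorem ecs_indep (m : Fin 7 → PMF (Block k)) :
    (indep m).bind (ecs G) = indep fun i => (m i).bind G.ec :=
  indep_bind_indep m fun _ => G.ec

theorem Claims.ecs_off (h : Claims G T A B C) {t : Fin 7 → Pauli}
    {ν : PMF (Fin 7 → Block k)} (hν : Off T ∅ t ν) :
    Graded (Off T ∅ t) (fun ρ => ∃ i, Off T {i} t ρ) 0 (7 * B) (21 * B ^ 2)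
      (ν.bind (ecs G)) := by
  obtain ⟨m, hm, rfl⟩ := hν
  rw [ecs_indep]
  exact graded_indep (n := 7) (K := fun i => T (t i))
    (fun i => h.ec (hm i (Set.notMem_empty i))) (fun g hg => ⟨g, fun j _ => hg j, rfl⟩)
    fun i g hg _ => ⟨i, g, fun j hj => hg j hj, rfl⟩

theorem Claims.ecs_any (h : Claims G T A B C) (ν : PMF (Fin 7 → Block k)) :
    Graded (fun ρ => ∃ t, Off T ∅ t ρ) (fun _ => True) 0 (7 * B) (21 * B ^ 2)
      (ν.bind (ecs G)) := by
  -- Conditioning on the whole input makes the outputs independent, however correlated the input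
  -- was.
  refine Graded.of_forall ν fun e _ => ?_
  refine graded_indep (n := 7) (K := fun _ ν => ∃ s, T s ν) (fun i => h.ec_any (e i))
    (fun g hg => ?_) fun _ _ _ _ => trivial
  choose t ht using hg
  exact ⟨t, g, fun j _ => ht j, rfl⟩

/-- Correction brings the uncontrolled subblock into some definite state. The resulting word differs
from a code word in at most one place, so its decoding is unchanged. -/
theorem Claims.ecs_oneBad (h : Claims G T A B C) {s : Pauli}
    {ν : PMF (Fin 7 → Block k)} (hν : OneBad T s ν) :
    Graded (fun ρ => ∃ t, decodePauli t = s ∧ Off T ∅ t ρ) (fun _ => True) 0 (7 * B)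
      (21 * B ^ 2) (ν.bind (ecs G)) := by
  obtain ⟨t, i, ht, rfl, m, hm, rfl⟩ := hν
  rw [ecs_indep]
  refine graded_indep (n := 7) (K := fun j μ => ∃ s, (j ≠ i → s = t j) ∧ T s μ) (fun j => ?_)
    (fun g hg => ?_) fun _ _ _ _ => trivial
  · by_cases hj : j = i
    · exact Fails.of_forall _ fun e _ => (h.ec_any e).mono le_rfl
        fun μ ⟨s, hs⟩ => ⟨s, fun h => absurd hj h, hs⟩
    · exact (h.ec (hm j hj)).mono le_rfl fun μ hμ => ⟨_, fun _ => rfl, hμ⟩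
  · choose w hw1 hw2 using hg
    exact ⟨w, ht.decodePauli_eq_off hw1, g, fun j _ => hw2 j, rfl⟩

/-- Two blocks with independent subblocks in definite states, of which those outside `S` have laws
in `T`. -/
def OffPair (T : Pauli → PMF (Block k) → Prop) (S : Set (Fin 7)) (σ : Fin 7 → Pauli × Pauli)
    (ρ : PMF ((Fin 7 → Block k) × (Fin 7 → Block k))) : Prop :=
  ∃ m m' : Fin 7 → PMF (Block k), (∀ j, j ∉ S → T (σ j).1 (m j) ∧ T (σ j).2 (m' j)) ∧
    (∀ j, ∃ s : Pauli × Pauli, (∀ e ∈ (m j).support, state k e = s.1) ∧ ∀ e ∈ (m' j).support, state k e = s.2) ∧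
    ρ = pair (indep m) (indep m')

theorem indep_op {α β γ : Type} {n : ℕ} (m : Fin n → PMF α) (m' : Fin n → PMF β)
    (op : α → β → PMF γ) :
    ((pair (indep m) (indep m')).bind fun r => indep fun i => op (r.1 i) (r.2 i)) =
      indep fun i => (pair (m i) (m' i)).bind fun r => op r.1 r.2 := by
  rw [← indep_pair_map, PMF.bind_map]
  exact indep_bind_indep (fun i => pair (m i) (m' i)) fun _ r => op r.1 r.2

/-- The places in `S` also end in definite states: a pair in `PairIn` has them, and a point mass has
them trivially. Verification needs this, since acceptance is then decided by the component of the
mixture. -/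
theorem offPair_of_pairIn (hT : Sound T) {S : Set (Fin 7)} {σ : Fin 7 → Pauli × Pauli}
    {g : Fin 7 → PMF (Block k × Block k)} (hg : ∀ j, j ∉ S → PairIn T (σ j) (g j))
    (hS : ∀ j, j ∈ S → (∃ s, PairIn T s (g j)) ∨ ∃ a, g j = PMF.pure a) :
    OffPair T S σ ((indep g).map fun r => (fun i => (r i).1, fun i => (r i).2)) := by
  have key : ∀ j, ∃ μ ν : PMF (Block k), (j ∉ S → T (σ j).1 μ ∧ T (σ j).2 ν) ∧
      (∃ s : Pauli × Pauli, (∀ e ∈ μ.support, state k e = s.1) ∧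
        ∀ e ∈ ν.support, state k e = s.2) ∧ g j = pair μ ν := by
    intro j
    by_cases hj : j ∈ S
    · rcases hS j hj with ⟨s, μ, ν, h1, h2, h3⟩ | ⟨⟨a, b⟩, h1⟩
      · exact ⟨μ, ν, fun h => absurd hj h, ⟨s, hT.state_eq h1, hT.state_eq h2⟩, h3⟩
      · refine ⟨PMF.pure a, PMF.pure b, fun h => absurd hj h, ⟨(state k a, state k b), ?_, ?_⟩,
          h1.trans (pair_pure a b).symm⟩
        · intro e he
          rw [(PMF.mem_support_pure_iff _ _).mp he]
        · intro e he
          rw [(PMF.mem_support_pure_iff _ _).mp he]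
    · obtain ⟨μ, ν, h1, h2, h3⟩ := hg j hj
      exact ⟨μ, ν, fun _ => ⟨h1, h2⟩, ⟨σ j, hT.state_eq h1, hT.state_eq h2⟩, h3⟩
  choose m m' h1 h2 h3 using key
  refine ⟨m, m', h1, h2, ?_⟩
  rw [← indep_pair_map, funext h3]

theorem cnots_pair (m m' : Fin 7 → PMF (Block k)) :
    ((pair (indep m) (indep m')).bind (cnots G)) =
      (indep fun i => (pair (m i) (m' i)).bind fun r => G.cnot r.1 r.2).map
        fun r => (fun i => (r i).1, fun i => (r i).2) := by
  rw [← indep_op, PMF.map_bind]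
  rfl

/-- At a place in `S`, `cnot_any` still yields tame outputs in unknown states unless the gate fails;
a failing gate adds its place to the uncontrolled set. -/
theorem Claims.cnots_off (h : Claims G T A B C) {S : Set (Fin 7)}
    {t w : Fin 7 → Pauli} {ν ν' : PMF (Fin 7 → Block k)} (hν : Off T S t ν) (hν' : Off T S w ν') :
    Graded (OffPair T S fun i => propagate (t i) (w i))
      (fun ρ => ∃ i, OffPair T (insert i S) (fun i => propagate (t i) (w i)) ρ) 0 (7 * C)
      (21 * C ^ 2) ((pair ν ν').bind (cnots G)) := by
  classical
  obtain ⟨m, hm, rfl⟩ := hν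
  obtain ⟨m', hm', rfl⟩ := hν'
  rw [cnots_pair]
  refine Graded.map (graded_indep (n := 7)
    (K := fun j ρ => ∃ s, (j ∉ S → s = propagate (t j) (w j)) ∧ PairIn T s ρ)
    (P := fun ρ => ∃ g, ρ = indep g ∧
      ∀ j, ∃ s, (j ∉ S → s = propagate (t j) (w j)) ∧ PairIn T s (g j))
    (Q := fun ρ => ∃ i g, ρ = indep g ∧ (∃ a, g i = PMF.pure a) ∧
      ∀ j, j ≠ i → ∃ s, (j ∉ S → s = propagate (t j) (w j)) ∧ PairIn T s (g j))
    (fun j => ?_) (fun g hg => ⟨g, rfl, hg⟩) fun i g hg hi => ⟨i, g, rfl, hi, hg⟩) _ ?_ ?_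
  · by_cases hj : j ∈ S
    · exact Fails.of_forall _ fun e _ => (h.cnot_any e.1 e.2).mono le_rfl
        fun μ ⟨s, hs⟩ => ⟨s, fun h => absurd hj h, hs⟩
    · exact (h.cnot (hm j hj) (hm' j hj)).mono le_rfl fun μ hμ => ⟨_, fun _ => rfl, hμ⟩
  · rintro _ ⟨g, rfl, hg⟩
    refine offPair_of_pairIn h.sound (fun j hj => ?_) fun j _ => ?_
    · obtain ⟨s, hs, hs'⟩ := hg j
      rw [← hs hj]
      exact hs'
    · obtain ⟨s, _, hs'⟩ := hg j
      exact Or.inl ⟨s, hs'⟩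
  · rintro _ ⟨i, g, rfl, hi, hg⟩
    refine ⟨i, offPair_of_pairIn h.sound (fun j hj => ?_) fun j _ => ?_⟩
    · rw [Set.mem_insert_iff, not_or] at hj
      obtain ⟨s, hs, hs'⟩ := hg j hj.1
      rw [← hs hj.2]
      exact hs'
    · by_cases hj : j = i
      · exact Or.inr (hj ▸ hi)
      · obtain ⟨s, _, hs'⟩ := hg j hj
        exact Or.inl ⟨s, hs'⟩

/-! ### Syndrome extraction and correction -/

/-- Correction of the first of two blocks according to the measured relative states of the
second. -/
def fixBy (φ : Pauli → Pauli) (r : Fin 7 → Block k × Block k) : Fin 7 → Block k :=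
  fun i => (r i).1 + fill (φ (relPauli (fun j => state k (r j).2) i)) k

/-- Coupling of a block to an ancilla by the transverse operation `op`, and correction. -/
def extract (op : Block k → Block k → PMF (Block k × Block k)) (φ : Pauli → Pauli)
    (r : (Fin 7 → Block k) × (Fin 7 → Block k)) : PMF (Fin 7 → Block k) :=
  (indep fun i => op (r.1 i) (r.2 i)).map (fixBy φ)

/-- The measured states are constant on the support, so the correction is a fixed shift of each
subblock and creates no correlations. -/
theorem fixBy_off_empty (hT : Sound T) {σ : Fin 7 → Pauli × Pauli}
    {g : Fin 7 → PMF (Block k × Block k)} (hg : ∀ j, PairIn T (σ j) (g j)) (φ : Pauli → Pauli) :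
    Off T ∅ (fun i => (σ i).1 + φ (relPauli (fun j => (σ j).2) i)) ((indep g).map (fixBy φ)) := by
  choose μ ν h1 h2 h3 using hg
  obtain rfl : g = fun j => pair (μ j) (ν j) := funext h3
  refine ⟨fun i => (μ i).map fun e => e + fill (φ (relPauli (fun j => (σ j).2) i)) k,
    fun j _ => hT.shift (h1 j) _, ?_⟩
  have h4 : ∀ r ∈ (indep fun j => pair (μ j) (ν j)).support, fixBy φ r =
      fun i => (r i).1 + fill (φ (relPauli (fun j => (σ j).2) i)) k := by
    intro r hr
    rw [mem_support_indep] at hr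
    have : (fun j => state k (r j).2) = fun j => (σ j).2 :=
      funext fun j => hT.state_eq (h2 j) _ (mem_support_pair.mp (hr j)).2
    funext i
    rw [fixBy, this]
  rw [map_congr_support h4]
  refine (indep_map _ fun i (r : Block k × Block k) => r.1 + fill (φ (relPauli (fun j => (σ j).2) i)) k).trans ?_
  refine congrArg indep (funext fun i => ?_)
  conv_rhs => rw [← pair_map_fst (μ i) (ν i), PMF.map_comp]
  rfl

/-- Off `i` the measured word agrees with a code word, so a relative error can be found only at `i`,
and only there is a correction applied. It depends on the pair at `i` alone, which keeps the
subblocks independent. -/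
theorem fixBy_off_singleton (hT : Sound T) {σ : Fin 7 → Pauli × Pauli} {i : Fin 7}
    (hσ : IsCode fun j => (σ j).2)
    {g : Fin 7 → PMF (Block k × Block k)} (hg : ∀ j, j ≠ i → PairIn T (σ j) (g j))
    {φ : Pauli → Pauli} (hφ : φ 0 = 0) :
    Off T {i} (fun i => (σ i).1) ((indep g).map (fixBy φ)) := by
  classical
  set ψ : Fin 7 → Block k × Block k → Block k := fun j r => if j = i then
    r.1 + fill (φ (relPauli (Function.update (fun j => (σ j).2) i (state k r.2)) i)) k
    else r.1 with hψ
  have h4 : ∀ r ∈ (indep g).support, fixBy φ r = fun j => ψ j (r j) := by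
    intro r hr
    rw [mem_support_indep] at hr
    have h5 : ∀ j, j ≠ i → state k (r j).2 = (σ j).2 := by
      intro j hj
      obtain ⟨μ, ν, h1, h2, h3⟩ := hg j hj
      have := hr j
      rw [h3] at this
      exact hT.state_eq h2 _ (mem_support_pair.mp this).2
    have h6 : (fun j => state k (r j).2) =
        Function.update (fun j => (σ j).2) i (state k (r i).2) := by
      funext j
      by_cases hj : j = i
      · subst hj; simp
      · simp [hj, h5 j hj]
    funext j
    by_cases hj : j = i
    · subst hj
      rw [fixBy, h6, hψ]
      simp
    · have h7 := hσ.relPauli_eq_off h5 hj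
      rw [fixBy, h7, hφ, fill_zero, add_zero, hψ]
      simp [hj]
  rw [map_congr_support h4, indep_map]
  refine ⟨_, fun j hj => ?_, rfl⟩
  obtain ⟨μ, ν, h1, h2, h3⟩ := hg j hj
  have : ψ j = Prod.fst := by
    funext r
    simp only [hψ]
    rw [if_neg (show ¬ j = i from hj)]
  rw [this, h3, pair_map_fst]
  exact h1

/-- A pair operation suitable for coupling a block to an ancilla in state `0`, with its effect on
states. -/
structure Couples (T : Pauli → PMF (Block k) → Prop) (C : ℝ≥0∞)
    (op : Block k → Block k → PMF (Block k × Block k)) (pr : Pauli → Pauli → Pauli × Pauli) :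
    Prop where
  tame : ∀ {s t μ ν}, T s μ → T t ν → Fails C (PairIn T (pr s t)) ((pair μ ν).bind fun r =>
    op r.1 r.2)
  code : ∀ {t w : Fin 7 → Pauli}, IsCode t → IsCode w → decodePauli w = 0 →
    IsCode (fun i => (pr (t i) (w i)).1) ∧ IsCode (fun i => (pr (t i) (w i)).2) ∧
      decodePauli (fun i => (pr (t i) (w i)).1) = decodePauli t

variable {op : Block k → Block k → PMF (Block k × Block k)} {pr : Pauli → Pauli → Pauli × Pauli}
  {φ : Pauli → Pauli}

theorem extract_pair (m m' : Fin 7 → PMF (Block k)) :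
    (pair (indep m) (indep m')).bind (extract op φ) =
      (indep fun i => (pair (m i) (m' i)).bind fun r => op r.1 r.2).map (fixBy φ) := by
  rw [← indep_op, PMF.map_bind]
  rfl

theorem Couples.extract_off (hT : Sound T) (h : Couples T C op pr) (φ : Pauli → Pauli)
    {t w : Fin 7 → Pauli} {ν ν' : PMF (Fin 7 → Block k)} (hν : Off T ∅ t ν) (hν' : Off T ∅ w ν') :
    Graded (Off T ∅ fun i =>
        (pr (t i) (w i)).1 + φ (relPauli (fun j => (pr (t j) (w j)).2) i))
      (fun _ => True) 0 (7 * C) (21 * C ^ 2) ((pair ν ν').bind (extract op φ)) := by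
  obtain ⟨m, hm, rfl⟩ := hν
  obtain ⟨m', hm', rfl⟩ := hν'
  rw [extract_pair]
  refine Graded.map (graded_indep (n := 7) (K := fun j => PairIn T (pr (t j) (w j)))
    (P := fun ρ => ∃ g, ρ = indep g ∧ ∀ j, PairIn T (pr (t j) (w j)) (g j))
    (Q := fun _ => True)
    (fun j => h.tame (hm j (Set.notMem_empty j)) (hm' j (Set.notMem_empty j)))
    (fun g hg => ⟨g, rfl, hg⟩) fun _ _ _ _ => trivial) _ ?_ fun _ _ => trivial
  rintro _ ⟨g, rfl, hg⟩
  exact fixBy_off_empty hT hg φ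

theorem Couples.extract_clean (hT : Sound T) (h : Couples T C op pr) (hφ : φ 0 = 0) {s : Pauli}
    {ν ν' : PMF (Fin 7 → Block k)} (hν : Clean T s ν) (hν' : Clean T 0 ν') :
    Graded (Clean T s) (OneBad T s) 0 (7 * C) (21 * C ^ 2)
      ((pair ν ν').bind (extract op φ)) := by
  obtain ⟨t, ht, rfl, m, hm, rfl⟩ := hν
  obtain ⟨w, hw, hw0, m', hm', rfl⟩ := hν'
  obtain ⟨c1, c2, c3⟩ := h.code ht hw hw0
  rw [extract_pair]
  refine Graded.map (graded_indep (n := 7) (K := fun j => PairIn T (pr (t j) (w j)))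
    (P := fun ρ => ∃ g, ρ = indep g ∧ ∀ j, PairIn T (pr (t j) (w j)) (g j))
    (Q := fun ρ => ∃ i g, ρ = indep g ∧ ∀ j, j ≠ i → PairIn T (pr (t j) (w j)) (g j))
    (fun j => h.tame (hm j (Set.notMem_empty j)) (hm' j (Set.notMem_empty j)))
    (fun g hg => ⟨g, rfl, hg⟩) fun i g hg _ => ⟨i, g, rfl, hg⟩) _ ?_ ?_
  · rintro _ ⟨g, rfl, hg⟩
    refine ⟨_, c1, c3, ?_⟩
    have := fixBy_off_empty hT hg φ
    simp only [c2.relPauli, hφ, add_zero] at this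
    exact this
  · rintro _ ⟨i, g, rfl, hg⟩
    exact ⟨_, i, c1, c3, fixBy_off_singleton hT c2 hg hφ⟩

/-- One index `i` serves for an uncontrolled subblock in the block as well as in the ancilla:
coupling confines it to place `i` of the result, where nothing is required. -/
theorem Couples.extract_oneBad (hT : Sound T) (h : Couples T C op pr) (hφ : φ 0 = 0)
    {i : Fin 7} {t w : Fin 7 → Pauli} (ht : IsCode t) (hw : IsCode w) (hw0 : decodePauli w = 0)
    {ν ν' : PMF (Fin 7 → Block k)} (hν : Off T {i} t ν) (hν' : Off T {i} w ν') :
    Graded (OneBad T (decodePauli t)) (fun _ => True) 0 (7 * C) (21 * C ^ 2)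
      ((pair ν ν').bind (extract op φ)) := by
  obtain ⟨m, hm, rfl⟩ := hν
  obtain ⟨m', hm', rfl⟩ := hν'
  obtain ⟨c1, c2, c3⟩ := h.code ht hw hw0
  rw [extract_pair]
  refine Graded.map (graded_indep (n := 7) (K := fun j ρ => j ≠ i → PairIn T (pr (t j) (w j)) ρ)
    (P := fun ρ => ∃ g, ρ = indep g ∧ ∀ j, j ≠ i → PairIn T (pr (t j) (w j)) (g j))
    (Q := fun _ => True) (fun j => ?_)
    (fun g hg => ⟨g, rfl, hg⟩) fun _ _ _ _ => trivial) _ ?_ fun _ _ => trivial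
  · by_cases hj : j = i
    · exact Fails.of_self (fun h => absurd hj h) _
    · exact (h.tame (hm j hj) (hm' j hj)).mono le_rfl fun μ hμ _ => hμ
  · rintro _ ⟨g, rfl, hg⟩
    exact ⟨_, i, c1, c3, fixBy_off_singleton hT c2 hg hφ⟩

variable {a : ℝ≥0∞} {anc : PMF (Fin 7 → Block k)}

theorem Graded.pair_right {α β : Type} {K L : PMF β → Prop} {d x y : ℝ≥0∞} {ν : PMF β}
    (h : Graded K L d x y ν) (μ : PMF α) :
    Graded (fun ρ => ∃ ν, K ν ∧ ρ = FT.pair μ ν) (fun ρ => ∃ ν, L ν ∧ ρ = FT.pair μ ν) d x y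
      (FT.pair μ ν) :=
  h.lift (fun ν => FT.pair μ ν) (fun _ => pair_bind_right _ _ _) (fun ν h => ⟨ν, h, rfl⟩)
    fun ν h => ⟨ν, h, rfl⟩

theorem Off.subset {S S' : Set (Fin 7)} (hS : S ⊆ S') {t : Fin 7 → Pauli}
    {ν : PMF (Fin 7 → Block k)} (h : Off T S t ν) : Off T S' t ν := by
  obtain ⟨m, h1, h2⟩ := h
  exact ⟨m, fun j hj => h1 j fun h => hj (hS h), h2⟩

/-- An uncontrolled subblock of the ancilla and a failed gate have the same effect, one uncontrolled
subblock in the result; hence both count as faults, and only failure of the ancilla is fatal. -/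
theorem Couples.correct_clean (hT : Sound T) (h : Couples T C op pr) (hφ : φ 0 = 0)
    (hanc : Graded (Clean T 0) (OneBad T 0) A a 0 anc) {s : Pauli}
    {ν : PMF (Fin 7 → Block k)} (hν : Clean T s ν) :
    Graded (Clean T s) (OneBad T s) A (a + 7 * C) (21 * C ^ 2 + a * (7 * C))
      ((pair ν anc).bind (extract op φ)) := by
  have := Graded.bind (K' := Clean T s) (L' := OneBad T s) (f := extract op φ) (d' := 0)
    (x' := 7 * C) (y' := 21 * C ^ 2) (z' := 21 * C ^ 2) (hanc.pair_right ν) ?_ ?_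
  · simpa using this
  · rintro _ ⟨ν', hν', rfl⟩
    exact h.extract_clean hT hφ hν hν'
  · rintro _ ⟨ν', ⟨w, i, hw, hw0, hν'⟩, rfl⟩
    obtain ⟨t, ht, rfl, hν⟩ := hν
    exact h.extract_oneBad hT hφ ht hw hw0 (hν.subset (Set.empty_subset _)) hν'

theorem Couples.correct_oneBad (hT : Sound T) (h : Couples T C op pr) (hφ : φ 0 = 0)
    (hanc : Graded (Clean T 0) (OneBad T 0) A a 0 anc) {s : Pauli}
    {ν : PMF (Fin 7 → Block k)} (hν : OneBad T s ν) :
    Graded (OneBad T s) (fun _ => True) A (a + 7 * C) (21 * C ^ 2 + a * (7 * C))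
      ((pair ν anc).bind (extract op φ)) := by
  have := Graded.bind (K' := OneBad T s) (L' := fun _ => True) (f := extract op φ) (d' := 0)
    (x' := 7 * C) (y' := 21 * C ^ 2) (z' := 0) (hanc.pair_right ν) ?_ ?_
  · simpa using this
  · rintro _ ⟨ν', ⟨w, hw, hw0, hν'⟩, rfl⟩
    obtain ⟨t, i, ht, rfl, hν⟩ := hν
    exact h.extract_oneBad hT hφ ht hw hw0 hν (hν'.subset (Set.empty_subset _))
  · rintro _ _
    exact Graded.of_self trivial _ _ _

/-- Here `t` may have any syndrome; this is the step by which a badly damaged block is restored. -/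
theorem Couples.correct_off (hT : Sound T) (h : Couples T C op pr) (φ : Pauli → Pauli)
    (hanc : Graded (Clean T 0) (OneBad T 0) A a 0 anc) {t : Fin 7 → Pauli}
    {ν : PMF (Fin 7 → Block k)} (hν : Off T ∅ t ν) :
    Graded (fun ρ => ∃ w, IsCode w ∧ decodePauli w = 0 ∧ Off T ∅ (fun i =>
        (pr (t i) (w i)).1 + φ (relPauli (fun j => (pr (t j) (w j)).2) i)) ρ)
      (fun _ => True) A (a + 7 * C) (21 * C ^ 2 + a * (7 * C))
      ((pair ν anc).bind (extract op φ)) := by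
  have := Graded.bind (f := extract op φ) (d' := 0) (K' := fun ρ => ∃ w, IsCode w ∧
      decodePauli w = 0 ∧ Off T ∅ (fun i =>
        (pr (t i) (w i)).1 + φ (relPauli (fun j => (pr (t j) (w j)).2) i)) ρ)
    (L' := fun _ => True)
    (x' := 7 * C) (y' := 21 * C ^ 2) (z' := 0) (hanc.pair_right ν) ?_ ?_
  · simpa using this
  · rintro _ ⟨ν', ⟨w, hw, hw0, hν'⟩, rfl⟩
    exact (h.extract_off hT φ hν hν').mono le_rfl le_rfl le_rfl
      (fun ρ hρ => ⟨w, hw, hw0, hρ⟩) fun _ _ => trivial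
  · rintro _ _
    exact Graded.of_self trivial _ _ _

end Transverse

/-! ### Error correction -/

section Correction

variable {k : ℕ} {G : Gadgets k} {T : Pauli → PMF (Block k) → Prop} {A a b B C : ℝ≥0∞}
  {anc : PMF (Fin 7 → Block k)}

theorem decodePauli_snd_eq_zero {w : Fin 7 → Pauli} (h : decodePauli w = 0) :
    logicalBit (fun i => (w i).2) = 0 := congrArg Prod.snd h

theorem decodePauli_fst_eq_zero {w : Fin 7 → Pauli} (h : decodePauli w = 0) :
    logicalBit (fun i => (w i).1) = 0 := congrArg Prod.fst h

theorem couples_X (h : Claims G T A B C) : Couples T C G.cnot propagate where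
  tame := h.cnot
  code {t w} ht hw hw0 := by
    refine ⟨⟨ht.1, (relBits_add_code _ hw.2).trans ht.2⟩,
      ⟨(relBits_add_code _ hw.1).trans ht.1, hw.2⟩, ?_⟩
    have h2 := logicalBit_add_code (fun i => (t i).2) hw.2
    rw [decodePauli_snd_eq_zero hw0, add_zero] at h2
    rw [decodePauli, decodePauli, ← h2]
    rfl

theorem PairIn.swap {s : Pauli × Pauli} {ρ : PMF (Block k × Block k)} (h : PairIn T s ρ) :
    PairIn T s.swap (ρ.map Prod.swap) := by
  obtain ⟨μ, ν, h1, h2, rfl⟩ := h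
  exact ⟨ν, μ, h2, h1, pair_map_swap _ _⟩

theorem couples_Z (h : Claims G T A B C) :
    Couples T C (fun e f => (G.cnot f e).map Prod.swap) fun s t => (propagate t s).swap where
  tame {s t μ ν} hs ht := by
    have : ((pair μ ν).bind fun r => (G.cnot r.2 r.1).map Prod.swap) =
        ((pair ν μ).bind fun r => G.cnot r.1 r.2).map Prod.swap := by
      rw [← pair_map_swap, PMF.map_bind, PMF.bind_map]
      rfl
    rw [this]
    exact (h.cnot ht hs).map _ fun _ hs => hs.swap
  code {t w} ht hw hw0 := by
    have e1 : (fun i => (w i).1 + (t i).1) = (fun i => (t i).1) + fun i => (w i).1 :=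
      funext fun i => add_comm _ _
    have e2 : (fun i => (w i).2 + (t i).2) = (fun i => (t i).2) + fun i => (w i).2 :=
      funext fun i => add_comm _ _
    have h1 := logicalBit_add_code (fun i => (t i).1) hw.1
    rw [decodePauli_fst_eq_zero hw0, add_zero, ← e1] at h1
    have h2 := relBits_add_code (fun i => (t i).1) hw.1
    have h3 := relBits_add_code (fun i => (t i).2) hw.2
    rw [← e1] at h2
    rw [← e2] at h3
    refine ⟨⟨h2.trans ht.1, ht.2⟩, ⟨hw.1, h3.trans ht.2⟩, ?_⟩
    rw [decodePauli, decodePauli, ← h1]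
    rfl

/-- The part of a measured relative state to which `X` correction responds. -/
def xPart (w : Pauli) : Pauli := (w.1, 0)

/-- The part of a measured relative state to which `Z` correction responds. -/
def zPart (w : Pauli) : Pauli := (0, w.2)

/-- The ancilla contributes a code word, so the measured relative `X` error is that of the block
itself, and removing it preserves the decoding. The `Z` word flowing back from the ancilla is a code
word with trivial logical bit. -/
theorem fix_X (t : Fin 7 → Pauli) {w : Fin 7 → Pauli} (hw : IsCode w) (hw0 : decodePauli w = 0)
    {t' : Fin 7 → Pauli} (ht' : t' = fun i => (propagate (t i) (w i)).1 +
      xPart (relPauli (fun j => (propagate (t j) (w j)).2) i)) :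
    relBits (fun i => (t' i).1) = 0 ∧ decodePauli t' = decodePauli t := by
  have e0 : relBits (fun j => (t j).1 + (w j).1) = relBits fun j => (t j).1 :=
    relBits_add_code (fun j => (t j).1) hw.1
  have e1 : (fun i => (t' i).1) = (fun i => (t i).1) + relBits fun j => (t j).1 := by
    funext i
    rw [Pi.add_apply, ← e0, ht']
    rfl
  have e2 : (fun i => (t' i).2) = (fun i => (t i).2) + fun i => (w i).2 := by
    funext i
    rw [ht']
    exact add_zero _
  refine ⟨by rw [e1, relBits_add_relBits], ?_⟩
  rw [decodePauli, e1, e2, logicalBit_add_relBits, logicalBit_add_code _ hw.2,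
    decodePauli_snd_eq_zero hw0, add_zero]
  rfl

/-- The dual step adds to the `X` part only a code word with trivial logical bit, so the `X`
syndrome removed before stays trivial. -/
theorem fix_Z {t w : Fin 7 → Pauli} (ht : relBits (fun i => (t i).1) = 0) (hw : IsCode w)
    (hw0 : decodePauli w = 0) {t' : Fin 7 → Pauli}
    (ht' : t' = fun i => (propagate (w i) (t i)).swap.1 +
      zPart (relPauli (fun j => (propagate (w j) (t j)).swap.2) i)) :
    IsCode t' ∧ decodePauli t' = decodePauli t := by
  have e : (fun i => (w i).2 + (t i).2) = (fun i => (t i).2) + fun i => (w i).2 :=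
    funext fun i => add_comm _ _
  have e0 : relBits (fun j => (w j).2 + (t j).2) = relBits fun j => (t j).2 := by
    rw [e, relBits_add_code _ hw.2]
  have e1 : (fun i => (t' i).2) = (fun i => (t i).2) + relBits fun j => (t j).2 := by
    funext i
    rw [Pi.add_apply, ← e0, ht']
    rfl
  have e2 : (fun i => (t' i).1) = (fun i => (t i).1) + fun i => (w i).1 := by
    funext i
    rw [ht']
    exact (add_zero _).trans (add_comm _ _)
  refine ⟨⟨by rw [e2, relBits_add_code _ hw.1, ht], by rw [e1, relBits_add_relBits]⟩, ?_⟩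
  rw [decodePauli, e1, e2, logicalBit_add_relBits, logicalBit_add_code _ hw.1,
    decodePauli_fst_eq_zero hw0, add_zero]
  rfl

/-- `halfEC` on tuples of subblocks. -/
def half (G : Gadgets k) (anc : PMF (Fin 7 → Block k)) (e : Fin 7 → Block k) :
    PMF (Fin 7 → Block k) := halfEC G anc e

/-- With independent fresh ancillas, a round is a chain of couplings of pairs, to which
`Graded.bind` applies step by step. -/
theorem half_eq (ν : PMF (Fin 7 → Block k)) : ν.bind (half G anc) =
    (pair ((pair (ν.bind (ecs G)) (anc.map fun e i => had k (e i))).bind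
      (extract G.cnot xPart)) anc).bind
        (extract (fun e f => (G.cnot f e).map Prod.swap) zPart) := by
  have hX : ∀ e : Fin 7 → Block k, correctX G anc e =
      (anc.map fun e i => had k (e i)).bind fun f => extract G.cnot xPart (e, f) := by
    intro e
    refine congrArg (PMF.bind (α := Fin 7 → Block k) (anc.map fun e i => had k (e i)))
      (funext fun f => ?_)
    exact PMF.map_comp _ _ _
  have hZ : ∀ e : Fin 7 → Block k, correctZ G anc e =
      anc.bind fun f => extract (fun e f => (G.cnot f e).map Prod.swap) zPart (e, f) := by
    intro e
    refine congrArg (PMF.bind (α := Fin 7 → Block k) anc) (funext fun f => ?_)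
    refine (PMF.map_comp _ _ _).trans (Eq.symm ?_)
    rw [extract]
    simp only
    rw [← indep_map (fun i => G.cnot (f i) (e i)) fun _ => Prod.swap, PMF.map_comp]
    rfl
  have h1 : ∀ e : Fin 7 → Block k, half G anc e = (ecs G e).bind fun e =>
      ((anc.map fun e i => had k (e i)).bind fun f => extract G.cnot xPart (e, f)).bind fun e =>
        anc.bind fun f => extract (fun e f => (G.cnot f e).map Prod.swap) zPart (e, f) := by
    intro e
    simp only [← hX, ← hZ]
    rfl
  rw [pair_bind, pair_bind, PMF.bind_bind, PMF.bind_bind]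
  exact congrArg _ (funext h1)

/-! ### One round of error correction -/

section Half

variable (h : Claims G T A B C) {A' : ℝ≥0∞}
  (hanc : Graded (Clean T 0) (OneBad T 0) A' a 0 anc)
include h hanc

theorem graded_had : Graded (Clean T 0) (OneBad T 0) A' a 0 (anc.map fun e i => had k (e i)) :=
  Graded.map hanc _ (fun _ h' => h'.map_had h.sound) fun _ h' => h'.map_had h.sound

/-- A round contains seven lower-level corrections, two ancillas and fourteen gates. The last bound
counts pairs among these locations: `21` and `91` are the binomial coefficients of `7` and `14` over
`2`, and the mixed terms are products of the single bounds. Failures of the two ancillas are fatal.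
-/
theorem half_clean {s : Pauli} {ν : PMF (Fin 7 → Block k)} (hν : Clean T s ν) :
    Graded (Clean T s) (OneBad T s) (2 * A') (7 * B + 2 * a + 14 * C)
      (a ^ 2 + 21 * B ^ 2 + 91 * C ^ 2 + 14 * a * B + 98 * B * C + 28 * a * C)
      (ν.bind (half G anc)) := by
  rw [half_eq]
  have h1 : Graded (Clean T s) (OneBad T s) 0 (7 * B) (21 * B ^ 2) (ν.bind (ecs G)) := by
    obtain ⟨t, ht, rfl, hν⟩ := hν
    exact (h.ecs_off hν).mono le_rfl le_rfl le_rfl (fun _ h' => ⟨t, ht, rfl, h'⟩)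
      fun _ ⟨i, h'⟩ => ⟨t, i, ht, rfl, h'⟩
  -- Pairing with a fresh ancilla is written as a random step from `e`; averaging over `e` restores
  -- the pair law.
  have h2 := Graded.bind (f := fun e => pair (PMF.pure e) (anc.map fun e i => had k (e i)) |>.bind
      (extract G.cnot xPart)) (z' := 21 * C ^ 2 + a * (7 * C)) h1
    (fun μ hμ => by
      rw [← PMF.bind_bind, ← pair_bind_left, PMF.bind_pure]
      exact (couples_X h).correct_clean h.sound rfl (graded_had h hanc) hμ)
    (fun μ hμ => by
      rw [← PMF.bind_bind, ← pair_bind_left, PMF.bind_pure]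
      exact (couples_X h).correct_oneBad h.sound rfl (graded_had h hanc) hμ)
  rw [← PMF.bind_bind, ← pair_bind_left, PMF.bind_pure] at h2
  have h3 := Graded.bind (f := fun e => pair (PMF.pure e) anc |>.bind
      (extract (fun e f => (G.cnot f e).map Prod.swap) zPart))
      (z' := 21 * C ^ 2 + a * (7 * C)) h2
    (fun μ hμ => by
      rw [← PMF.bind_bind, ← pair_bind_left, PMF.bind_pure]
      exact (couples_Z h).correct_clean h.sound rfl hanc hμ)
    (fun μ hμ => by
      rw [← PMF.bind_bind, ← pair_bind_left, PMF.bind_pure]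
      exact (couples_Z h).correct_oneBad h.sound rfl hanc hμ)
  rw [← PMF.bind_bind, ← pair_bind_left, PMF.bind_pure] at h3
  refine h3.mono (le_of_eq ?_) (le_of_eq ?_) (le_of_eq ?_) (fun _ h => h) fun _ h => h <;> ring

/-- The predicate `P` carries what is known of the decoded state: nothing for an arbitrary block,
its value for a block with one uncontrolled subblock. The `X` step clears the `X` syndrome and the
`Z` step the other one, both without changing the decoding. -/
theorem half_of_ecs {P : Pauli → Prop} {ν : PMF (Fin 7 → Block k)}
    (hν : Graded (fun ρ => ∃ t, P (decodePauli t) ∧ Off T ∅ t ρ) (fun _ => True) 0 (7 * B)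
      (21 * B ^ 2) (ν.bind (ecs G))) :
    Graded (fun ρ => ∃ s, P s ∧ Clean T s ρ) (fun _ => True) (2 * A') (7 * B + 2 * a + 14 * C)
      (a ^ 2 + 21 * B ^ 2 + 91 * C ^ 2 + 14 * a * B + 98 * B * C + 28 * a * C)
      (ν.bind (half G anc)) := by
  rw [half_eq]
  have h2 := Graded.bind (f := fun e => pair (PMF.pure e) (anc.map fun e i => had k (e i)) |>.bind
      (extract G.cnot xPart)) (x' := a + 7 * C) (y' := 21 * C ^ 2 + a * (7 * C)) (d' := A')
      (K' := fun ρ => ∃ t, relBits (fun i => (t i).1) = 0 ∧ P (decodePauli t) ∧ Off T ∅ t ρ)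
      (L' := fun _ => True) (z' := 0) hν
    (fun μ ⟨t, ht, hμ⟩ => by
      rw [← PMF.bind_bind, ← pair_bind_left, PMF.bind_pure]
      refine ((couples_X h).correct_off h.sound xPart (graded_had h hanc) hμ).mono le_rfl le_rfl
        le_rfl (fun ρ ⟨w, hw, hw0, hρ⟩ => ?_) fun _ h => h
      obtain ⟨h4, h5⟩ := fix_X t hw hw0 (t' := fun i => (propagate (t i) (w i)).1 +
        xPart (relPauli (fun j => (propagate (t j) (w j)).2) i)) rfl
      exact ⟨_, h4, by rw [h5]; exact ht, hρ⟩)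
    (fun μ hμ => Graded.of_self trivial _ _ _)
  rw [← PMF.bind_bind, ← pair_bind_left, PMF.bind_pure] at h2
  have h3 := Graded.bind (f := fun e => pair (PMF.pure e) anc |>.bind
      (extract (fun e f => (G.cnot f e).map Prod.swap) zPart))
      (x' := a + 7 * C) (y' := 21 * C ^ 2 + a * (7 * C)) (d' := A')
      (K' := fun ρ => ∃ s, P s ∧ Clean T s ρ)
      (L' := fun _ => True) (z' := 0) h2
    (fun μ ⟨t, ht, ht', hμ⟩ => by
      rw [← PMF.bind_bind, ← pair_bind_left, PMF.bind_pure]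
      refine ((couples_Z h).correct_off h.sound zPart hanc hμ).mono le_rfl le_rfl
        le_rfl (fun ρ ⟨w, hw, hw0, hρ⟩ => ?_) fun _ h => h
      obtain ⟨h4, h5⟩ := fix_Z ht hw hw0 (t' := fun i => (propagate (w i) (t i)).swap.1 +
        zPart (relPauli (fun j => (propagate (w j) (t j)).swap.2) i)) rfl
      exact ⟨_, by rw [h5]; exact ht', _, h4, rfl, hρ⟩)
    (fun μ hμ => Graded.of_self trivial _ _ _)
  rw [← PMF.bind_bind, ← pair_bind_left, PMF.bind_pure] at h3
  refine h3.mono (le_of_eq ?_) (le_of_eq ?_) (le_of_eq ?_) (fun _ h => h) fun _ h => h <;> ring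

theorem half_any (ν : PMF (Fin 7 → Block k)) :
    Graded (fun ρ => ∃ s, Clean T s ρ) (fun _ => True) (2 * A') (7 * B + 2 * a + 14 * C)
      (a ^ 2 + 21 * B ^ 2 + 91 * C ^ 2 + 14 * a * B + 98 * B * C + 28 * a * C)
      (ν.bind (half G anc)) := by
  refine (half_of_ecs h hanc (P := fun _ => True) ?_).mono le_rfl le_rfl le_rfl
    (fun _ ⟨s, _, hs⟩ => ⟨s, hs⟩) fun _ h => h
  exact (h.ecs_any ν).mono le_rfl le_rfl le_rfl (fun _ ⟨t, ht⟩ => ⟨t, trivial, ht⟩) fun _ h => h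

theorem half_oneBad {s : Pauli} {ν : PMF (Fin 7 → Block k)} (hν : OneBad T s ν) :
    Graded (Clean T s) (fun _ => True) (2 * A') (7 * B + 2 * a + 14 * C)
      (a ^ 2 + 21 * B ^ 2 + 91 * C ^ 2 + 14 * a * B + 98 * B * C + 28 * a * C)
      (ν.bind (half G anc)) := by
  refine (half_of_ecs h hanc (P := fun s' => s' = s) (h.ecs_oneBad hν)).mono le_rfl le_rfl le_rfl
    (fun _ ⟨s', hs', hs⟩ => hs' ▸ hs) fun _ h => h

end Half

/-! ### Two rounds of error correction -/

/-- Both rounds of error correction on tuples of subblocks. -/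
def full (G : Gadgets k) (anc : PMF (Fin 7 → Block k)) (e : Fin 7 → Block k) :
    PMF (Fin 7 → Block k) := (half G anc e).bind (half G anc)

section Full

variable {x y A' : ℝ≥0∞}

/-- The properties of one round of error correction that are used for both: failure parameters,
and effect on blocks without, with one, and with any number of uncontrolled subblocks. -/
structure Round (T : Pauli → PMF (Block k) → Prop) (d x y : ℝ≥0∞)
    (f : (Fin 7 → Block k) → PMF (Fin 7 → Block k)) : Prop where
  clean : ∀ {s} {ν : PMF (Fin 7 → Block k)}, Clean T s ν → Graded (Clean T s) (OneBad T s) d x y (ν.bind f)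
  oneBad : ∀ {s} {ν : PMF (Fin 7 → Block k)}, OneBad T s ν → Graded (Clean T s) (fun _ => True) d x y (ν.bind f)
  any : ∀ ν : PMF (Fin 7 → Block k), Graded (fun ρ => ∃ s, Clean T s ρ) (fun _ => True) d x y (ν.bind f)

variable {d : ℝ≥0∞} {f : (Fin 7 → Block k) → PMF (Fin 7 → Block k)} (hf : Round T d x y f)
include hf

/-- A fault-free first round makes the block clean and a fault-free second round keeps it so; no
fault is tolerated here, whence the first-order term `2 * x`. -/
theorem Round.twice_oneBad {s : Pauli} {ν : PMF (Fin 7 → Block k)} (hν : OneBad T s ν) :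
    Fails (2 * d + 2 * x) (Labelled T b s) ((ν.bind f).bind f) := by
  refine ((hf.oneBad hν).fails.bind (δ' := d + x) fun μ hμ => ?_).mono (le_of_eq (by ring))
    fun _ h => h
  exact (hf.clean hμ).fails.mono le_rfl fun _ h => h.labelled b

variable (hdy : d + y < 1) (hb : x / (1 - (d + y)) ≤ b)
include hdy hb

theorem Round.labelled {s : Pauli} {ν : PMF (Fin 7 → Block k)} (hν : Clean T s ν) :
    Fails (d + y) (Labelled T b s) (ν.bind f) :=
  ((hf.clean hν).normalize hdy).mono le_rfl fun _ h =>
    h.mono le_rfl hb le_rfl (fun _ h => h) fun _ h => h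

/-- One fault in the first round is repaired by a fault-free second round, and one fault in the
second is recorded in the label. Apart from fatal events, what remains is two faults in one round,
or one in each. -/
theorem Round.twice_clean {s : Pauli} {ν : PMF (Fin 7 → Block k)} (hν : Clean T s ν) :
    Fails (2 * d + 2 * y + x ^ 2) (Labelled T b s) ((ν.bind f).bind f) := by
  refine ((hf.clean hν).bind_fails (d' := d) (δ := y) (δ' := x)
    (fun μ hμ => hf.labelled hdy hb hμ) fun μ hμ => ?_).mono (le_of_eq (by ring)) fun _ h => h
  exact (hf.oneBad hμ).fails.mono le_rfl fun _ h => h.labelled b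

/-- The only round without faults suffices to restore the block if the other has one fault: if the
first is fault-free, a fault in the second goes into the label. -/
theorem Round.twice_any (ν : PMF (Fin 7 → Block k)) :
    Fails (2 * d + 2 * y + x ^ 2) (fun ρ => ∃ s, Labelled T b s ρ) ((ν.bind f).bind f) := by
  refine ((hf.any ν).bind_fails (d' := d) (δ := y) (δ' := x)
    (fun μ ⟨s, hμ⟩ => (hf.labelled hdy hb hμ).mono le_rfl fun _ h => ⟨s, h⟩)
    fun μ hμ => ?_).mono (le_of_eq (by ring)) fun _ h => h
  exact (hf.any μ).fails.mono le_rfl fun _ ⟨s, h⟩ => ⟨s, h.labelled b⟩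

theorem Round.twice_labelled {s : Pauli} {ν : PMF (Fin 7 → Block k)} (hν : Labelled T b s ν) :
    Fails (2 * d + 2 * y + x ^ 2 + b * (2 * x)) (Labelled T b s) ((ν.bind f).bind f) := by
  rw [PMF.bind_bind]
  refine (hν.bind_fails (d' := 2 * d) (δ := 2 * y + x ^ 2) (δ' := 2 * x) (fun μ hμ => ?_)
    fun μ hμ => ?_).mono (le_of_eq (by ring)) fun _ h => h
  · rw [← PMF.bind_bind, ← add_assoc]
    exact hf.twice_clean hdy hb hμ
  · rw [← PMF.bind_bind]
    exact hf.twice_oneBad hμ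

end Full

/-! ### The next level -/

theorem IsCode.propagate {t w : Fin 7 → Pauli} (ht : IsCode t) (hw : IsCode w) :
    IsCode (fun i => (propagate (t i) (w i)).1) ∧ IsCode (fun i => (propagate (t i) (w i)).2) ∧
      (decodePauli (fun i => (FT.propagate (t i) (w i)).1),
        decodePauli fun i => (FT.propagate (t i) (w i)).2) =
          FT.propagate (decodePauli t) (decodePauli w) := by
  have h1 := logicalBit_add_code (fun i => (t i).2) hw.2
  have h2 := logicalBit_add_code (fun i => (t i).1) hw.1
  refine ⟨⟨ht.1, (relBits_add_code _ hw.2).trans ht.2⟩,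
    ⟨(relBits_add_code _ hw.1).trans ht.1, hw.2⟩, ?_⟩
  simp only [FT.propagate, decodePauli]
  rw [← h1, ← h2]
  rfl

/-- The properties of error correction that make the gate of the next level reliable. -/
structure Recovers (T : Pauli → PMF (Block k) → Prop) (b B e : ℝ≥0∞)
    (E : (Fin 7 → Block k) → PMF (Fin 7 → Block k)) : Prop where
  any : ∀ v, Fails B (fun ρ => ∃ s, Labelled T b s ρ) (E v)
  clean : ∀ {s} {ν : PMF (Fin 7 → Block k)}, Clean T s ν → Fails B (Labelled T b s) (ν.bind E)
  oneBad : ∀ {s} {ν : PMF (Fin 7 → Block k)}, OneBad T s ν → Fails e (Labelled T b s) (ν.bind E)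

/-- `nextCNOT` on tuples of subblocks. -/
def cnotThen (G : Gadgets k) (E : (Fin 7 → Block k) → PMF (Fin 7 → Block k))
    (r : (Fin 7 → Block k) × (Fin 7 → Block k)) : PMF ((Fin 7 → Block k) × (Fin 7 → Block k)) :=
  (cnots G r).bind fun r => pair (E r.1) (E r.2)

/-! ### The gate of the next level -/

section Gate

variable {E : (Fin 7 → Block k) → PMF (Fin 7 → Block k)} {e : ℝ≥0∞}

theorem cnotThen_any (hE : Recovers T b B e E) (r : (Fin 7 → Block k) × (Fin 7 → Block k)) :
    Fails (2 * B) (fun ρ => ∃ s : Pauli × Pauli, ∃ μ ν, Labelled T b s.1 μ ∧ Labelled T b s.2 ν ∧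
      ρ = pair μ ν) (cnotThen G E r) := by
  refine Fails.of_forall _ fun r _ => ?_
  refine ((hE.any r.1).pair (hE.any r.2)).mono (le_of_eq (two_mul B).symm) ?_
  rintro _ ⟨μ, ν, ⟨s, hs⟩, ⟨t, ht⟩, rfl⟩
  exact ⟨(s, t), μ, ν, hs, ht, rfl⟩

theorem fails_pair {E : (Fin 7 → Block k) → PMF (Fin 7 → Block k)} {δ δ' : ℝ≥0∞} {s t : Pauli}
    {μ ν : PMF (Fin 7 → Block k)} (h : Fails δ (Labelled T b s) (μ.bind E))
    (h' : Fails δ' (Labelled T b t) (ν.bind E)) :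
    Fails (δ + δ') (fun ρ => ∃ μ ν, Labelled T b s μ ∧ Labelled T b t ν ∧ ρ = pair μ ν)
      ((pair μ ν).bind fun r => pair (E r.1) (E r.2)) := by
  rw [pair_bind_pair]
  exact h.pair h'

/-- If both inputs are clean, failure needs two failed gates, one failed gate and a failed recovery
(`2 * e`), or a failed correction without any failed gate (`2 * B'`). One uncontrolled input
subblock, of probability at most `2 * b`, affects the same place in both outputs and leaves no room
for a failed gate. Uncontrolled subblocks in both inputs are given up, at cost `b ^ 2`. -/
theorem cnotThen_labelled {B' : ℝ≥0∞} (h : Claims G T A B C) (hE : Recovers T b B' e E)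
    {s t : Pauli} {μ ν : PMF (Fin 7 → Block k)} (hμ : Labelled T b s μ) (hν : Labelled T b t ν) :
    Fails (2 * B' + 14 * C * e + 21 * C ^ 2 + 2 * b * (2 * e + 7 * C) + b ^ 2)
      (fun ρ => ∃ μ ν, Labelled T b (propagate s t).1 μ ∧ Labelled T b (propagate s t).2 ν ∧
        ρ = pair μ ν) ((pair μ ν).bind (cnotThen G E)) := by
  refine ((hμ.pair hν).bind_fails (d' := 0) (δ := 21 * C ^ 2 + 2 * B' + 7 * C * (2 * e))
    (δ' := 7 * C + 2 * e) ?_ ?_).mono (le_of_eq (by ring)) fun _ h => h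
  · rintro _ ⟨μ, ν, ⟨t, ht, rfl, hm⟩, ⟨w, hw, rfl, hn⟩, rfl⟩
    obtain ⟨c1, c2, c3⟩ := ht.propagate hw
    rw [← c3]
    have := (h.cnots_off hm hn).bind_fails (f := fun r => pair (E r.1) (E r.2)) (d' := 0)
      (δ := 2 * B') (δ' := 2 * e) (J := fun ρ => ∃ μ ν,
        Labelled T b (decodePauli fun i => (propagate (t i) (w i)).1) μ ∧
        Labelled T b (decodePauli fun i => (propagate (t i) (w i)).2) ν ∧ ρ = pair μ ν) ?_ ?_
    · rw [PMF.bind_bind] at this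
      exact this.mono (le_of_eq (by ring)) fun _ h => h
    · rintro _ ⟨m, m', h1, _, rfl⟩
      exact (fails_pair (hE.clean ⟨_, c1, rfl, m, fun j hj => (h1 j hj).1, rfl⟩)
        (hE.clean ⟨_, c2, rfl, m', fun j hj => (h1 j hj).2, rfl⟩)).mono
          (le_of_eq (by ring)) fun _ h => h
    · rintro _ ⟨i, m, m', h1, _, rfl⟩
      exact (fails_pair
        (hE.oneBad ⟨_, i, c1, rfl, m, fun j hj => (h1 j (by simpa using hj)).1, rfl⟩)
        (hE.oneBad ⟨_, i, c2, rfl, m', fun j hj => (h1 j (by simpa using hj)).2, rfl⟩)).mono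
          (le_of_eq (by ring)) fun _ h => h
  · rintro _ ⟨μ, ν, hμν, rfl⟩
    obtain ⟨i, u, w, ht, rfl, hw, rfl, hμ, hν⟩ : ∃ i u w, IsCode u ∧ decodePauli u = s ∧
        IsCode w ∧ decodePauli w = t ∧ Off T {i} u μ ∧ Off T {i} w ν := by
      rcases hμν with ⟨⟨u, ht, hs, hμ⟩, w, i, hw, hs', hν⟩ | ⟨⟨u, i, ht, hs, hμ⟩, w, hw, hs', hν⟩
      · exact ⟨i, u, w, ht, hs, hw, hs', hμ.subset (Set.empty_subset _), hν⟩
      · exact ⟨i, u, w, ht, hs, hw, hs', hμ, hν.subset (Set.empty_subset _)⟩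
    obtain ⟨c1, c2, c3⟩ := ht.propagate hw
    rw [← c3]
    have := (h.cnots_off hμ hν).fails.bind (f := fun r => pair (E r.1) (E r.2)) (δ' := 2 * e)
      (J := fun ρ => ∃ μ ν,
        Labelled T b (decodePauli fun i => (propagate (u i) (w i)).1) μ ∧
        Labelled T b (decodePauli fun i => (propagate (u i) (w i)).2) ν ∧ ρ = pair μ ν) ?_
    · rw [PMF.bind_bind] at this
      exact this.mono (le_of_eq (by ring)) fun _ h => h
    rintro _ ⟨m, m', h1, _, rfl⟩
    exact (fails_pair (hE.oneBad ⟨_, i, c1, rfl, m, fun j hj => (h1 j hj).1, rfl⟩)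
      (hE.oneBad ⟨_, i, c2, rfl, m', fun j hj => (h1 j hj).2, rfl⟩)).mono
        (le_of_eq (by ring)) fun _ h => h

end Gate

/-- `h₁` and `h₂` bound one and two faults in a round, and `e` is the cost of recovering from one
uncontrolled subblock. By `hab` a fresh ancilla, labelled with `a`, belongs to the same class as
corrected blocks, labelled with `b`. -/
theorem Claims.next (h : Claims G T A B C) {A' B' C' e : ℝ≥0∞}
    (hanc : Fails A' (Labelled T a 0) (verified G)) {h₁ h₂ : ℝ≥0∞}
    (hh₁ : h₁ = 7 * B + 2 * a + 14 * C)
    (hh₂ : h₂ = a ^ 2 + 21 * B ^ 2 + 91 * C ^ 2 + 14 * a * B + 98 * B * C + 28 * a * C)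
    (hlt : 2 * A' + h₂ < 1) (hb : h₁ / (1 - (2 * A' + h₂)) ≤ b) (hab : a ≤ b)
    (he : e = 4 * A' + 2 * h₁)
    (hB' : 4 * A' + 2 * h₂ + h₁ ^ 2 + b * (2 * h₁) = B')
    (hC' : 2 * B' + 14 * C * e + 21 * C ^ 2 + 2 * b * (2 * e + 7 * C) + b ^ 2 = C') :
    Claims ⟨verified G, nextEC G, nextCNOT G⟩ (Labelled T b) A' B' C' := by
  have hanc' : Graded (Clean T 0) (OneBad T 0) A' a 0 (verified G) := by
    have := hanc.of_graded (P := Clean T 0) (Q := OneBad T 0) (d := 0) (x := a) (y := 0)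
      fun _ h => h
    rwa [add_zero] at this
  have hR : Round T (2 * A') h₁ h₂ (half G (verified G)) := by
    subst hh₁ hh₂
    exact ⟨half_clean h hanc', half_oneBad h hanc', half_any h hanc'⟩
  have hle : 2 * (2 * A') + 2 * h₂ + h₁ ^ 2 ≤ B' := by
    rw [← hB']
    refine le_trans (le_of_eq ?_) le_self_add
    ring
  have hE : Recovers T b B' e (full G (verified G)) := by
    refine ⟨fun v => ?_, fun {s ν} hν => ?_, fun {s ν} hν => ?_⟩
    · have := hR.twice_any hlt hb (PMF.pure v)
      rw [PMF.pure_bind] at this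
      exact this.mono hle fun _ h => h
    · have := hR.twice_clean hlt hb hν
      rw [PMF.bind_bind] at this
      exact this.mono hle fun _ h => h
    · have := hR.twice_oneBad (b := b) hν
      rw [PMF.bind_bind] at this
      exact this.mono (le_of_eq (by rw [he]; ring)) fun _ h => h
  have hl : ∀ {s} {ν : PMF (Fin 7 → Block k)}, Labelled T b s ν →
      Fails B' (Labelled T b s) (ν.bind (full G (verified G))) := by
    intro s ν hν
    have := hR.twice_labelled hlt hb hν
    rw [PMF.bind_bind] at this
    exact this.mono (le_of_eq (by rw [← hB']; ring)) fun _ h => h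
  refine ⟨h.sound.labelled b, ?_, hE.any, hl, fun e f => ?_, fun {s t μ ν} hμ hν => ?_⟩
  · exact hanc.mono le_rfl fun _ h => h.mono le_rfl hab le_rfl (fun _ h => h) fun _ h => h
  · refine Fails.mono (cnotThen_any hE (e, f)) ?_ fun _ h => h
    rw [← hC']
    simp only [add_assoc]
    exact le_self_add
  · exact Fails.mono (cnotThen_labelled h hE hμ hν) (le_of_eq hC') fun _ h => h

end Correction

/-! ### Preparation of the ancilla -/

section Ancilla

variable {k : ℕ} {G : Gadgets k} {T : Pauli → PMF (Block k) → Prop} {A B C : ℝ≥0∞}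

/-- A gate between two subblocks of one block. -/
def gate (G : Gadgets k) (c t : Fin 7) (e : Fin 7 → Block k) : PMF (Fin 7 → Block k) :=
  (G.cnot (e c) (e t)).map fun r => Function.update (Function.update e c r.1) t r.2

theorem indep_update_pair {α : Type} {n : ℕ} (m : Fin n → PMF α) {c t : Fin n} (hct : c ≠ t)
    (μ ν : PMF α) : ((pair μ ν).bind fun r =>
      indep (Function.update (Function.update m c (PMF.pure r.1)) t (PMF.pure r.2))) =
        indep (Function.update (Function.update m c μ) t ν) := by
  rw [pair_bind]
  simp only
  simp only [← indep_update_bind, PMF.bind_pure]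
  simp only [Function.update_comm hct]
  rw [← indep_update_bind, PMF.bind_pure]

/-- Once the values at `c` and `t` are sampled, the gate acts on two point masses and the other
subblocks remain independent of its outcome. -/
theorem indep_bind_gate (m : Fin 7 → PMF (Block k)) {c t : Fin 7} (hct : c ≠ t) :
    (indep m).bind (gate G c t) = ((pair (m c) (m t)).bind fun r => G.cnot r.1 r.2).bind fun r =>
      indep (Function.update (Function.update m c (PMF.pure r.1)) t (PMF.pure r.2)) := by
  have h0 := indep_update_pair m hct (m c) (m t)
  rw [Function.update_eq_self, Function.update_eq_self] at h0
  conv_lhs => rw [← h0]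
  rw [PMF.bind_bind, PMF.bind_bind]
  refine congrArg _ (funext fun ab => ?_)
  have h1 : ∀ e ∈ (indep (Function.update (Function.update m c (PMF.pure ab.1)) t
      (PMF.pure ab.2))).support, gate G c t e =
        (G.cnot ab.1 ab.2).bind fun r => PMF.pure
          (Function.update (Function.update e c r.1) t r.2) := by
    intro e he
    rw [mem_support_indep] at he
    have hc := he c
    have ht := he t
    rw [Function.update_self, PMF.mem_support_pure_iff] at ht
    rw [Function.update_of_ne hct, Function.update_self, PMF.mem_support_pure_iff] at hc
    rw [gate, hc, ht]
    rfl
  rw [bind_congr_support h1, PMF.bind_comm]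
  refine congrArg _ (funext fun r => ?_)
  have h2 : ∀ e : Fin 7 → Block k, Function.update (Function.update e c r.1) t r.2 =
      fun j => (fun (j : Fin 7) (x : Block k) => if j = t then r.2 else if j = c then r.1 else x)
        j (e j) := by
    intro e
    funext j
    by_cases hj : j = t
    · subst hj; simp
    · by_cases hj' : j = c
      · subst hj'; simp [hj]
      · simp [hj, hj']
  simp only [h2]
  refine (indep_map _ fun (j : Fin 7) (x : Block k) =>
    if j = t then r.2 else if j = c then r.1 else x).trans (congrArg indep (funext fun j => ?_))
  by_cases hj : j = t
  · subst hj
    simp [PMF.pure_map]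
  · by_cases hj' : j = c
    · subst hj'
      simp [hj, PMF.pure_map]
    · simp only [hj, hj', if_false]
      rw [Function.update_of_ne hj, Function.update_of_ne hj', Function.update_of_ne hj,
        Function.update_of_ne hj']
      exact PMF.map_id _

theorem Claims.gate_off (h : Claims G T A B C) {c t : Fin 7} (hct : c ≠ t)
    {ν : PMF (Fin 7 → Block k)} (hν : Off T ∅ (fun _ => 0) ν) :
    Fails C (Off T ∅ fun _ => 0) (ν.bind (gate G c t)) := by
  obtain ⟨m, hm, rfl⟩ := hν
  rw [indep_bind_gate m hct]
  have h1 := h.cnot (hm c (Set.notMem_empty c)) (hm t (Set.notMem_empty t))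
  rw [← add_zero C]
  refine h1.bind fun ρ hρ => Fails.of_self ?_ _
  obtain ⟨μ, ν, h2, h3, rfl⟩ := hρ
  rw [indep_update_pair m hct]
  refine ⟨_, fun j hj => ?_, rfl⟩
  by_cases hj1 : j = t
  · subst hj1
    rw [Function.update_self]
    exact h3
  · rw [Function.update_of_ne hj1]
    by_cases hj2 : j = c
    · subst hj2
      rw [Function.update_self]
      exact h2
    · rw [Function.update_of_ne hj2]
      exact hm j hj

/-- `applyCNOTs` on tuples of subblocks. -/
def gates (G : Gadgets k) (L : List (Fin 7 × Fin 7)) (e : Fin 7 → Block k) :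
    PMF (Fin 7 → Block k) := applyCNOTs G L e

theorem bind_gates_cons (c t : Fin 7) (L : List (Fin 7 × Fin 7)) (ν : PMF (Fin 7 → Block k)) :
    ν.bind (gates G ((c, t) :: L)) = (ν.bind (gate G c t)).bind (gates G L) := by
  rw [PMF.bind_bind]
  refine congrArg _ (funext fun e => ?_)
  rw [gate, PMF.bind_map]
  rfl

/-- After a failed gate nothing is retained, since errors may spread through the encoder; the final
transverse correction brings the subblocks back into definite states. -/
theorem Claims.gates_off (h : Claims G T A B C) : (L : List (Fin 7 × Fin 7)) →
    (∀ g ∈ L, g.1 ≠ g.2) → {ν : PMF (Fin 7 → Block k)} → Off T ∅ (fun _ => 0) ν →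
    Graded (Off T ∅ fun _ => 0) (fun _ => True) 0 (L.length * C) (L.length.choose 2 * C ^ 2)
      (ν.bind (gates G L))
  | [], _, ν, hν => by
    have : ν.bind (gates G []) = ν := PMF.bind_pure ν
    rw [this]
    exact Graded.of_self hν _ _ _
  | (c, t) :: L, hL, ν, hν => by
    rw [bind_gates_cons]
    refine ((h.gate_off (hL (c, t) (by simp)) hν).graded.bind (d' := 0) (x' := L.length * C)
      (y' := L.length.choose 2 * C ^ 2) (z' := 0) (L' := fun _ => True)
      (fun μ hμ => h.gates_off L (fun g hg => hL g (by simp [hg])) hμ)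
      fun μ _ => Graded.of_self trivial _ _ _).mono (by simp) (le_of_eq ?_) (le_of_eq ?_)
      (fun _ h => h) fun _ h => h
    · rw [List.length_cons]
      push_cast
      ring
    · rw [List.length_cons, Nat.choose_succ_succ' _ 1, Nat.choose_one_right]
      push_cast
      ring

/-- An unverified ancilla with one fault. -/
def UnverifiedFault (T : Pauli → PMF (Block k) → Prop) (ρ : PMF (Fin 7 → Block k)) : Prop :=
  (∃ t, Off T ∅ t ρ) ∨ ∃ i, Off T {i} (fun _ => 0) ρ

/-- `unverified` as a law of tuples of subblocks. -/
def unver (G : Gadgets k) : PMF (Fin 7 → Block k) := unverified G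

/-- A fault before the final correction leads to the first alternative of `UnverifiedFault`, with an
unknown word of states; a fault within that correction leads to the second. The two bounds count the
`7`, `9` and `7` locations and their pairs. -/
theorem Claims.unver (h : Claims G T A B C) :
    Graded (Off T ∅ fun _ => 0) (UnverifiedFault T) 0 (7 * A + 9 * C + 7 * B)
      (21 * A ^ 2 + 36 * C ^ 2 + 21 * B ^ 2 + 63 * A * C + 49 * A * B + 63 * B * C)
      (unver G) := by
  have e : FT.unver G = ((indep fun i => if startsPlus i then G.anc.map (had k) else G.anc).bind
      (gates G encoder)).bind (ecs G) := by
    rw [PMF.bind_bind]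
    rfl
  have h1 : Graded (Off T ∅ fun _ => 0) (fun _ => True) 0 (7 * A) (21 * A ^ 2)
      (indep fun i => if startsPlus i then G.anc.map (had k) else G.anc) := by
    refine graded_indep (n := 7) (K := fun _ => T 0) (fun i => ?_)
      (fun g hg => ⟨g, fun j _ => hg j, rfl⟩) fun _ _ _ _ => trivial
    split_ifs
    · exact h.anc.map _ fun μ hμ => h.sound.had hμ
    · exact h.anc
  have h2 := Graded.bind h1 (z' := 0) (L' := fun _ => True)
    (fun μ hμ => h.gates_off encoder (by decide) hμ) fun μ _ => Graded.of_self trivial _ _ _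
  have h3 := Graded.bind h2 (z' := 21 * B ^ 2) (d' := 0) (x' := 7 * B) (y' := 21 * B ^ 2)
    (K' := Off T ∅ fun _ => 0) (L' := UnverifiedFault T)
    (fun μ hμ => (h.ecs_off hμ).mono le_rfl le_rfl le_rfl (fun _ h => h) fun _ h => Or.inr h)
    fun μ _ => (h.ecs_any μ).mono le_rfl le_rfl le_rfl (fun _ h => Or.inl h) fun _ h => h
  rw [e]
  have e9 : encoder.length = 9 := rfl
  have e36 : Nat.choose 9 2 = 36 := rfl
  refine h3.mono (by simp) (le_of_eq ?_) (le_of_eq ?_) (fun _ h => h) fun _ h => h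
  · rw [e9]
    push_cast
    ring
  · rw [e9, e36]
    push_cast
    ring

/-- A verified pair with one fault. -/
def AttemptFault (T : Pauli → PMF (Block k) → Prop)
    (ρ : PMF ((Fin 7 → Block k) × (Fin 7 → Block k))) : Prop :=
  (∃ σ, OffPair T ∅ σ ρ ∧ ((∀ i, (σ i).2.1 = (σ i).1.1) ∨ ∀ i, (σ i).1.1 = 0)) ∨
    ∃ i, OffPair T {i} (fun _ => 0) ρ

/-- `attempt` as a law of pairs of tuples of subblocks. -/
def trial (G : Gadgets k) : PMF ((Fin 7 → Block k) × (Fin 7 → Block k)) := attempt G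

/-- If the unknown word is in the first copy, the gates reproduce its `X` part in the second; if it
is in the second copy, only `Z` components reach the first. The `25` gates are the `9` of each
encoder and the `7` transverse ones. -/
theorem Claims.trial (h : Claims G T A B C) :
    Graded (OffPair T ∅ fun _ => 0) (AttemptFault T) 0 (14 * A + 14 * B + 25 * C)
      (91 * (A ^ 2 + B ^ 2) + 300 * C ^ 2 + 350 * (A + B) * C + 196 * A * B) (trial G) := by
  have e : FT.trial G = (pair (FT.unver G) (FT.unver G)).bind (cnots G) := by
    rw [pair_bind]
    rfl
  rw [e]
  have p0 : (fun i : Fin 7 => propagate ((fun _ => 0 : Fin 7 → Pauli) i)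
      ((fun _ => 0 : Fin 7 → Pauli) i)) = fun _ => 0 := rfl
  refine ((h.unver.pair h.unver).bind (d' := 0) (x' := 7 * C) (y' := 21 * C ^ 2)
    (z' := 21 * C ^ 2) ?_ ?_).mono (by simp) (le_of_eq (by ring)) (le_of_eq (by ring))
    (fun _ h => h) fun _ h => h
  · rintro _ ⟨μ, ν, hμ, hν, rfl⟩
    have := h.cnots_off hμ hν
    rw [p0] at this
    exact this.mono le_rfl le_rfl le_rfl (fun _ h => h) fun _ ⟨i, hi⟩ =>
      Or.inr ⟨i, by simpa using hi⟩
  · rintro _ ⟨μ, ν, ⟨hμ, ⟨t, hν⟩ | ⟨i, hν⟩⟩ | ⟨⟨t, hμ⟩ | ⟨i, hμ⟩, hν⟩, rfl⟩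
    · exact (h.cnots_off hμ hν).mono le_rfl le_rfl le_rfl
        (fun _ h => Or.inl ⟨_, h, Or.inr fun i => rfl⟩) fun _ _ => trivial
    · have := h.cnots_off (hμ.subset (Set.empty_subset {i})) hν
      rw [p0] at this
      exact this.mono le_rfl le_rfl le_rfl (fun _ h => Or.inr ⟨i, h⟩) fun _ _ => trivial
    · exact (h.cnots_off hμ hν).mono le_rfl le_rfl le_rfl
        (fun _ h => Or.inl ⟨_, h, Or.inl fun i => add_zero _⟩) fun _ _ => trivial
    · have := h.cnots_off hμ (hν.subset (Set.empty_subset {i}))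
      rw [p0] at this
      exact this.mono le_rfl le_rfl le_rfl (fun _ h => Or.inr ⟨i, h⟩) fun _ _ => trivial

/-- Acceptance of a pair of tuples of subblocks. -/
def acc (k : ℕ) : Set ((Fin 7 → Block k) × (Fin 7 → Block k)) := accepted k

theorem mem_acc {r : (Fin 7 → Block k) × (Fin 7 → Block k)} : r ∈ acc k ↔
    relBits (fun i => (state k (r.2 i)).1) = 0 ∧ logicalBit (fun i => (state k (r.2 i)).1) = 0 :=
  and_congr_left' funext_iff.symm

/-- `reduceZ` on tuples of subblocks. -/
def reduce (e : Fin 7 → Block k) : Fin 7 → Block k := reduceZ (k := k + 1) e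

theorem map_reduce {s : Pauli} {ν : PMF (Fin 7 → Block k)}
    (hν : ∀ e ∈ ν.support, state (k + 1) e = s) :
    ν.map reduce = ν.map fun e i => e i + fill (0, s.2) k := by
  refine map_congr_support fun e he => ?_
  have h : reduce e = fun i => e i + fill (0, (state (k + 1) e).2) k := rfl
  rw [h, hν e he]

theorem OneBad.map_reduce (hT : Sound T) {s : Pauli} {ν : PMF (Fin 7 → Block k)}
    (h : OneBad T s ν) (hs : s.1 = 0) : OneBad T 0 (ν.map reduce) := by
  rw [FT.map_reduce (h.state_eq hT)]
  have e : s + (0, s.2) = 0 :=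
    Prod.ext (by rw [Prod.fst_add, hs]; rfl) (CharTwo.add_self_eq_zero _)
  rw [← e]
  exact h.map_shift hT _

theorem Clean.map_reduce (hT : Sound T) {s : Pauli} {ν : PMF (Fin 7 → Block k)}
    (h : Clean T s ν) (hs : s.1 = 0) : Clean T 0 (ν.map reduce) := by
  rw [FT.map_reduce (h.oneBad.state_eq hT)]
  have e : s + (0, s.2) = 0 :=
    Prod.ext (by rw [Prod.fst_add, hs]; rfl) (CharTwo.add_self_eq_zero _)
  rw [← e]
  exact h.map_shift hT _

theorem map_reduce_fst (μ ν : PMF (Fin 7 → Block k)) :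
    ((pair μ ν).map fun r => reduce r.1) = μ.map reduce := by
  conv_rhs => rw [← pair_map_fst μ ν, PMF.map_comp]
  rfl

/-- All `Z` errors on `|0⟩` are equivalent to errors on one subblock. -/
theorem oneBad_of_off {t : Fin 7 → Pauli} {ν : PMF (Fin 7 → Block k)} (hν : Off T ∅ t ν)
    (h1 : relBits (fun i => (t i).1) = 0) (h2 : logicalBit (fun i => (t i).1) = 0) :
    ∃ s : Pauli, s.1 = 0 ∧ OneBad T s ν := by
  obtain ⟨m, hm, rfl⟩ := hν
  obtain ⟨i, hi⟩ := relBits_weight_le_one fun i => (t i).2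
  -- The `Z` part rounded to a code word. It differs from the true one at most at `i`, so the
  -- subblock `i` is declared uncontrolled.
  set z : Fin 7 → ZMod 2 := (fun i => (t i).2) + relBits fun i => (t i).2 with hz
  refine ⟨_, ?_, fun j => ((t j).1, z j), i, ⟨h1, relBits_add_relBits _⟩, rfl, m,
    fun j hj => ?_, rfl⟩
  · exact h2
  · have : ((t j).1, z j) = t j := by
      rw [hz, Pi.add_apply, hi j hj, add_zero]
    simp only
    rw [this]
    exact hm j (Set.notMem_empty j)

/-- All states are definite within a component, so acceptance has probability zero or one there, and
conditioning on it does not change the law. If all subblocks are controlled, acceptance forces the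
`X` word of the second block, and hence that of the first, to be trivial. If only `i` is
uncontrolled, the first block already decodes to `0`. -/
theorem AttemptFault.condOn (hT : Sound T) {ρ : PMF ((Fin 7 → Block k) × (Fin 7 → Block k))}
    (h : AttemptFault T ρ) (hacc : ∃ r ∈ acc k, r ∈ ρ.support) :
    OneBad T 0 ((FT.condOn ρ (acc k)).map fun r => reduce r.1) := by
  have key : ∀ {S σ}, OffPair T S σ ρ → FT.condOn ρ (acc k) = ρ ∧ (S = ∅ →
      relBits (fun i => (σ i).2.1) = 0 ∧ logicalBit (fun i => (σ i).2.1) = 0) := by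
    rintro S σ ⟨m, m', h1, h2, rfl⟩
    choose s h3 h4 using h2
    have h5 : ∀ r ∈ (pair (indep m) (indep m')).support, ∀ j, state k (r.2 j) = (s j).2 :=
      fun r hr j => h4 j _ (mem_support_indep.mp (mem_support_pair.mp hr).2 j)
    obtain ⟨r, hr, hr'⟩ := hacc
    refine ⟨condOn_of_support_subset fun r' h' => ?_, fun hS => ?_⟩
    · rw [mem_acc] at hr ⊢
      simp only [h5 r hr'] at hr
      simp only [h5 r' h']
      exact hr
    · subst hS
      have h6 : ∀ j, state k (r.2 j) = (σ j).2 := fun j =>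
        hT.state_eq (h1 j (Set.notMem_empty j)).2 _
          (mem_support_indep.mp (mem_support_pair.mp hr').2 j)
      rw [mem_acc] at hr
      simp only [h6] at hr
      exact hr
  rcases h with ⟨σ, hσ, h7⟩ | ⟨i, hσ⟩
  · obtain ⟨h8, h9⟩ := key hσ
    obtain ⟨h10, h11⟩ := h9 rfl
    rw [h8]
    obtain ⟨m, m', h1, h2, rfl⟩ := hσ
    rw [map_reduce_fst]
    have hX : relBits (fun i => (σ i).1.1) = 0 ∧ logicalBit (fun i => (σ i).1.1) = 0 := by
      rcases h7 with h7 | h7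
      · simp only [h7] at h10 h11
        exact ⟨h10, h11⟩
      · simp only [h7]
        exact ⟨relBits_const 0, logicalBit_const 0⟩
    obtain ⟨s, hs, hbad⟩ := oneBad_of_off (T := T) (t := fun i => (σ i).1)
      ⟨m, fun j hj => (h1 j hj).1, rfl⟩ hX.1 hX.2
    exact hbad.map_reduce hT hs
  · rw [(key hσ).1]
    obtain ⟨m, m', h1, h2, rfl⟩ := hσ
    rw [map_reduce_fst]
    exact OneBad.map_reduce hT (s := 0) ⟨_, i, isCode_zero, decodePauli_zero, m,
      fun j hj => (h1 j hj).1, rfl⟩ rfl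

/-- The verified ancilla, and the probability of acceptance. -/
theorem Claims.verified_anc (h : Claims G T A B C) {x y A' a : ℝ≥0∞}
    (hx : x = 14 * A + 14 * B + 25 * C)
    (hy : y = 91 * (A ^ 2 + B ^ 2) + 300 * C ^ 2 + 350 * (A + B) * C + 196 * A * B)
    (hx1 : x < 1) (hA' : A' = y / (1 - x)) (hA1 : A' < 1) (ha : a = x / (1 - x) / (1 - A')) :
    1 - x ≤ (attempt G).toOuterMeasure (accepted k) ∧
      Fails A' (Labelled T a 0) (verified G) := by
  have h1 := h.trial
  rw [← hx, ← hy] at h1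
  have hK : ∀ μ, OffPair T ∅ (fun _ => 0) μ → ∀ r ∈ μ.support, r ∈ acc k := by
    rintro _ ⟨m, m', h4, _, rfl⟩ r hr
    have h6 : ∀ j, state k (r.2 j) = 0 := fun j =>
      h.sound.state_eq (h4 j (Set.notMem_empty j)).2 _
        (mem_support_indep.mp (mem_support_pair.mp hr).2 j)
    rw [mem_acc]
    simp only [h6]
    exact ⟨relBits_const 0, logicalBit_const 0⟩
  have hP : ∀ μ, OffPair T ∅ (fun _ => 0) μ → Clean T 0 (μ.map fun r => reduce r.1) := by
    rintro _ ⟨m, m', h4, _, rfl⟩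
    rw [map_reduce_fst]
    exact Clean.map_reduce h.sound (s := 0) ⟨_, isCode_zero, decodePauli_zero, m,
      fun j hj => (h4 j hj).1, rfl⟩ rfl
  obtain ⟨h2, h3⟩ := h1.condOn (Q := fun ρ => OneBad T 0 (ρ.map fun r => reduce r.1)) hx1 hK hP
    fun ρ hρ hacc => hρ.condOn h.sound hacc
  refine ⟨h2, ?_⟩
  have h4 : Graded (Clean T 0) (OneBad T 0) 0 (x / (1 - x)) A' (FT.verified G) := by
    rw [hA']
    exact h3.map (fun r => reduce r.1) (fun _ h => h) fun _ h => h
  -- A double fault becomes the hidden failure of the output; excluding it divides the bound for one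
  -- fault by `1 - A'`.
  have h5 := h4.normalize (by rwa [zero_add])
  rw [zero_add, ← ha] at h5
  exact h5

end Ancilla

/-! ### Wellness of mixtures of tame laws -/

section Wellness

/-- Conditioning independent samples on all but one of them does not affect that one. -/
theorem condOn_indep_map_apply {α : Type} {n : ℕ} (μ : Fin n → PMF α) (i : Fin n) {e : Fin n → α}
    (he : e ∈ (indep μ).support) :
    (condOn (indep μ) {e' | ∀ j, j ≠ i → e' j = e j}).map (fun e' => e' i) = μ i := by
  classical
  set S : Set (Fin n → α) := {e' | ∀ j, j ≠ i → e' j = e j} with hS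
  -- All coordinates but `i` are frozen: the product law is the mixture of these laws, and
  -- conditioning on the other coordinates only selects components, each with `i`-th marginal `μ i`.
  set g : Fin n → α → PMF α := fun j a => if j = i then μ i else PMF.pure a with hg
  have h1 : indep μ = (indep μ).bind fun c => indep fun j => g j (c j) := by
    rw [indep_bind_indep]
    congr 1
    funext j
    by_cases hj : j = i
    · subst hj
      simp [hg]
    · simp [hg, hj]
  have heS : e ∈ S := fun j _ => rfl
  obtain ⟨μ', h2, -, h3⟩ := condOn_bind (μ := indep μ) (f := fun c => indep fun j => g j (c j))
    (S := S) ⟨e, heS, by rwa [← h1]⟩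
  rw [h1, h3, PMF.map_bind]
  have h4 : ∀ c ∈ μ'.support,
      (condOn (indep fun j => g j (c j)) S).map (fun e' => e' i) = μ i := by
    intro c hc
    have h5 : ∀ b ∈ (indep fun j => g j (c j)).support, ∀ j, j ≠ i → b j = c j := by
      intro b hb j hj
      have := mem_support_indep.mp hb j
      simpa [hg, hj] using this
    obtain ⟨-, b, hbS, hb⟩ := h2 c hc
    rw [condOn_of_support_subset, indep_map_apply]
    · simp [hg]
    · intro b' hb' j hj
      rw [h5 b' hb' j hj, ← h5 b hb j hj, hbS j hj]
  rw [bind_congr_support h4, PMF.bind_const]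

/-- A law with a label all of whose values determine independent subblocks. -/
theorem Labelled.exists_label {k : ℕ} {T : Pauli → PMF (Block k) → Prop} {a : ℝ≥0∞} {s : Pauli}
    {ν : PMF (Fin 7 → Block k)} (h : Labelled T a s ν) :
    ∃ (σ : PMF ((ℕ × ℕ) × PMF (Fin 7 → Block k))) (lab : _ → Option (Fin 7)),
      σ.bind Prod.snd = ν ∧ σ.toOuterMeasure {c | lab c ≠ none} ≤ a ∧
      ∀ c ∈ σ.support, ∃ t m, IsCode t ∧ (∀ j, lab c ≠ some j → T (t j) (m j)) ∧
        c.2 = indep m := by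
  obtain ⟨σ, h1, h2, h3, h4, h5, h6⟩ := h
  have key : ∀ c, ∃ u : Option (Fin 7), c ∈ σ.support → ((u ≠ none → 1 ≤ c.1.1) ∧
      ∃ t m, IsCode t ∧ (∀ j, u ≠ some j → T (t j) (m j)) ∧ c.2 = indep m) := by
    rintro ⟨⟨x, y⟩, ρ⟩
    by_cases hc : ((x, y), ρ) ∈ σ.support
    swap
    · exact ⟨none, fun h => absurd h hc⟩
    have e1 := notMem_of_toOuterMeasure_eq_zero (nonpos_iff_eq_zero.mp h4) hc
    have e2 := notMem_of_toOuterMeasure_eq_zero (nonpos_iff_eq_zero.mp h6) hc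
    simp only [Set.mem_ofPred_eq, not_le] at e1 e2
    obtain rfl : y = 0 := by omega
    rcases (by omega : x = 0 ∨ x = 1) with rfl | rfl
    · obtain ⟨t, g1, -, m, g2, g3⟩ := h2 _ hc rfl
      exact ⟨none, fun _ => ⟨fun h => absurd rfl h, t, m, g1,
        fun j _ => g2 j (Set.notMem_empty j), g3⟩⟩
    · obtain ⟨t, i, g1, -, m, g2, g3⟩ := h3 _ hc rfl
      exact ⟨some i, fun _ => ⟨fun _ => le_rfl, t, m, g1,
        fun j hj => g2 j fun hji => hj (by rw [hji]), g3⟩⟩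
  choose lab hlab using key
  exact ⟨σ, lab, h1, (toOuterMeasure_le_of_support fun c hc h => (hlab c hc).1 h).trans h5,
    fun c hc => (hlab c hc).2⟩

/-- Mixtures of tame laws are needed for the induction: conditioning on the other subblocks
reweights the hidden components, so the law of subblock `i` is again a mixture of tame laws and not
a single one. -/
theorem well_bind {q : ℕ → ℝ≥0∞} {r : ℕ → ℝ} : {k : ℕ} →
    (∀ j, 1 ≤ j → j ≤ k → 0 ≤ r j ∧ q j ≤ ENNReal.ofReal (r j)) → {ι : Type} → (π : PMF ι) →
    (f : ι → PMF (Block k)) → (∀ c ∈ π.support, ∃ s, Tame q k s (f c)) → Well r k (π.bind f)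
  | 0, _, _, _, _, _ => trivial
  | k + 1, hq, ι, π, f, hf => by
    intro s hs
    obtain ⟨π', h1, -, h2⟩ := condOn_bind (S := {e | state (k + 1) e = s})
      (by obtain ⟨e, he, he'⟩ := hs; exact ⟨e, he', he⟩ :
        ∃ e ∈ {e | state (k + 1) e = s}, e ∈ (π.bind f).support)
    have hT := sound_tame q k
    have h3 : ∀ c ∈ π'.support,
        Tame q (k + 1) s (condOn (f c) {e | state (k + 1) e = s}) := by
      intro c hc
      obtain ⟨hc', e, he, he'⟩ := h1 c hc
      obtain ⟨s', hs'⟩ := hf c hc'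
      have h4 := (sound_tame q (k + 1)).state_eq hs'
      -- A tame law has a definite state, so conditioning on the state keeps a component whole or
      -- discards it.
      obtain rfl : s' = s := (h4 e he').symm.trans he
      rw [condOn_of_support_subset (S := {e | state (k + 1) e = s'}) h4]
      exact hs'
    have h4 : Tame q (k + 1) s (condOn (π.bind f) {e | state (k + 1) e = s}) := by
      rw [h2]
      exact Graded.of_forall π' h3
    obtain ⟨σ, lab, h5, h6, h7⟩ := Labelled.exists_label h4
    refine ⟨σ.map lab, fun u => (condOn σ {c | lab c = u}).bind Prod.snd, ?_, ?_, ?_⟩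
    · have h8 : σ.bind Prod.snd =
          (σ.map lab).bind fun u => (condOn σ {c | lab c = u}).bind Prod.snd := by
        rw [← PMF.bind_bind, map_bind_condOn]
      exact h5.symm.trans h8
    · obtain ⟨h8, h9⟩ := hq (k + 1) (by omega) le_rfl
      rw [← ENNReal.toReal_sum fun i _ => PMF.apply_ne_top _ _]
      refine ENNReal.toReal_le_of_le_ofReal h8 (le_trans ?_ h9)
      have h10 : ∑ i, (σ.map lab) (some i) =
          (σ.map lab).toOuterMeasure (Finset.univ.map Function.Embedding.some : Finset (Option (Fin 7))) := by
        rw [PMF.toOuterMeasure_apply_finset, Finset.sum_map]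
        rfl
      rw [h10, PMF.toOuterMeasure_map_apply]
      refine le_trans (toOuterMeasure_le_of_support fun c _ hc => ?_) h6
      obtain ⟨i, -, hi⟩ := Finset.mem_map.mp (Finset.mem_coe.mp (Set.mem_preimage.mp hc))
      rw [Set.mem_ofPred_eq, ← hi]
      exact Option.some_ne_none i
    · intro u hu i hui e he
      obtain ⟨c₀, hc₀, hu'⟩ := (PMF.mem_support_map_iff _ _ _).mp hu
      have hX : ∀ c, c ∈ (condOn σ {c | lab c = u}).support ↔ lab c = u ∧ c ∈ σ.support :=
        fun c => mem_support_condOn ⟨c₀, hu', hc₀⟩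
      refine ⟨?_, ?_⟩
      · obtain ⟨c, hc, hec⟩ := (PMF.mem_support_bind_iff _ _ _).mp he
        obtain ⟨hlab, hc⟩ := (hX c).mp hc
        obtain ⟨t, m, g1, g2, g3⟩ := h7 c hc
        rw [g3] at hec
        -- The place `l` may deviate from the code word: it is the named subblock, or any place
        -- other than `i` if the label is empty.
        obtain ⟨l, hl, hl'⟩ : ∃ l, i ≠ l ∧ ∀ j, j ≠ l → u ≠ some j := by
          rcases u with _ | l
          · obtain ⟨l, hl⟩ := exists_ne i
            exact ⟨l, hl.symm, fun j _ => Option.some_ne_none j |>.symm⟩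
          · exact ⟨l, fun h => hui (by rw [h]), fun j hj h => hj (Option.some.inj h).symm⟩
        exact g1.relPauli_eq_off (fun j hj => hT.state_eq (g2 j (by rw [hlab]; exact hl' j hj)) _
          (mem_support_indep.mp hec j)) hl
      -- By Bayes' rule only the weights of the components change; within a component independence
      -- keeps the law of subblock `i`.
      · obtain ⟨X', g4, -, g5⟩ := condOn_bind (μ := condOn σ {c | lab c = u}) (f := Prod.snd)
          (S := {e' | ∀ j, j ≠ i → e' j = e j}) ⟨e, fun j _ => rfl, he⟩
        have g6 : (condOn ((condOn σ {c | lab c = u}).bind Prod.snd)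
            {e' | ∀ j, j ≠ i → e' j = e j}).map (fun e' => e' i) = X'.bind fun c =>
              (condOn c.2 {e' | ∀ j, j ≠ i → e' j = e j}).map (fun e' => e' i) := by
          rw [g5, PMF.map_bind]
        refine Eq.mpr (congrArg (Well r k) g6) (well_bind (q := q)
          (fun j hj hj' => hq j hj (by omega)) X' _ fun c hc => ?_)
        obtain ⟨hc, b, hb, hb'⟩ := g4 c hc
        obtain ⟨hlab, hc⟩ := (hX c).mp hc
        obtain ⟨t, m, -, g2, g3⟩ := h7 c hc
        have g7 : {e' : Fin 7 → Block k | ∀ j, j ≠ i → e' j = e j} =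
            {e' | ∀ j, j ≠ i → e' j = b j} :=
          Set.ext fun e' => forall₂_congr fun j hj => by rw [hb j hj]
        refine ⟨t i, ?_⟩
        rw [g7, g3, condOn_indep_map_apply m i (by rwa [← g3])]
        exact g2 i (by rwa [hlab])

end Wellness

/-! ### The ideal ancilla and bookkeeping -/

section Kets

/-- Propagation of logical basis states through a transverse CNOT gate. -/
theorem codeKet_mul_codeKet_add : (k : ℕ) → (a b : ZMod 2) → (y z : Bits k) →
    codeKet k a y * codeKet k b (y + z) = codeKet k a y * codeKet k (a + b) z
  | 0, a, b, y, z => by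
    have key : ∀ a b y z : ZMod 2, (if y = a then (1 : ℂ) else 0) * (if y + z = b then 1 else 0) =
        (if y = a then 1 else 0) * (if z = a + b then 1 else 0) := by
      intro a b y z
      by_cases h : y = a
      · subst h
        have h2 : ∀ y z b : ZMod 2, y + z = b ↔ z = y + b := by decide
        rw [if_congr (h2 y z b) rfl rfl]
      · simp [h]
    exact key a b y z
  | k + 1, a, b, y, z => by
    have key : ∀ x : Fin 7 → ZMod 2,
        ((if parityCheck *ᵥ x = 0 ∧ ∑ i, x i = a then ∏ i, codeKet k (x i) (y i) else 0) *
          ∑ x' : Fin 7 → ZMod 2, if parityCheck *ᵥ x' = 0 ∧ ∑ i, x' i = b then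
            ∏ i, codeKet k (x' i) (y i + z i) else 0) =
        (if parityCheck *ᵥ x = 0 ∧ ∑ i, x i = a then ∏ i, codeKet k (x i) (y i) else 0) *
          ∑ x' : Fin 7 → ZMod 2, if parityCheck *ᵥ x' = 0 ∧ ∑ i, x' i = a + b then
            ∏ i, codeKet k (x' i) (z i) else 0 := by
      intro x
      by_cases hx : parityCheck *ᵥ x = 0 ∧ ∑ i, x i = a
      swap
      · simp [hx]
      -- Translation by the code word `x` maps the words of parity `b` onto those of parity `a + b`.
      rw [if_pos hx, ← Equiv.sum_comp (Equiv.addLeft x) fun x' : Fin 7 → ZMod 2 =>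
        if parityCheck *ᵥ x' = 0 ∧ ∑ i, x' i = a + b then ∏ i, codeKet k (x' i) (z i) else 0,
        Finset.mul_sum, Finset.mul_sum]
      refine Finset.sum_congr rfl fun x' _ => ?_
      have h1 : (parityCheck *ᵥ (Equiv.addLeft x x') = 0 ∧
          ∑ i, (Equiv.addLeft x x') i = a + b) ↔ parityCheck *ᵥ x' = 0 ∧ ∑ i, x' i = b := by
        simp only [Equiv.coe_addLeft, Matrix.mulVec_add, Pi.add_apply, Finset.sum_add_distrib,
          hx.1, hx.2, zero_add, add_right_inj]
      rw [if_congr h1 rfl rfl]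
      split_ifs
      · rw [← Finset.prod_mul_distrib, ← Finset.prod_mul_distrib]
        exact Finset.prod_congr rfl fun i _ => codeKet_mul_codeKet_add k _ _ _ _
      · rfl
    have h2 : ∀ (c p q r : ℂ), p * q = p * r → c * p * (c * q) = c * p * (c * r) := by
      intro c p q r h
      linear_combination c * c * h
    refine h2 _ _ _ _ ?_
    rw [Finset.sum_mul, Finset.sum_mul]
    exact Finset.sum_congr rfl fun x _ => key x

/-- A superposition of encoded bit strings. -/
def encode (k : ℕ) (φ : (Fin 7 → ZMod 2) → ℂ) (y : Fin 7 → Bits k) : ℂ :=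
  ∑ x, φ x * ∏ i, codeKet k (x i) (y i)

theorem codeKet_succ (k : ℕ) (b : ZMod 2) : codeKet (k + 1) b = encode k fun x =>
    if parityCheck *ᵥ x = 0 ∧ ∑ i, x i = b then 1 / (Real.sqrt 8 : ℂ) else 0 := by
  have key : ∀ y : Fin 7 → Bits k, (1 / (Real.sqrt 8 : ℂ)) * (∑ x : Fin 7 → ZMod 2,
      if parityCheck *ᵥ x = 0 ∧ ∑ i, x i = b then ∏ i, codeKet k (x i) (y i) else 0) =
      encode k (fun x => if parityCheck *ᵥ x = 0 ∧ ∑ i, x i = b then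
        1 / (Real.sqrt 8 : ℂ) else 0) y := by
    intro y
    rw [encode, Finset.mul_sum]
    refine Finset.sum_congr rfl fun x _ => ?_
    split_ifs
    · rfl
    · rw [mul_zero, zero_mul]
  exact funext key

/-- A CNOT gate is an involution on words, so the sum can be reindexed by it; the factors at `c` and
`t` are then compared by `codeKet_mul_codeKet_add`. -/
theorem encode_cnot (k : ℕ) (φ : (Fin 7 → ZMod 2) → ℂ) {c t : Fin 7} (h : c ≠ t)
    (y : Fin 7 → Bits k) : encode k φ (Function.update y t (y c + y t)) =
      encode k (fun x => φ (Function.update x t (x c + x t))) y := by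
  set g : (Fin 7 → ZMod 2) → Fin 7 → ZMod 2 := fun x => Function.update x t (x c + x t) with hg
  have h0 : ∀ x, g (g x) = x := by
    intro x
    funext i
    by_cases hi : i = t
    · subst hi
      simp only [hg, Function.update_self, Function.update_of_ne h]
      rw [← add_assoc, CharTwo.add_self_eq_zero, zero_add]
    · simp only [hg, Function.update_of_ne hi]
  let G : Equiv.Perm (Fin 7 → ZMod 2) := ⟨g, g, h0, h0⟩
  rw [encode, encode, ← Equiv.sum_comp G]
  refine Finset.sum_congr rfl fun x _ => ?_
  change φ (g x) * _ = φ (g x) * _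
  congr 1
  change ∏ i, codeKet k (g x i) (Function.update y t (y c + y t) i) = _
  rw [← Finset.mul_prod_erase _ _ (Finset.mem_univ t), ← Finset.mul_prod_erase _ (fun i =>
    codeKet k (x i) (y i)) (Finset.mem_univ t)]
  have hc : c ∈ Finset.univ.erase t := Finset.mem_erase.mpr ⟨h, Finset.mem_univ c⟩
  have h1 : ∀ i ∈ Finset.univ.erase t, codeKet k (g x i) (Function.update y t (y c + y t) i) =
      codeKet k (x i) (y i) := by
    intro i hi
    have hi := (Finset.mem_erase.mp hi).1
    simp only [hg, Function.update_of_ne hi]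
  rw [Finset.prod_congr rfl h1, ← Finset.mul_prod_erase _ _ hc]
  have h2 := codeKet_mul_codeKet_add k (x c) (x c + x t) (y c) (y t)
  rw [← add_assoc, CharTwo.add_self_eq_zero, zero_add] at h2
  simp only [hg, Function.update_self]
  linear_combination (∏ i ∈ (Finset.univ.erase t).erase c, codeKet k (x i) (y i)) * h2

theorem encode_foldl (k : ℕ) : (L : List (Fin 7 × Fin 7)) → (∀ g ∈ L, g.1 ≠ g.2) →
    (φ : (Fin 7 → ZMod 2) → ℂ) →
    L.foldl (fun ψ g => fun y => ψ (Function.update y g.2 (y g.1 + y g.2))) (encode k φ) =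
      encode k (L.foldl (fun ψ g => fun x => ψ (Function.update x g.2 (x g.1 + x g.2))) φ)
  | [], _, _ => rfl
  | g :: L, hL, φ => by
    rw [List.foldl_cons, List.foldl_cons,
      ← encode_foldl k L (fun g hg => hL g (List.mem_cons_of_mem _ hg))]
    congr 1
    funext y
    exact encode_cnot k φ (hL g List.mem_cons_self) y

/-- The starting state of the encoding circuit. -/
theorem prod_start (k : ℕ) (y : Fin 7 → Bits k) :
    ∏ i, (if startsPlus i then plusKet k (y i) else codeKet k 0 (y i)) = encode k (fun x =>
      if x 2 = 0 ∧ x 4 = 0 ∧ x 5 = 0 ∧ x 6 = 0 then 1 / (Real.sqrt 8 : ℂ) else 0) y := by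
  set w : Fin 7 → ZMod 2 → ℂ := fun i b =>
    if startsPlus i then 1 / (Real.sqrt 2 : ℂ) else if b = 0 then 1 else 0 with hw
  have h1 : ∀ i, (if startsPlus i then plusKet k (y i) else codeKet k 0 (y i)) =
      ∑ b : ZMod 2, w i b * codeKet k b (y i) := by
    intro i
    rw [show (Finset.univ : Finset (ZMod 2)) = {0, 1} from rfl,
      Finset.sum_pair (by decide : (0 : ZMod 2) ≠ 1)]
    simp only [hw, plusKet]
    split_ifs with h
    · ring
    · simp at *
    · simp
  have h8 : (Real.sqrt 8 : ℂ) = Real.sqrt 2 * Real.sqrt 2 * Real.sqrt 2 := by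
    rw [← Complex.ofReal_mul, ← Complex.ofReal_mul, Real.mul_self_sqrt (by norm_num)]
    congr 1
    rw [show (8 : ℝ) = 2 ^ 2 * 2 by norm_num, Real.sqrt_mul (by norm_num),
      Real.sqrt_sq (by norm_num)]
  rw [Finset.prod_congr rfl fun i _ => h1 i, Finset.prod_univ_sum, Fintype.piFinset_univ, encode]
  refine Finset.sum_congr rfl fun x _ => ?_
  rw [Finset.prod_mul_distrib]
  congr 1
  rw [Fin.prod_univ_seven]
  simp only [hw, startsPlus]
  simp only [Matrix.cons_val, if_true, Bool.false_eq_true, if_false]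
  rw [h8]
  split_ifs <;> simp_all [mul_comm]

/-- Undoing the encoder, with its gates in reverse order, sends exactly the even code words to the
words that vanish at the places starting in `|0⟩`. -/
theorem encoder_parity : ∀ x : Fin 7 → ZMod 2,
    (let x' := encoder.foldr (fun g x => Function.update x g.2 (x g.1 + x g.2)) x
     x' 2 = 0 ∧ x' 4 = 0 ∧ x' 5 = 0 ∧ x' 6 = 0) ↔
      parityCheck *ᵥ x = 0 ∧ ∑ i, x i = 0 := by
  decide +kernel

theorem foldl_precomp {α β : Type} (f : α → β → α) (φ : α → ℂ) : (L : List β) →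
    L.foldl (fun ψ g => fun x => ψ (f x g)) φ = fun x => φ (L.foldr (fun g x => f x g) x) := by
  intro L
  induction L generalizing φ with
  | nil => rfl
  | cons g L ih =>
    rw [List.foldl_cons, ih]
    rfl

theorem idealUnverified_eq (k : ℕ) : idealUnverified k = codeKet (k + 1) 0 := by
  have h1 : (fun y : Fin 7 → Bits k =>
      ∏ i, if startsPlus i then plusKet k (y i) else codeKet k 0 (y i)) = _ :=
    funext (prod_start k)
  have h2 : ∀ g ∈ encoder, g.1 ≠ g.2 := by decide
  refine (congrArg (encoder.foldl fun ψ g => fun y : Fin 7 → Bits k =>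
    ψ (Function.update y g.2 (y g.1 + y g.2))) h1).trans ?_
  rw [encode_foldl k _ h2, codeKet_succ]
  congr 1
  rw [foldl_precomp (fun (x : Fin 7 → ZMod 2) (g : Fin 7 × Fin 7) =>
    Function.update x g.2 (x g.1 + x g.2))]
  funext x
  exact if_congr (encoder_parity x) rfl rfl

theorem idealAttempt_eq (k : ℕ) :
    idealAttempt k = fun y z => codeKet (k + 1) 0 y * codeKet (k + 1) 0 z := by
  funext y z
  rw [idealAttempt, idealUnverified_eq, codeKet_mul_codeKet_add, add_zero]

theorem zDot_add : (k : ℕ) → (e f : Block k) → (y : Bits k) →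
    zDot k (e + f) y = zDot k e y + zDot k f y
  | 0, e, f, y => add_mul (R := ZMod 2) e.2 f.2 y
  | k + 1, e, f, y => by
    refine Eq.trans ?_ Finset.sum_add_distrib
    exact Finset.sum_congr rfl fun i _ => zDot_add k (e i) (f i) (y i)

theorem xBits_add_fill (c : ZMod 2) : (k : ℕ) → (e : Block k) →
    xBits k (e + fill (0, c) k) = xBits k e
  | 0, e => add_zero (M := ZMod 2) e.1
  | k + 1, e => funext fun i => xBits_add_fill c k (e i)

/-- The transverse `Z` operator acts on logical basis states as the logical `Z`. -/
theorem zDot_fill (c : ZMod 2) : (k : ℕ) → (b : ZMod 2) → (y : Bits k) → codeKet k b y ≠ 0 →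
    zDot k (fill (0, c) k) y = c * b
  | 0, b, y, h => by
    have h1 : y = b := by
      by_contra h2
      exact h (if_neg h2)
    subst h1
    rfl
  | k + 1, b, y, h => by
    have h1 : encode k (fun x => if parityCheck *ᵥ x = 0 ∧ ∑ i, x i = b then
        1 / (Real.sqrt 8 : ℂ) else 0) y ≠ 0 := by
      rw [codeKet_succ] at h
      exact h
    obtain ⟨x, -, hx⟩ := Finset.exists_ne_zero_of_sum_ne_zero h1
    have h2 := left_ne_zero_of_mul hx
    have h3 : parityCheck *ᵥ x = 0 ∧ ∑ i, x i = b := by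
      by_contra h4
      exact h2 (if_neg h4)
    have h4 := Finset.prod_ne_zero_iff.mp (right_ne_zero_of_mul hx)
    rw [← h3.2, Finset.mul_sum]
    exact Finset.sum_congr rfl fun i hi => zDot_fill c k (x i) (y i) (h4 i hi)

/-- The additional sign matters only where the amplitude is non-zero, and there the transverse `Z`
has eigenvalue `1` on `|0⟩`. -/
theorem pauliKet_reduceZ {k : ℕ} (e : Block k) :
    pauliKet (reduceZ e) (codeKet k 0) = pauliKet e (codeKet k 0) := by
  funext y
  rw [pauliKet, pauliKet, reduceZ, xBits_add_fill, zDot_add]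
  by_cases h : codeKet k 0 (y + xBits k e) = 0
  · rw [h, mul_zero, mul_zero]
  · rw [zDot_fill _ k 0 _ h, mul_zero, add_zero]

end Kets

/-! ### The induction over levels -/

section Levels

/-- The hidden flag of a law that fails with small probability. -/
theorem Fails.exists_flag {α : Type} {δ : ℝ≥0∞} {K : PMF α → Prop} {ν : PMF α}
    (h : Fails δ K ν) (hδ : δ < 1) : ∃ (fail : PMF Bool) (out : Bool → PMF α),
      ν = fail.bind out ∧ fail true ≤ δ ∧
        ∃ π : PMF (Bool × PMF α), out false = π.bind Prod.snd ∧ ∀ c ∈ π.support, K c.2 := by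
  obtain ⟨π, rfl, h2, h3⟩ := h
  refine ⟨π.map Prod.fst, fun b => (condOn π {c | c.1 = b}).bind Prod.snd, ?_, ?_,
    condOn π {c | c.1 = false}, rfl, fun c hc => ?_⟩
  · rw [← PMF.bind_bind, map_bind_condOn]
  · rw [← PMF.toOuterMeasure_apply_singleton, PMF.toOuterMeasure_map_apply]
    exact h3
  · have h4 : ∃ c ∈ {c : Bool × PMF α | c.1 = false}, c ∈ π.support := by
      by_contra! h4
      have h5 : π.toOuterMeasure {c | c.1 = true} = 1 :=
        (PMF.toOuterMeasure_apply_eq_one_iff _ _).mpr fun c hc => by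
          have := fun h => h4 c h hc
          simpa using this
      exact absurd (h5 ▸ h3) (not_le.mpr hδ)
    obtain ⟨h5, h6⟩ := (mem_support_condOn h4).mp hc
    exact h2 c h6 h5

theorem fails_physicalCNOT (p : ℝ≥0) (hp : p ≤ 1) (err : PMF (Pauli × Pauli)) (e f : Pauli) :
    Fails p (fun ρ => ρ = PMF.pure (propagate e f)) (physicalCNOT p hp err e f) := by
  refine ⟨(coin p hp).map fun c => (c, if c then err.map fun P => propagate e f + P
    else PMF.pure (propagate e f)), ?_, fun c hc h0 => ?_, ?_⟩
  · rw [PMF.bind_map]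
    rfl
  · obtain ⟨b, -, rfl⟩ := (PMF.mem_support_map_iff _ _ _).mp hc
    obtain rfl : b = false := h0
    rfl
  · rw [PMF.toOuterMeasure_map_apply]
    have h1 : (fun c : Bool => (c, if c then err.map fun P => propagate e f + P
        else PMF.pure (propagate e f))) ⁻¹' {c | c.1 = true} = {true} := by
      ext b
      simp
    rw [h1, PMF.toOuterMeasure_apply_singleton]
    exact le_rfl

theorem claims_zero (p : ℝ≥0) (hp : p ≤ 1) (err : PMF (Pauli × Pauli)) (q : ℕ → ℝ≥0∞) :
    Claims (gadgets p hp err 0) (Tame q 0) 0 0 p where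
  sound := sound_tame q 0
  anc := Fails.of_self (K := Tame q 0 0) rfl _
  ec_any e := Fails.of_self (K := fun ν => ∃ s, Tame q 0 s ν) ⟨e, rfl⟩ _
  ec {s μ} h := by
    obtain rfl : μ = PMF.pure s := h
    exact Fails.of_self (K := Tame q 0 s) (PMF.pure_bind _ _) _
  cnot_any e f := (fails_physicalCNOT p hp err e f).mono le_rfl fun ρ h =>
    ⟨propagate e f, _, _, rfl, rfl, h.trans (pair_pure _ _).symm⟩
  cnot {s t μ ν} h h' := by
    obtain rfl : μ = PMF.pure s := h
    obtain rfl : ν = PMF.pure t := h'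
    have e : (pair (PMF.pure s) (PMF.pure t)).bind (fun r => physicalCNOT p hp err r.1 r.2) =
        physicalCNOT p hp err s t := by
      rw [pair_pure, PMF.pure_bind]
    exact e ▸ (fails_physicalCNOT p hp err s t).mono le_rfl fun ρ h =>
      ⟨_, _, rfl, rfl, h.trans (pair_pure _ _).symm⟩

/-! ### Comparison with the real parameters -/

variable {k : ℕ} {G : Gadgets k} {T : Pauli → PMF (Block k) → Prop}

theorem coe_div_one_sub (y : ℝ≥0) {x : ℝ≥0} (hx : x < 1) :
    ((y / (1 - x) : ℝ≥0) : ℝ≥0∞) = y / (1 - x) := by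
  rw [ENNReal.coe_div (tsub_pos_of_lt hx).ne', ENNReal.coe_sub, ENNReal.coe_one]

theorem Claims.verified_params {P : Params} (hA : 0 ≤ P.A) (hB : 0 ≤ P.B) (hC : 0 ≤ P.C)
    (h : Claims G T (ENNReal.ofReal P.A) (ENNReal.ofReal P.B) (ENNReal.ofReal P.C))
    (hN : 0 < P.next.N) (hA1 : P.next.A < 1) :
    0 ≤ P.next.A ∧ 0 ≤ P.next.a ∧
    ENNReal.ofReal P.next.N ≤ (attempt G).toOuterMeasure (accepted k) ∧
      Fails (ENNReal.ofReal P.next.A) (Labelled T (ENNReal.ofReal P.next.a) 0) (verified G) := by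
  obtain ⟨N₀, A, a₀, Bp₀, b₀, B, C⟩ := P
  simp only at hA hB hC h
  lift A to ℝ≥0 using hA
  lift B to ℝ≥0 using hB
  lift C to ℝ≥0 using hC
  simp only [ENNReal.ofReal_coe_nnreal] at h
  set P' := Params.next _ with hP'
  set x : ℝ≥0 := 14 * A + 14 * B + 25 * C with hx
  set y : ℝ≥0 := 91 * (A ^ 2 + B ^ 2) + 300 * C ^ 2 + 350 * (A + B) * C + 196 * A * B with hy
  have eN : P'.N = 1 - x := by
    rw [hP', hx]
    simp only [Params.next]
    push_cast
    ring
  have hx1 : x < 1 := by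
    rw [eN, sub_pos] at hN
    exact_mod_cast hN
  have eA : P'.A = (y / (1 - x) : ℝ≥0) := by
    rw [NNReal.coe_div, NNReal.coe_sub hx1.le, NNReal.coe_one, ← eN, hP', hy]
    simp only [Params.next]
    congr 1
    norm_num [Nat.choose]
  set A' : ℝ≥0 := y / (1 - x) with hA'
  have hA'1 : A' < 1 := by
    rw [eA] at hA1
    exact_mod_cast hA1
  have ea : P'.a = (x / (1 - x) / (1 - A') : ℝ≥0) := by
    have e1 : P'.a = (2 * 7 * ((A : ℝ) + B) + (2 * 9 + 7) * C) / ((1 - P'.A) * P'.N) := rfl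
    rw [e1, NNReal.coe_div, NNReal.coe_div, NNReal.coe_sub hx1.le, NNReal.coe_sub hA'1.le,
      NNReal.coe_one, eN, eA, div_div, mul_comm (1 - (x : ℝ))]
    congr 1
    rw [hx]
    push_cast
    ring
  obtain ⟨h1, h2⟩ := h.verified_anc (x := x) (y := y) (A' := A') (a := (x / (1 - x) / (1 - A') : ℝ≥0))
    (by rw [hx]; push_cast; rfl) (by rw [hy]; push_cast; rfl) (by exact_mod_cast hx1)
    (coe_div_one_sub y hx1) (by exact_mod_cast hA'1)
    (by rw [coe_div_one_sub _ hA'1, coe_div_one_sub _ hx1])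
  refine ⟨eA ▸ NNReal.coe_nonneg _, ea ▸ NNReal.coe_nonneg _, ?_, ?_⟩
  · rw [eN, ENNReal.ofReal_sub _ (NNReal.coe_nonneg x), ENNReal.ofReal_one,
      ENNReal.ofReal_coe_nnreal]
    exact h1
  · rw [eA, ea, ENNReal.ofReal_coe_nnreal, ENNReal.ofReal_coe_nnreal]
    exact h2

/-- Here `B'` plays the role of `e`, and `b` equals `2 * h₁ / (1 - B')`. It dominates `h₁ / (1 - (2
* A' + h₂))`, with `A'` the new ancilla bound, as well as `a`, which is at most `2 * h₁`. -/
theorem Claims.next_params {P : Params} (hA : 0 ≤ P.A) (hB : 0 ≤ P.B) (hC : 0 ≤ P.C)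
    (h : Claims G T (ENNReal.ofReal P.A) (ENNReal.ofReal P.B) (ENNReal.ofReal P.C))
    (hN : 0 < P.next.N) (hA1 : P.next.A < 1) (hBp : P.next.B ≤ P.next.Bp) (hBp1 : P.next.Bp < 1) :
    0 ≤ P.next.A ∧ 0 ≤ P.next.b ∧ 0 ≤ P.next.B ∧ 0 ≤ P.next.C ∧
    Claims ⟨verified G, nextEC G, nextCNOT G⟩ (Labelled T (ENNReal.ofReal P.next.b))
      (ENNReal.ofReal P.next.A) (ENNReal.ofReal P.next.B) (ENNReal.ofReal P.next.C) := by
  obtain ⟨hA', ha, -, h1⟩ := h.verified_params hA hB hC hN hA1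
  have eb : P.next.b = (4 * P.next.a + 2 * 7 * P.B + 4 * 7 * P.C) / (1 - P.next.Bp) := rfl
  have eBp : P.next.Bp = 4 * P.next.A + (4 * P.next.a + 2 * 7 * P.B + 4 * 7 * P.C) := rfl
  have eB : P.next.B = 4 * P.next.A + 378 * P.C ^ 2 + 6 * P.next.a ^ 2 + 91 * P.B ^ 2 +
      P.next.b * (4 * 7 * P.C + 4 * P.next.a + 2 * 7 * P.B) +
      4 * 7 * P.C * (4 * P.next.a + 2 * 7 * P.B) + 8 * 7 * P.next.a * P.B := by
    simp only [Params.next]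
    norm_num [Nat.choose]
  have eC : P.next.C = (2 * P.next.B + 2 * 7 * P.C * P.next.Bp + 21 * P.C ^ 2) +
      2 * P.next.b * (2 * P.next.Bp + 7 * P.C) + P.next.b ^ 2 := by
    simp only [Params.next]
    norm_num [Nat.choose]
  generalize P.next = P' at *
  obtain ⟨N₀, A, a₀, Bp₀, b₀, B, C⟩ := P
  obtain ⟨N', A', a, Bp, b, B', C'⟩ := P'
  simp only at *
  lift A to ℝ≥0 using hA
  lift B to ℝ≥0 using hB
  lift C to ℝ≥0 using hC
  lift A' to ℝ≥0 using hA'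
  lift a to ℝ≥0 using ha
  have hσ : 0 ≤ 4 * (a : ℝ) + 2 * 7 * B + 4 * 7 * C := by positivity
  have hpos : 0 < 1 - Bp := sub_pos.mpr hBp1
  have hb : 0 ≤ b := eb ▸ div_nonneg hσ hpos.le
  have hBp0 : 0 ≤ Bp := by rw [eBp]; positivity
  lift Bp to ℝ≥0 using hBp0
  lift b to ℝ≥0 using hb
  have hB0 : 0 ≤ B' := by rw [eB]; positivity
  lift B' to ℝ≥0 using hB0
  have hC0 : 0 ≤ C' := by rw [eC]; positivity
  lift C' to ℝ≥0 using hC0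
  simp only [ENNReal.ofReal_coe_nnreal] at h h1 ⊢
  refine ⟨A'.2, b.2, B'.2, C'.2, ?_⟩
  set h₁ : ℝ≥0 := 7 * B + 2 * a + 14 * C with hh₁
  set h₂ : ℝ≥0 := a ^ 2 + 21 * B ^ 2 + 91 * C ^ 2 + 14 * a * B + 98 * B * C + 28 * a * C with hh₂
  have f₁ : (h₁ : ℝ) = 7 * B + 2 * a + 14 * C := by rw [hh₁]; push_cast; rfl
  have f₂ : (h₂ : ℝ) = a ^ 2 + 21 * B ^ 2 + 91 * C ^ 2 + 14 * a * B + 98 * B * C + 28 * a * C := by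
    rw [hh₂]; push_cast; rfl
  have eB2 : 4 * (A' : ℝ) + 2 * h₂ + h₁ ^ 2 + b * (2 * h₁) = B' := by
    rw [eB, f₁, f₂]; ring
  have eb2 : (b : ℝ) * (1 - Bp) = 2 * h₁ := by
    rw [eb, div_mul_cancel₀ _ hpos.ne', f₁]; ring
  have n1 : (0 : ℝ) ≤ h₁ := h₁.2
  have n2 : (0 : ℝ) ≤ h₂ := h₂.2
  have nb : (0 : ℝ) ≤ b := b.2
  have nA : (0 : ℝ) ≤ A' := A'.2
  have nBp : (0 : ℝ) ≤ Bp := Bp.2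
  -- By `eB2` twice the left-hand side is at most the new `B`, which `hBp` bounds by `Bp`.
  have hφ : 2 * (A' : ℝ) + h₂ ≤ Bp := by
    have := mul_nonneg nb n1
    nlinarith
  have hφ1 : 2 * A' + h₂ < 1 := by
    have := hφ.trans_lt hBp1
    exact_mod_cast this
  refine h.next (h₁ := h₁) (h₂ := h₂) (e := Bp) h1 (by rw [hh₁]; push_cast; rfl)
    (by rw [hh₂]; push_cast; rfl) (by exact_mod_cast hφ1) ?_ ?_ ?_ (by exact_mod_cast eB2) ?_
  · have := coe_div_one_sub h₁ hφ1
    push_cast at this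
    rw [← this]
    refine ENNReal.coe_le_coe.mpr (NNReal.coe_le_coe.mp ?_)
    rw [NNReal.coe_div, NNReal.coe_sub hφ1.le]
    push_cast
    rw [div_le_iff₀ (by linarith)]
    nlinarith [mul_le_mul_of_nonneg_left hφ nb]
  · refine ENNReal.coe_le_coe.mpr (NNReal.coe_le_coe.mp ?_)
    have : (a : ℝ) ≤ 2 * h₁ := by
      rw [f₁]
      nlinarith [a.2, B.2, C.2]
    nlinarith [mul_nonneg nb nBp]
  · have : (Bp : ℝ) = 4 * A' + 2 * h₁ := by rw [eBp, f₁]; ring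
    exact_mod_cast this
  · have : 2 * (B' : ℝ) + 14 * C * Bp + 21 * C ^ 2 + 2 * b * (2 * Bp + 7 * C) + b ^ 2 = C' := by
      rw [eC]; ring
    exact_mod_cast this

/-- `q` is prescribed only at the levels `1` to `k`, so its value at level `k + 1` stays free and
can be taken from `a` for the verified ancilla. -/
theorem claims_gadgets (p : ℝ≥0) (hp : p ≤ 1) (err : PMF (Pauli × Pauli)) {q : ℕ → ℝ≥0∞} :
    (k : ℕ) → (∀ j, 1 ≤ j → j ≤ k → 0 < (params p j).N) →
    (∀ j, 1 ≤ j → j ≤ k → (params p j).A < 1) →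
    (∀ j, 1 ≤ j → j ≤ k → (params p j).B ≤ (params p j).Bp ∧ (params p j).Bp < 1) →
    (∀ j, 1 ≤ j → j ≤ k → q j = ENNReal.ofReal (params p j).b) →
    0 ≤ (params p k).A ∧ 0 ≤ (params p k).B ∧ 0 ≤ (params p k).C ∧
      (∀ j, 1 ≤ j → j ≤ k → 0 ≤ (params p j).b) ∧
      Claims (gadgets p hp err k) (Tame q k) (ENNReal.ofReal (params p k).A)
        (ENNReal.ofReal (params p k).B) (ENNReal.ofReal (params p k).C)
  | 0, _, _, _, _ => by
    refine ⟨le_rfl, le_rfl, p.2, fun j hj hj' => by omega, ?_⟩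
    have := claims_zero p hp err q
    simp only [params, ENNReal.ofReal_zero, ENNReal.ofReal_coe_nnreal]
    exact this
  | k + 1, hN, hA, hB, hq => by
    obtain ⟨h1, h2, h3, h4, h5⟩ := claims_gadgets p hp err (q := q) k
      (fun j hj hj' => hN j hj (by omega)) (fun j hj hj' => hA j hj (by omega))
      (fun j hj hj' => hB j hj (by omega)) (fun j hj hj' => hq j hj (by omega))
    obtain ⟨h6, h7⟩ := hB (k + 1) (by omega) le_rfl
    obtain ⟨g1, g2, g3, g4, g5⟩ := h5.next_params h1 h2 h3 (hN (k + 1) (by omega) le_rfl)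
      (hA (k + 1) (by omega) le_rfl) h6 h7
    refine ⟨g1, g3, g4, fun j hj hj' => ?_, ?_⟩
    · rcases Nat.lt_or_ge k j with h | h
      · obtain rfl : j = k + 1 := by omega
        exact g2
      · exact h4 j hj h
    · have e : ENNReal.ofReal (params p k).next.b = q (k + 1) := (hq (k + 1) (by omega) le_rfl).symm
      rw [e] at g5
      exact g5

end Levels

end FT

end

open FT
/-- Preparation of a verified level-`(k + 1)` ancilla. -/
theorem mainTheorem4 (p : ℝ≥0) (hp : p ≤ 1) (err : PMF (Pauli × Pauli)) (k : ℕ)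
    (hN : ∀ j, 1 ≤ j → j ≤ k + 1 → 0 < (params p j).N)
    (hA : ∀ j, 1 ≤ j → j ≤ k + 1 → (params p j).A < 1)
    (hB : ∀ j, 1 ≤ j → j ≤ k → (params p j).B ≤ (params p j).Bp ∧ (params p j).Bp < 1) :
    -- the noiseless circuit prepares `|0⟩`, and bookkeeping does not change the physical state
    ((idealAttempt k = fun y z => codeKet (k + 1) 0 y * codeKet (k + 1) 0 z) ∧
      ∀ e : Block (k + 1),
        pauliKet (reduceZ e) (codeKet (k + 1) 0) = pauliKet e (codeKet (k + 1) 0)) ∧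
    -- the acceptance probability
    (params p (k + 1)).N ≤
      ((attempt (gadgets p hp err k)).toOuterMeasure (accepted k)).toReal ∧
    -- the accepted ancilla: a hidden failure flag, and the law of the errors given the flag
    ∃ (fail : PMF Bool) (out : Bool → PMF (Block (k + 1))),
      (gadgets p hp err (k + 1)).anc = fail.bind out ∧
      (fail true).toReal ≤ (params p (k + 1)).A ∧
      (∀ e ∈ (out false).support, state (k + 1) e = 0) ∧
      Well (fun j => if j = k + 1 then (params p (k + 1)).a else (params p j).b) (k + 1)
        (out false) := by
  refine ⟨⟨idealAttempt_eq k, pauliKet_reduceZ⟩, ?_⟩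
  -- The parameter `a` is used only at the top level; all subblocks have passed error correction or
  -- gates and carry the parameters `b`.
  set r : ℕ → ℝ := fun j => if j = k + 1 then (params p (k + 1)).a else (params p j).b with hr
  set q : ℕ → ℝ≥0∞ := fun j => ENNReal.ofReal (r j) with hq
  have hr' : ∀ j, j ≤ k → r j = (params p j).b := fun j hj => if_neg (by omega)
  have hrk : r (k + 1) = (params p (k + 1)).a := if_pos rfl
  obtain ⟨h1, h2, h3, h4, h5⟩ := claims_gadgets p hp err (q := q) k
    (fun j hj hj' => hN j hj (by omega)) (fun j hj hj' => hA j hj (by omega)) hB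
    (fun j hj hj' => congrArg ENNReal.ofReal (hr' j hj'))
  obtain ⟨h6, h7, h8, h9⟩ := h5.verified_params h1 h2 h3 (hN (k + 1) (by omega) le_rfl)
    (hA (k + 1) (by omega) le_rfl)
  have hA1 : (params p (k + 1)).A < 1 := hA (k + 1) (by omega) le_rfl
  obtain ⟨fail, out, g1, g2, π, g3, g4⟩ := h9.exists_flag
    (ENNReal.ofReal_lt_one.mpr (hA (k + 1) (by omega) le_rfl))
  have g5 : ∀ c ∈ π.support, Tame q (k + 1) 0 c.2 := by
    intro c hc
    have e : q (k + 1) = ENNReal.ofReal (params p k).next.a := congrArg ENNReal.ofReal hrk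
    have := g4 c hc
    rw [← e] at this
    exact this
  refine ⟨?_, fail, out, g1, ENNReal.toReal_le_of_le_ofReal h6 g2, ?_, ?_⟩
  · exact (ENNReal.ofReal_le_iff_le_toReal
      (ne_top_of_le_ne_top ENNReal.one_ne_top (toOuterMeasure_le_one _ _))).mp h8
  · intro e he
    rw [g3] at he
    obtain ⟨c, hc, hec⟩ := (PMF.mem_support_bind_iff _ _ _).mp he
    exact (sound_tame q (k + 1)).state_eq (g5 c hc) e hec
  · rw [g3]
    refine well_bind (q := q) (fun j hj hj' => ⟨?_, le_rfl⟩) π _ fun c hc => ⟨0, g5 c hc⟩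
    rcases Nat.lt_or_ge k j with h | h
    · obtain rfl : j = k + 1 := by omega
      rw [hrk]
      exact h7
    · rw [hr' j h]
      exact h4 j hj h
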